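/- Let $(R,\mu)$ be a $\sigma$-finite nonatomic measure space, let $1<p<\infty$ and $1\le s\le\infty$, and let $p',s'$ be the conjugate exponents, $1/p+1/p'=1$ and $1/s+1/s'=1$ (with $1'=\infty$, $\infty'=1$). For a measurable function $f:R\to\mathbb{R}$ let $f^*(t)=\inf\{\lambda\ge 0:\mu(\{|f|>\lambda\})\le t\}$, $t>0$, be its non-increasing rearrangement, and for $1<q<\infty$, $1\le r\le\infty$ set $$\|f\|_{q,r}=\left(\int_0^\infty\bigl(t^{1/q}f^*(t)\bigr)^r\,\frac{dt}{t}\right)^{1/r}\quad(r<\infty),\qquad \|f\|_{q,\infty}=\sup_{t>0}t^{1/q}f^*(t).$$ Let $L^{q,r}(R,\mu)$ be the set of measurable $f$ with $\|f\|_{q,r}<\infty$, functions that agree almost everywhere being identified. For $f\in L^{p,s}(R,\mu)$ define the dual (Köthe) norm $$\|f\|'_{p,s}=\sup\left\{\int_R fg\,d\mu:\ g\in L^{p',s'}(R,\mu),\ \|g\|_{p',s'}=1\right\}$$ (with $\sup\emptyset=0$ when $\mu(R)=0$) and the decomposition norm $$\|f\|_{(p,s)}=\inf\left\{\sum_k\|f_k\|_{p,s}\right\},$$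 where the infimum is taken over all finite representations $f=\sum_k f_k$ with $f_k\in L^{p,s}(R,\mu)$. Then, for every $f\in L^{p,s}(R,\mu)$, the function $fg$ is integrable for all $g\in L^{p',s'}(R,\mu)$, and $$\|f\|'_{p,s}=\|f\|_{(p,s)}.$$ -/

import Mathlib

open MeasureTheory
open scoped ENNReal

noncomputable section

namespace Lorentz

variable {R : Type*} [MeasurableSpace R]

/-- A measure is nonatomic if every measurable set of positive measure has a measurable subset
of strictly smaller positive measure. (This is stronger than singletons being null.) -/
def IsNonatomic (μ : Measure R) : Prop :=
  ∀ A : Set R, MeasurableSet A → 0 < μ A →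
    ∃ B : Set R, B ⊆ A ∧ MeasurableSet B ∧ 0 < μ B ∧ μ B < μ A

/-- The non-increasing rearrangement `f*(t) = inf {l ≥ 0 : μ {|f| > l} ≤ t}`, for `t ≥ 0`
(with value `∞` if there is no finite such `l`). -/
def rearrangement (μ : Measure R) (f : R → ℝ) (t : ℝ) : ℝ≥0∞ :=
  sInf {l : ℝ≥0∞ | μ {x | l < ‖f x‖ₑ} ≤ ENNReal.ofReal t}

/-- The Lorentz functional `‖f‖_{p,s}`: it is `(∫₀^∞ (t^{1/p} f*(t))^s dt/t)^{1/s}` for `s < ∞`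
and `sup_{t > 0} t^{1/p} f*(t)` for `s = ∞`. -/
def lorentzNorm (μ : Measure R) (p : ℝ) (s : ℝ≥0∞) (f : R → ℝ) : ℝ≥0∞ :=
  if s = ∞ then
    ⨆ t ∈ Set.Ioi (0 : ℝ), ENNReal.ofReal t ^ (1 / p) * rearrangement μ f t
  else
    (∫⁻ t in Set.Ioi (0 : ℝ),
      (ENNReal.ofReal t ^ (1 / p) * rearrangement μ f t) ^ s.toReal / ENNReal.ofReal t) ^
        (1 / s.toReal)

/-- Membership in the Lorentz space `L^{p,s}(R,μ)`. -/
def MemLorentz (μ : Measure R) (p : ℝ) (s : ℝ≥0∞) (f : R → ℝ) : Prop :=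
  AEMeasurable f μ ∧ lorentzNorm μ p s f < ∞

/-- The dual (Köthe) norm `‖f‖'_{p,s} = sup {∫ f g dμ : ‖g‖_{p',s'} = 1}`. It takes values in
`[0,∞]`; cutting off negative integrals does not matter since `g` may be replaced by `-g`. -/
def dualNorm (μ : Measure R) (p : ℝ) (s : ℝ≥0∞) (f : R → ℝ) : ℝ≥0∞ :=
  ⨆ (g : R → ℝ) (_ : AEMeasurable g μ)
    (_ : lorentzNorm μ p.conjExponent s.conjExponent g = 1),
    ENNReal.ofReal (∫ x, f x * g x ∂μ)

/-- The decomposition norm `‖f‖_{(p,s)} = inf Σ_k ‖f_k‖_{p,s}`, the infimum being taken over all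
finite representations `f = Σ_k f_k` (almost everywhere) with `f_k ∈ L^{p,s}(R,μ)`. -/
def decompNorm (μ : Measure R) (p : ℝ) (s : ℝ≥0∞) (f : R → ℝ) : ℝ≥0∞ :=
  ⨅ (n : ℕ) (F : Fin n → R → ℝ) (_ : ∀ k, MemLorentz μ p s (F k))
    (_ : f =ᵐ[μ] fun x => ∑ k, F k x),
    ∑ k, lorentzNorm μ p s (F k)

end Lorentz

end

/-!
The inequality `‖f‖' ≤ ‖f‖_{(p,s)}` and the integrability of `f g` come from Hölder's inequality
`∫ |f g| ≤ ‖f‖_{p,s} ‖g‖_{p',s'}` (`lintegral_mul_le_lorentzNorm`), which follows from the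
Hardy–Littlewood inequality and Hölder's inequality on the half-line, applied to each summand of a
decomposition. For the reverse inequality there are three cases.

If `s ≤ p`, both norms are equal to `‖f‖_{p,s}`. A nonatomic set of finite measure carries a
uniformly distributed function, so a function `g` with finitely many levels has a
measure-preserving parametrisation `σ`, higher levels coming first. As `s ≤ p`, the extremal
function `φ(t) = t^{s/p-1} g*(t)^{s-1}` of Hölder's inequality on the half-line is non-increasing;
hence it is the rearrangement of `φ ∘ σ`, and Hölder's inequality for `g` is sharp
(`lorentzNorm_le_of_forall_lintegral_mul_le`).

If `p ≤ s < ∞`, simple functions are dense and it suffices to treat a simple function `k`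
supported on a set `S` of finite measure. By Hahn–Banach there is a linear functional that is
dominated by the decomposition norm and norms `k`. It is countably additive on indicators, so it
has a density `g` by Radon–Nikodym. Since `s' ≤ p'`, the first case applies to `g` and gives
`‖g‖_{p',s'} ≤ 1`, so that the dual norm of `k` is at least its decomposition norm
(`decompNorm_le_dualNorm_of_ge`).

If `s = ∞`, functionals need not have densities and a decomposition is constructed. After scaling,
the pairing with indicators gives `∫_A |f| ≤ p' μ(A)^{1/p'} = ∫₀^{μ(A)} t^{-1/p} dt` for all `A`,
and it has to be shown that the decomposition norm is at most `1`. Suppose first that the values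
of `|f|` lie in an interval `(L, E L]`. Cut the support into cells of measure at most a small
number `c` on which `|f|` is almost constant. The condition on `f` says that the vector of its
values lies in a polymatroid, whose vertices are found by the greedy algorithm: for an order of
the cells, the value at a cell is that of a fixed profile `φ ≈ t^{-1/p}` at the total mass of the
preceding cells. By Hahn–Banach the vector lies below a convex combination of these vertices, and
each vertex is a function of weak norm about `1` (`exists_block_majorants`). The weights of the
combination can be taken equal and the number of vertices independent of `L`. If the range of
`|f|` is a union of such intervals separated by long gaps, then pasting the vertices of the
different blocks together still gives functions of weak norm about `1`, since at each level only
one block matters (`decompNorm_le_of_gaps`). In general, deleting from `f` one out of `M` residue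
classes of levels produces the gaps, and averaging over the classes costs only a factor close to
`1` (`decompNorm_top_le_pow`).
-/

namespace Lorentz

/-! ### The non-increasing rearrangement -/

section Rearrangement

variable {R : Type*} [MeasurableSpace R] {μ : Measure R} {f g : R → ℝ}

/-- The Galois connection between the rearrangement and the distribution function. -/
lemma rearrangement_le_iff {t : ℝ} {l : ℝ≥0∞} :
    rearrangement μ f t ≤ l ↔ μ {x | l < ‖f x‖ₑ} ≤ ENNReal.ofReal t := by
  refine ⟨fun h => ?_, fun h => sInf_le h⟩
  -- right-continuity of the distribution function: `{l < |f|}` is the union of `{l' < |f|}` over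
  -- the `l'` above `l`
  rcases eq_or_ne l ∞ with rfl | hl
  · simp
  obtain ⟨u, hu, hlu, hlim⟩ := exists_seq_strictAnti_tendsto' (lt_top_iff_ne_top.2 hl)
  have hU : {x | l < ‖f x‖ₑ} = ⋃ n, {x | u n < ‖f x‖ₑ} := by
    ext x
    simp only [Set.mem_ofPred_eq, Set.mem_iUnion]
    constructor
    · intro hx
      exact ((tendsto_order.1 hlim).2 _ hx).exists
    · rintro ⟨n, hn⟩
      exact (hlu n).1.trans hn
  have hmono : Monotone fun n => {x | u n < ‖f x‖ₑ} := fun m n hmn x hx =>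
    lt_of_le_of_lt (hu.antitone hmn) hx
  rw [hU, hmono.measure_iUnion]
  refine iSup_le fun n => ?_
  obtain ⟨l', hl', hl'n⟩ := sInf_lt_iff.1 (h.trans_lt (hlu n).1)
  exact (measure_mono fun x hx => lt_trans hl'n hx).trans hl'

lemma lt_rearrangement_iff {t : ℝ} {l : ℝ≥0∞} :
    l < rearrangement μ f t ↔ ENNReal.ofReal t < μ {x | l < ‖f x‖ₑ} := by
  rw [← not_le, rearrangement_le_iff, not_le]

lemma rearrangement_antitone : Antitone (rearrangement μ f) := fun _ _ hst =>
  rearrangement_le_iff.2 ((rearrangement_le_iff.1 le_rfl).trans (ENNReal.ofReal_le_ofReal hst))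

lemma measurable_rearrangement : Measurable (rearrangement μ f) :=
  rearrangement_antitone.measurable

lemma rearrangement_mono (h : ∀ᵐ x ∂μ, ‖f x‖ₑ ≤ ‖g x‖ₑ) (t : ℝ) :
    rearrangement μ f t ≤ rearrangement μ g t := by
  refine rearrangement_le_iff.2
    (le_trans (measure_mono_ae ?_) (rearrangement_le_iff.1 (le_refl (rearrangement μ g t))))
  filter_upwards [h] with x hx h'
  exact lt_of_lt_of_le h' hx

lemma rearrangement_const_mul {c : ℝ} (hc : c ≠ 0) (t : ℝ) :
    rearrangement μ (fun x => c * f x) t = ‖c‖ₑ * rearrangement μ f t := by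
  have hc0 : ‖c‖ₑ ≠ 0 := by simpa using hc
  have hct : ‖c‖ₑ ≠ ∞ := by simp
  refine eq_of_forall_ge_iff fun l => ?_
  rw [rearrangement_le_iff, mul_comm, ← ENNReal.le_div_iff_mul_le (Or.inl hc0) (Or.inl hct),
    rearrangement_le_iff]
  simp_rw [enorm_mul, ENNReal.div_lt_iff (Or.inl hc0) (Or.inl hct), mul_comm]

lemma rearrangement_eq_zero_of_measure_le {t : ℝ}
    (h : μ {x | f x ≠ 0} ≤ ENNReal.ofReal t) : rearrangement μ f t = 0 := by
  rw [← nonpos_iff_eq_zero, rearrangement_le_iff]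
  refine le_trans (measure_mono fun x hx => ?_) h
  simpa using hx

end Rearrangement

/-! ### Weighted functionals on the half-line -/

section HalfLine

/-- The functional `(∫₀^∞ (t^{1/p} u(t))^s dt/t)^{1/s}` (`sup_{t>0} t^{1/p} u(t)` for `s = ∞`) of a
function `u` on the half-line; the Lorentz functional is its value at the rearrangement. -/
noncomputable def halfLineNorm (p : ℝ) (s : ℝ≥0∞) (u : ℝ → ℝ≥0∞) : ℝ≥0∞ :=
  if s = ∞ then
    ⨆ t ∈ Set.Ioi (0 : ℝ), ENNReal.ofReal t ^ (1 / p) * u t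
  else
    (∫⁻ t in Set.Ioi (0 : ℝ),
      (ENNReal.ofReal t ^ (1 / p) * u t) ^ s.toReal / ENNReal.ofReal t) ^ (1 / s.toReal)

lemma lorentzNorm_eq {R : Type*} [MeasurableSpace R] (μ : Measure R) (p : ℝ) (s : ℝ≥0∞)
    (f : R → ℝ) : lorentzNorm μ p s f = halfLineNorm p s (rearrangement μ f) := rfl

variable {p : ℝ} {s : ℝ≥0∞} {u v : ℝ → ℝ≥0∞}

lemma halfLineNorm_mono (h : ∀ t, 0 < t → u t ≤ v t) :
    halfLineNorm p s u ≤ halfLineNorm p s v := by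
  unfold halfLineNorm
  split_ifs with hs
  · exact iSup₂_mono fun t ht => by gcongr; exact h t ht
  · refine ENNReal.rpow_le_rpow (setLIntegral_mono' measurableSet_Ioi fun t ht => ?_)
      (by positivity)
    gcongr
    exact h t ht

lemma halfLineNorm_const_mul (hs : 1 ≤ s) {c : ℝ≥0∞} (hc : c ≠ ∞) :
    halfLineNorm p s (fun t => c * u t) = c * halfLineNorm p s u := by
  unfold halfLineNorm
  split_ifs with hs'
  · simp_rw [ENNReal.mul_iSup, mul_left_comm]
  · have hs0 : 0 < s.toReal := ENNReal.toReal_pos (zero_lt_one.trans_le hs).ne' hs'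
    simp_rw [mul_left_comm _ c, ENNReal.mul_rpow_of_nonneg _ _ hs0.le, mul_div_assoc]
    rw [lintegral_const_mul' _ _ (ENNReal.rpow_ne_top_of_nonneg hs0.le hc),
      ENNReal.mul_rpow_of_nonneg _ _ (by positivity), ← ENNReal.rpow_mul, mul_one_div,
      div_self hs0.ne', ENNReal.rpow_one]

/-- The integrand of the functional as a power of `t` times a power of `u`. -/
lemma halfLine_integrand {t : ℝ} (ht : 0 < t) {q : ℝ} (hq : 0 ≤ q) (a : ℝ≥0∞) :
    (ENNReal.ofReal t ^ (1 / p) * a) ^ q / ENNReal.ofReal t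
      = ENNReal.ofReal t ^ (q / p - 1) * a ^ q := by
  have h0 : ENNReal.ofReal t ≠ 0 := by simpa using ht
  rw [ENNReal.mul_rpow_of_nonneg _ _ hq, ← ENNReal.rpow_mul, ENNReal.rpow_sub _ _ h0 (by simp),
    ENNReal.rpow_one, one_div_mul_eq_div, div_eq_mul_inv, div_eq_mul_inv (_ ^ _)]
  ring

lemma halfLineNorm_of_ne_top (hs : s ≠ ∞) :
    halfLineNorm p s u = (∫⁻ t in Set.Ioi (0 : ℝ),
      ENNReal.ofReal t ^ (s.toReal / p - 1) * u t ^ s.toReal) ^ (1 / s.toReal) := by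
  rw [halfLineNorm, if_neg hs]
  congr 1
  exact setLIntegral_congr_fun measurableSet_Ioi fun t ht =>
    halfLine_integrand ht ENNReal.toReal_nonneg _

lemma halfLineNorm_rpow (hs : s ≠ ∞) (hs1 : 1 ≤ s) :
    halfLineNorm p s u ^ s.toReal = ∫⁻ t in Set.Ioi (0 : ℝ),
      ENNReal.ofReal t ^ (s.toReal / p - 1) * u t ^ s.toReal := by
  have hs0 : 0 < s.toReal := ENNReal.toReal_pos (zero_lt_one.trans_le hs1).ne' hs
  rw [halfLineNorm_of_ne_top hs, ← ENNReal.rpow_mul, one_div_mul_cancel hs0.ne', ENNReal.rpow_one]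

lemma lintegral_Ioo_rpow {a m : ℝ} (ha : 0 < a) (hm : 0 ≤ m) :
    ∫⁻ t in Set.Ioo (0 : ℝ) m, ENNReal.ofReal t ^ (a - 1) = ENNReal.ofReal (m ^ a / a) := by
  have hI : IntegrableOn (fun t : ℝ => t ^ (a - 1)) (Set.Ioo 0 m) := by
    have := intervalIntegral.intervalIntegrable_rpow' (a := 0) (b := m) (r := a - 1) (by linarith)
    rw [intervalIntegrable_iff, Set.uIoc_of_le hm] at this
    exact this.mono_set Set.Ioo_subset_Ioc_self
  have h1 : ∫ t in Set.Ioo (0 : ℝ) m, t ^ (a - 1) = m ^ a / a := by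
    rw [← integral_Ioc_eq_integral_Ioo, ← intervalIntegral.integral_of_le hm,
      integral_rpow (Or.inl (by linarith))]
    simp [Real.zero_rpow ha.ne']
  rw [← h1, ofReal_integral_eq_lintegral_ofReal hI]
  · refine setLIntegral_congr_fun measurableSet_Ioo fun t ht => ?_
    exact ENNReal.ofReal_rpow_of_pos ht.1
  · exact (ae_restrict_mem measurableSet_Ioo).mono fun t ht => Real.rpow_nonneg ht.1.le _

lemma halfLineNorm_const_eq_top (hp : 0 < p) (hs : 1 ≤ s) {c : ℝ≥0∞} (hc : c ≠ 0) :
    halfLineNorm p s (fun _ => c) = ∞ := by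
  have hpow : ∀ {a : ℝ}, 0 < a → Filter.Tendsto (fun n : ℕ => ENNReal.ofReal ((n : ℝ) ^ a / a))
      Filter.atTop (nhds ∞) := fun {a} ha => ENNReal.tendsto_ofReal_nhds_top.2
    (((tendsto_rpow_atTop ha).comp tendsto_natCast_atTop_atTop).atTop_div_const ha)
  by_cases hst : s = ∞
  · rw [halfLineNorm, if_pos hst]
    rw [← top_le_iff]
    have h1 : Filter.Tendsto (fun n : ℕ => ENNReal.ofReal (n : ℝ) ^ (1 / p) * c) Filter.atTop
        (nhds (∞ * c)) := by
      refine ENNReal.Tendsto.mul_const ?_ (Or.inl (by simp))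
      have h2 := ((ENNReal.continuous_rpow_const (y := 1 / p)).tendsto ∞).comp
        (ENNReal.tendsto_ofReal_nhds_top.2 tendsto_natCast_atTop_atTop)
      rwa [ENNReal.top_rpow_of_pos (show 0 < 1 / p by positivity)] at h2
    rw [ENNReal.top_mul hc] at h1
    refine le_of_tendsto h1 ((Filter.eventually_gt_atTop 0).mono fun n hn => ?_)
    exact le_iSup₂_of_le (n : ℝ) (show (n : ℝ) ∈ Set.Ioi 0 by simpa using hn) le_rfl
  · have hs0 : 0 < s.toReal := ENNReal.toReal_pos (zero_lt_one.trans_le hs).ne' hst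
    rw [halfLineNorm_of_ne_top hst]
    have h0 : ∫⁻ t in Set.Ioi (0 : ℝ), ENNReal.ofReal t ^ (s.toReal / p - 1) = ∞ := by
      rw [← top_le_iff]
      refine le_of_tendsto (hpow (div_pos hs0 hp)) (Filter.Eventually.of_forall fun n => ?_)
      rw [← lintegral_Ioo_rpow (div_pos hs0 hp) n.cast_nonneg]
      exact lintegral_mono_set Set.Ioo_subset_Ioi_self
    have hc' : c ^ s.toReal ≠ 0 := by
      simp [ENNReal.rpow_eq_zero_iff, hc, hs0.not_gt]
    rw [lintegral_mul_const _ (by fun_prop), h0, ENNReal.top_mul hc',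
      ENNReal.top_rpow_of_pos (by positivity)]

end HalfLine

/-! ### The Hardy–Littlewood and Hölder inequalities -/

lemma volume_restrict_Ioi_lt (a : ℝ≥0∞) :
    volume.restrict (Set.Ioi (0 : ℝ)) {t | ENNReal.ofReal t < a} = a := by
  rw [Measure.restrict_apply (measurableSet_lt (by fun_prop) (by fun_prop))]
  rcases eq_or_ne a ∞ with rfl | ha
  · simp
  · have : {t : ℝ | ENNReal.ofReal t < a} ∩ Set.Ioi 0 = Set.Ioo 0 a.toReal := by
      ext t
      simp only [Set.mem_inter_iff, Set.mem_ofPred_eq, Set.mem_Ioi, Set.mem_Ioo]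
      rw [and_comm]
      refine and_congr_right fun ht => ?_
      rw [ENNReal.ofReal_lt_iff_lt_toReal ht.le ha]
    rw [this, Real.volume_Ioo, sub_zero, ENNReal.ofReal_toReal ha]

/-- Layer-cake formula for a product. -/
lemma lintegral_mul_eq_lintegral_measure {α : Type*} [MeasurableSpace α] (m : Measure α)
    [SFinite m] {F G : α → ℝ≥0∞} (hF : Measurable F) (hG : Measurable G) :
    ∫⁻ x, F x * G x ∂m =
      ∫⁻ z : ℝ × ℝ, m {x | ENNReal.ofReal z.1 < F x ∧ ENNReal.ofReal z.2 < G x}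
        ∂((volume.restrict (Set.Ioi (0 : ℝ))).prod (volume.restrict (Set.Ioi (0 : ℝ)))) := by
  set ν := volume.restrict (Set.Ioi (0 : ℝ)) with hν
  have hpt : ∀ x, F x * G x = ∫⁻ z : ℝ × ℝ,
      {w : (α × (ℝ × ℝ)) | ENNReal.ofReal w.2.1 < F w.1 ∧ ENNReal.ofReal w.2.2 < G w.1}.indicator
        (fun _ => (1 : ℝ≥0∞)) (x, z) ∂(ν.prod ν) := by
    intro x
    have h1 : ∀ a : ℝ≥0∞, ∫⁻ t, {t : ℝ | ENNReal.ofReal t < a}.indicator 1 t ∂ν = a := fun a => by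
      rw [lintegral_indicator_one (measurableSet_lt (by fun_prop) (by fun_prop)),
        volume_restrict_Ioi_lt]
    conv_lhs => rw [← h1 (F x), ← h1 (G x)]
    rw [← lintegral_prod_mul
      ((measurable_one.indicator (measurableSet_lt (by fun_prop) (by fun_prop))).aemeasurable)
      ((measurable_one.indicator (measurableSet_lt (by fun_prop) (by fun_prop))).aemeasurable)]
    refine lintegral_congr fun z => ?_
    simp only [Set.indicator, Set.mem_ofPred_eq, Pi.one_apply]
    split_ifs <;> simp_all
  have hms : MeasurableSet
      {w : (α × (ℝ × ℝ)) | ENNReal.ofReal w.2.1 < F w.1 ∧ ENNReal.ofReal w.2.2 < G w.1} := by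
    rw [Set.ofPred_and]
    exact (measurableSet_lt (by fun_prop) (by fun_prop)).inter
      (measurableSet_lt (by fun_prop) (by fun_prop))
  simp_rw [hpt]
  have hmi : AEMeasurable (Function.uncurry fun (x : α) (z : ℝ × ℝ) =>
      {w : (α × (ℝ × ℝ)) | ENNReal.ofReal w.2.1 < F w.1 ∧ ENNReal.ofReal w.2.2 < G w.1}.indicator
        (fun _ => (1 : ℝ≥0∞)) (x, z)) (m.prod (ν.prod ν)) :=
    (measurable_const.indicator hms).aemeasurable
  rw [lintegral_lintegral_swap hmi]
  refine lintegral_congr fun z => ?_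
  have hz : MeasurableSet {x | ENNReal.ofReal z.1 < F x ∧ ENNReal.ofReal z.2 < G x} := by
    rw [Set.ofPred_and]
    exact (measurableSet_lt (by fun_prop) (by fun_prop)).inter
      (measurableSet_lt (by fun_prop) (by fun_prop))
  rw [← lintegral_indicator_one hz]
  exact lintegral_congr fun x => by simp [Set.indicator]

section Holder

variable {R : Type*} [MeasurableSpace R] {μ : Measure R} {f g : R → ℝ}

lemma rearrangement_congr (h : f =ᵐ[μ] g) : rearrangement μ f = rearrangement μ g :=
  funext fun t => le_antisymm (rearrangement_mono (h.mono fun x hx => by rw [hx]) t)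
    (rearrangement_mono (h.mono fun x hx => by rw [hx]) t)

/-- The Hardy–Littlewood inequality. -/
lemma lintegral_mul_le_lintegral_rearrangement [SFinite μ] (hf : AEMeasurable f μ)
    (hg : AEMeasurable g μ) :
    ∫⁻ x, ‖f x‖ₑ * ‖g x‖ₑ ∂μ ≤
      ∫⁻ t in Set.Ioi (0 : ℝ), rearrangement μ f t * rearrangement μ g t := by
  rw [rearrangement_congr hf.ae_eq_mk, rearrangement_congr hg.ae_eq_mk]
  have : ∫⁻ x, ‖f x‖ₑ * ‖g x‖ₑ ∂μ = ∫⁻ x, ‖hf.mk f x‖ₑ * ‖hg.mk g x‖ₑ ∂μ :=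
    lintegral_congr_ae (by
      filter_upwards [hf.ae_eq_mk, hg.ae_eq_mk] with x h1 h2
      rw [h1, h2])
  have hf' := hf.measurable_mk
  have hg' := hg.measurable_mk
  rw [this, lintegral_mul_eq_lintegral_measure μ hf'.enorm hg'.enorm,
    lintegral_mul_eq_lintegral_measure _ measurable_rearrangement measurable_rearrangement]
  refine lintegral_mono fun z => ?_
  simp only [lt_rearrangement_iff, ← lt_min_iff]
  rw [volume_restrict_Ioi_lt]
  exact le_min (measure_mono fun x hx => hx.1) (measure_mono fun x hx => hx.2)

lemma lintegral_mul_le_halfLineNorm_top {p q : ℝ} (hpq : p.HolderConjugate q) {u v : ℝ → ℝ≥0∞}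
    (hv : Measurable v) :
    ∫⁻ t in Set.Ioi (0 : ℝ), u t * v t ≤ halfLineNorm p ∞ u * halfLineNorm q 1 v := by
  rw [halfLineNorm_of_ne_top ENNReal.one_ne_top]
  simp only [ENNReal.toReal_one, ENNReal.rpow_one, div_one]
  rw [← lintegral_const_mul _ (by fun_prop)]
  refine setLIntegral_mono' measurableSet_Ioi fun t ht => ?_
  have h0 : ENNReal.ofReal t ≠ 0 := by simpa using ht
  have h1 : ENNReal.ofReal t ^ (1 / p) * u t ≤ halfLineNorm p ∞ u := by
    rw [halfLineNorm, if_pos rfl]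
    exact le_iSup₂_of_le t ht le_rfl
  calc u t * v t = (ENNReal.ofReal t ^ (1 / p) * u t) * (ENNReal.ofReal t ^ (1 / q - 1) * v t) := by
        have : ENNReal.ofReal t ^ (1 / p) * ENNReal.ofReal t ^ (1 / q - 1) = 1 := by
          rw [← ENNReal.rpow_add _ _ h0 (by simp)]
          have := hpq.inv_add_inv_eq_one
          rw [show 1 / p + (1 / q - 1) = 0 by rw [one_div, one_div]; linarith, ENNReal.rpow_zero]
        rw [mul_mul_mul_comm, this, one_mul]
    _ ≤ _ := by gcongr

/-- Hölder's inequality on the half-line. -/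
lemma lintegral_mul_le_halfLineNorm {p q : ℝ} (hpq : p.HolderConjugate q) {s r : ℝ≥0∞}
    (hsr : s.HolderConjugate r) {u v : ℝ → ℝ≥0∞} (hu : Measurable u) (hv : Measurable v) :
    ∫⁻ t in Set.Ioi (0 : ℝ), u t * v t ≤ halfLineNorm p s u * halfLineNorm q r v := by
  by_cases hs : s = ∞
  · have hr : r = 1 := by
      have := hsr.inv_add_inv_eq_one
      simpa [hs] using this
    subst hs hr
    exact lintegral_mul_le_halfLineNorm_top hpq hv
  by_cases hr : r = ∞
  · have hs : s = 1 := by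
      have := hsr.inv_add_inv_eq_one
      simpa [hr] using this
    subst hs hr
    simp_rw [mul_comm (u _), mul_comm (halfLineNorm p 1 u)]
    exact lintegral_mul_le_halfLineNorm_top hpq.symm hu
  have hs1 : 1 < s.toReal := by
    rw [← ENNReal.toReal_one, ENNReal.toReal_lt_toReal ENNReal.one_ne_top hs]
    refine lt_of_le_of_ne hsr.one_le fun h => hr ?_
    have := hsr.inv_add_inv_eq_one
    simpa [← h] using this
  have hC : s.toReal.HolderConjugate r.toReal := ENNReal.HolderConjugate.toReal hs1
  have hinv := hpq.inv_add_inv_eq_one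
  have hinv' := hC.inv_add_inv_eq_one
  have hs0 := hC.pos
  have hr0 := hC.symm.pos
  have key : ∀ {t : ℝ}, 0 < t → ∀ (a : ℝ) {q : ℝ}, 0 < q → ∀ b : ℝ≥0∞,
      (ENNReal.ofReal t ^ (1 / a - 1 / q) * b) ^ q = ENNReal.ofReal t ^ (q / a - 1) * b ^ q := by
    intro t ht a q hq b
    rw [ENNReal.mul_rpow_of_nonneg _ _ hq.le, ← ENNReal.rpow_mul]
    congr 2
    field_simp
  have := ENNReal.lintegral_mul_le_Lp_mul_Lq (volume.restrict (Set.Ioi (0 : ℝ))) hC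
    (f := fun t => ENNReal.ofReal t ^ (1 / p - 1 / s.toReal) * u t)
    (g := fun t => ENNReal.ofReal t ^ (1 / q - 1 / r.toReal) * v t) (by fun_prop) (by fun_prop)
  rw [halfLineNorm_of_ne_top hs, halfLineNorm_of_ne_top hr]
  refine le_trans (le_of_eq ?_) (this.trans (le_of_eq ?_))
  · refine setLIntegral_congr_fun measurableSet_Ioi fun t ht => ?_
    have h0 : ENNReal.ofReal t ≠ 0 := by simpa using ht
    rw [Pi.mul_apply, mul_mul_mul_comm, ← ENNReal.rpow_add _ _ h0 (by simp)]
    rw [show 1 / p - 1 / s.toReal + (1 / q - 1 / r.toReal) = 0 by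
      simp only [one_div]; linarith, ENNReal.rpow_zero, one_mul]
  · congr 2
    · exact setLIntegral_congr_fun measurableSet_Ioi fun t ht => key ht _ hs0 _
    · exact setLIntegral_congr_fun measurableSet_Ioi fun t ht => key ht _ hr0 _

lemma lintegral_mul_le_lorentzNorm [SFinite μ] {p q : ℝ} (hpq : p.HolderConjugate q) {s r : ℝ≥0∞}
    (hsr : s.HolderConjugate r) (hf : AEMeasurable f μ) (hg : AEMeasurable g μ) :
    ∫⁻ x, ‖f x‖ₑ * ‖g x‖ₑ ∂μ ≤ lorentzNorm μ p s f * lorentzNorm μ q r g :=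
  (lintegral_mul_le_lintegral_rearrangement hf hg).trans
    (lintegral_mul_le_halfLineNorm hpq hsr measurable_rearrangement measurable_rearrangement)

lemma MemLorentz.integrable_mul [SFinite μ] {p q : ℝ} (hpq : p.HolderConjugate q) {s r : ℝ≥0∞}
    (hsr : s.HolderConjugate r) (hf : MemLorentz μ p s f) (hg : MemLorentz μ q r g) :
    Integrable (fun x => f x * g x) μ := by
  refine ⟨(hf.1.mul hg.1).aestronglyMeasurable, ?_⟩
  rw [HasFiniteIntegral]
  simp_rw [enorm_mul]
  exact (lintegral_mul_le_lorentzNorm hpq hsr hf.1 hg.1).trans_lt (ENNReal.mul_lt_top hf.2 hg.2)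

end Holder

/-! ### Elementary properties of the Lorentz functional and of the two norms -/

section Norms

variable {R : Type*} [MeasurableSpace R] {μ : Measure R} {f g : R → ℝ} {p : ℝ} {s : ℝ≥0∞}

lemma lorentzNorm_mono (h : ∀ᵐ x ∂μ, ‖f x‖ₑ ≤ ‖g x‖ₑ) :
    lorentzNorm μ p s f ≤ lorentzNorm μ p s g :=
  halfLineNorm_mono fun t _ => rearrangement_mono h t

lemma lorentzNorm_congr_enorm (h : ∀ᵐ x ∂μ, ‖f x‖ₑ = ‖g x‖ₑ) :
    lorentzNorm μ p s f = lorentzNorm μ p s g :=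
  le_antisymm (lorentzNorm_mono (h.mono fun _ hx => hx.le))
    (lorentzNorm_mono (h.mono fun _ hx => hx.ge))

lemma lorentzNorm_const_mul (hs : 1 ≤ s) {c : ℝ} (hc : c ≠ 0) :
    lorentzNorm μ p s (fun x => c * f x) = ‖c‖ₑ * lorentzNorm μ p s f := by
  rw [lorentzNorm_eq, lorentzNorm_eq, ← halfLineNorm_const_mul hs (by simp)]
  congr 1
  exact funext fun t => rearrangement_const_mul hc t

lemma measure_lt_of_lorentzNorm_lt_top (hp : 0 < p) (hs : 1 ≤ s) (h : lorentzNorm μ p s f < ∞)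
    {l : ℝ≥0∞} (hl : l ≠ 0) : μ {x | l < ‖f x‖ₑ} < ∞ := by
  by_contra hcon
  rw [not_lt, top_le_iff] at hcon
  refine h.ne (top_le_iff.1 ?_)
  rw [← halfLineNorm_const_eq_top hp hs hl]
  refine halfLineNorm_mono fun t _ => (lt_rearrangement_iff.2 ?_).le
  rw [hcon]
  exact ENNReal.ofReal_lt_top

lemma ae_eq_zero_of_lorentzNorm_eq_zero [SFinite μ] {q : ℝ} (hpq : p.HolderConjugate q)
    (hs : 1 ≤ s) (hf : AEMeasurable f μ) (h : lorentzNorm μ p s f = 0) : f =ᵐ[μ] 0 := by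
  have h1 := lintegral_mul_le_lorentzNorm hpq (ENNReal.HolderConjugate.conjExponent hs) hf
    (aemeasurable_const (b := (1 : ℝ)))
  rw [h, zero_mul, nonpos_iff_eq_zero, lintegral_eq_zero_iff' (by fun_prop)] at h1
  filter_upwards [h1] with x hx
  simpa using hx

/-- The duality pairing is controlled by the dual norm: the supremum defining `dualNorm` may be
taken over all `h`, with absolute values inside the integral. -/
lemma lintegral_mul_le_dualNorm [SFinite μ] (hp : 1 < p) (hs : 1 ≤ s) (hf : MemLorentz μ p s f)
    {h : R → ℝ} (hh : MemLorentz μ p.conjExponent s.conjExponent h) :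
    ∫⁻ x, ‖f x‖ₑ * ‖h x‖ₑ ∂μ ≤
      dualNorm μ p s f * lorentzNorm μ p.conjExponent s.conjExponent h := by
  have hpq := Real.HolderConjugate.conjExponent hp
  have hsr := ENNReal.HolderConjugate.conjExponent hs
  set q := p.conjExponent
  set r := s.conjExponent
  have hr : 1 ≤ r := hsr.symm.one_le
  set N := lorentzNorm μ q r h with hN
  rcases eq_or_ne N 0 with h0 | h0
  · have := ae_eq_zero_of_lorentzNorm_eq_zero hpq.symm hr hh.1 h0
    rw [lintegral_congr_ae (g := 0)]
    · simp
    · filter_upwards [this] with x hx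
      simp [hx]
  have hNt : N ≠ ∞ := hh.2.ne
  -- the competitor `g = ± h / ‖h‖`, with the sign that makes `f g` nonnegative
  set c : ℝ := N.toReal⁻¹ with hc
  have hc0 : 0 < c := inv_pos.2 (ENNReal.toReal_pos h0 hNt)
  set f₀ := hf.1.mk f
  set h₀ := hh.1.mk h
  set g : R → ℝ := fun x => if 0 ≤ f₀ x * h₀ x then c * h₀ x else -(c * h₀ x) with hg
  have hf₀ : Measurable f₀ := hf.1.measurable_mk
  have hh₀ : Measurable h₀ := hh.1.measurable_mk
  have hgm : Measurable g := Measurable.ite (measurableSet_le (by fun_prop) (by fun_prop))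
    (by fun_prop) (by fun_prop)
  have hgn : lorentzNorm μ q r g = 1 := by
    have : lorentzNorm μ q r g = lorentzNorm μ q r (fun x => c * h x) := by
      refine lorentzNorm_congr_enorm ?_
      filter_upwards [hh.1.ae_eq_mk] with x hx
      simp only [hg, hx, h₀]
      split_ifs <;> simp
    rw [this, lorentzNorm_const_mul hr hc0.ne', ← hN, Real.enorm_of_nonneg hc0.le, hc,
      ENNReal.ofReal_inv_of_pos (ENNReal.toReal_pos h0 hNt), ENNReal.ofReal_toReal hNt,
      ENNReal.inv_mul_cancel h0 hNt]
  have hfg : ∀ᵐ x ∂μ, f x * g x = c * |f x * h x| := by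
    filter_upwards [hh.1.ae_eq_mk, hf.1.ae_eq_mk] with x hx hx'
    simp only [hg]
    rw [hx, hx']
    split_ifs with h1
    · rw [abs_of_nonneg h1]; ring
    · rw [abs_of_neg (not_le.1 h1)]; ring
  have hle : ENNReal.ofReal (∫ x, f x * g x ∂μ) ≤ dualNorm μ p s f :=
    le_iSup_of_le g (le_iSup_of_le hgm.aemeasurable (le_iSup_of_le hgn le_rfl))
  have hint : Integrable (fun x => c * |f x * h x|) μ :=
    (hf.integrable_mul hpq hsr hh).abs.const_mul c
  rw [integral_congr_ae hfg, ofReal_integral_eq_lintegral_ofReal hint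
    (Filter.Eventually.of_forall fun x => by positivity)] at hle
  have hcN : ENNReal.ofReal c = N⁻¹ := by
    rw [hc, ENNReal.ofReal_inv_of_pos (ENNReal.toReal_pos h0 hNt), ENNReal.ofReal_toReal hNt]
  have : ∫⁻ x, ENNReal.ofReal (c * |f x * h x|) ∂μ = N⁻¹ * ∫⁻ x, ‖f x‖ₑ * ‖h x‖ₑ ∂μ := by
    rw [← lintegral_const_mul' _ _ (ENNReal.inv_ne_top.2 h0)]
    refine lintegral_congr fun x => ?_
    rw [ENNReal.ofReal_mul hc0.le, hcN, ← enorm_mul, Real.enorm_eq_ofReal_abs]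
  rw [this] at hle
  calc ∫⁻ x, ‖f x‖ₑ * ‖h x‖ₑ ∂μ = N⁻¹ * (∫⁻ x, ‖f x‖ₑ * ‖h x‖ₑ ∂μ) * N := by
        rw [mul_right_comm, ENNReal.inv_mul_cancel h0 hNt, one_mul]
    _ ≤ _ := by gcongr

lemma decompNorm_le_sum {n : ℕ} {F : Fin n → R → ℝ} (hF : ∀ k, MemLorentz μ p s (F k))
    (h : f =ᵐ[μ] fun x => ∑ k, F k x) :
    decompNorm μ p s f ≤ ∑ k, lorentzNorm μ p s (F k) :=
  iInf_le_of_le n (iInf_le_of_le F (iInf_le_of_le hF (iInf_le_of_le h le_rfl)))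

lemma le_decompNorm_iff {a : ℝ≥0∞} : a ≤ decompNorm μ p s f ↔ ∀ (n : ℕ) (F : Fin n → R → ℝ),
    (∀ k, MemLorentz μ p s (F k)) → (f =ᵐ[μ] fun x => ∑ k, F k x) →
      a ≤ ∑ k, lorentzNorm μ p s (F k) := by
  simp only [decompNorm, le_iInf_iff]

lemma decompNorm_le_lorentzNorm (hf : MemLorentz μ p s f) :
    decompNorm μ p s f ≤ lorentzNorm μ p s f := by
  simpa using decompNorm_le_sum (n := 1) (F := fun _ => f) (fun _ => hf) (by simp)

lemma decompNorm_add_le : decompNorm μ p s (fun x => f x + g x) ≤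
    decompNorm μ p s f + decompNorm μ p s g := by
  simp only [decompNorm.eq_1 μ p s f, decompNorm.eq_1 μ p s g, ENNReal.iInf_add, ENNReal.add_iInf,
    le_iInf_iff]
  intro n F hF hfF m G hG hgG
  refine (decompNorm_le_sum (F := Fin.append F G) (fun k => ?_) ?_).trans (le_of_eq ?_)
  · refine Fin.addCases (fun i => ?_) (fun i => ?_) k
    · simpa using hF i
    · simpa using hG i
  · filter_upwards [hfF, hgG] with x h1 h2
    simp [Fin.sum_univ_add, h1, h2, add_comm]
  · simp [Fin.sum_univ_add, add_comm]

lemma MemLorentz.const_mul (hs : 1 ≤ s) {c : ℝ} (hc : c ≠ 0) (hf : MemLorentz μ p s f) :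
    MemLorentz μ p s (fun x => c * f x) := by
  refine ⟨hf.1.const_mul c, ?_⟩
  rw [lorentzNorm_const_mul hs hc]
  exact ENNReal.mul_lt_top (by simp) hf.2

lemma MemLorentz.mono (hg : MemLorentz μ p s g) (hf : AEMeasurable f μ)
    (h : ∀ᵐ x ∂μ, ‖f x‖ₑ ≤ ‖g x‖ₑ) : MemLorentz μ p s f :=
  ⟨hf, (lorentzNorm_mono h).trans_lt hg.2⟩

lemma decompNorm_const_mul_le (hs : 1 ≤ s) {c : ℝ} (hc : c ≠ 0) :
    decompNorm μ p s (fun x => c * f x) ≤ ‖c‖ₑ * decompNorm μ p s f := by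
  have hc0 : ‖c‖ₑ ≠ 0 := by simpa using hc
  have hct : ‖c‖ₑ ≠ ∞ := by simp
  rw [mul_comm, ← ENNReal.div_le_iff_le_mul (Or.inl hc0) (Or.inl hct), le_decompNorm_iff]
  intro n F hF hfF
  rw [ENNReal.div_le_iff_le_mul (Or.inl hc0) (Or.inl hct), Finset.sum_mul]
  refine (decompNorm_le_sum (F := fun k x => c * F k x) (fun k => (hF k).const_mul hs hc)
    ?_).trans (le_of_eq ?_)
  · filter_upwards [hfF] with x hx
    rw [hx, Finset.mul_sum]
  · exact Finset.sum_congr rfl fun k _ => by rw [lorentzNorm_const_mul hs hc, mul_comm]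

/-- The decomposition norm is a lattice norm: multiply a decomposition of `g` by `f / g`. -/
lemma decompNorm_mono (hf : AEMeasurable f μ) (hg : AEMeasurable g μ)
    (h : ∀ᵐ x ∂μ, ‖f x‖ₑ ≤ ‖g x‖ₑ) :
    decompNorm μ p s f ≤ decompNorm μ p s g := by
  rw [le_decompNorm_iff]
  intro n F hF hgF
  have hle : ∀ k, ∀ᵐ x ∂μ, ‖f x / g x * F k x‖ₑ ≤ ‖F k x‖ₑ := fun k => by
    filter_upwards [h] with x hx
    rw [enorm_mul]
    refine mul_le_of_le_one_left zero_le ?_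
    rw [enorm_le_iff_norm_le] at hx
    rw [← enorm_one (G := ℝ), enorm_le_iff_norm_le, norm_div, norm_one]
    exact div_le_one_of_le₀ hx (norm_nonneg _)
  refine (decompNorm_le_sum (F := fun k x => f x / g x * F k x)
    (fun k => (hF k).mono ((hf.div hg).mul (hF k).1) (hle k)) ?_).trans
      (Finset.sum_le_sum fun k _ => lorentzNorm_mono (hle k))
  filter_upwards [h, hgF] with x hx hx'
  rw [← Finset.mul_sum, ← hx']
  rcases eq_or_ne (g x) 0 with h0 | h0
  · simpa [h0] using hx
  · rw [div_mul_cancel₀ _ h0]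

lemma dualNorm_le_decompNorm [SFinite μ] (hp : 1 < p) (hs : 1 ≤ s) :
    dualNorm μ p s f ≤ decompNorm μ p s f := by
  rw [le_decompNorm_iff]
  intro n F hF hfF
  refine iSup_le fun g => iSup_le fun hg => iSup_le fun hg1 => ?_
  calc ENNReal.ofReal (∫ x, f x * g x ∂μ) ≤ ∫⁻ x, ‖f x * g x‖ₑ ∂μ := by
        refine le_trans ?_ (enorm_integral_le_lintegral_enorm _)
        rw [Real.enorm_eq_ofReal_abs]
        exact ENNReal.ofReal_le_ofReal (le_abs_self _)
    _ ≤ ∫⁻ x, ∑ k, ‖F k x‖ₑ * ‖g x‖ₑ ∂μ := by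
        refine lintegral_mono_ae ?_
        filter_upwards [hfF] with x hx
        rw [hx, enorm_mul, ← Finset.sum_mul]
        gcongr
        exact enorm_sum_le _ _
    _ = ∑ k, ∫⁻ x, ‖F k x‖ₑ * ‖g x‖ₑ ∂μ :=
        lintegral_finsetSum' _ fun k _ => (hF k).1.enorm.mul hg.enorm
    _ ≤ ∑ k, lorentzNorm μ p s (F k) := by
        refine Finset.sum_le_sum fun k _ => ?_
        simpa [hg1] using lintegral_mul_le_lorentzNorm (Real.HolderConjugate.conjExponent hp)
          (ENNReal.HolderConjugate.conjExponent hs) (hF k).1 hg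

end Norms

/-! ### Nonatomic measures -/

section Nonatomic

variable {R : Type*} [MeasurableSpace R] {μ : Measure R}

lemma IsNonatomic.exists_subset_measure_le (hμ : IsNonatomic μ) {A : Set R} (hA : MeasurableSet A)
    (h0 : 0 < μ A) (hfin : μ A ≠ ∞) {ε : ℝ≥0∞} (hε : 0 < ε) :
    ∃ B ⊆ A, MeasurableSet B ∧ 0 < μ B ∧ μ B ≤ ε := by
  have key : ∀ n : ℕ, ∃ B ⊆ A, MeasurableSet B ∧ 0 < μ B ∧ μ B ≤ μ A * 2⁻¹ ^ n := by
    intro n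
    induction n with
    | zero => exact ⟨A, subset_rfl, hA, h0, by simp⟩
    | succ n ih =>
      obtain ⟨B, hBA, hB, hB0, hBn⟩ := ih
      obtain ⟨C, hCB, hC, hC0, hClt⟩ := hμ B hB hB0
      have hBfin : μ B ≠ ∞ := ne_top_of_le_ne_top hfin (measure_mono hBA)
      have hadd : μ C + μ (B \ C) = μ B := by
        rw [← measure_union Set.disjoint_sdiff_right (hB.diff hC), Set.union_sdiff_cancel hCB]
      have hD0 : 0 < μ (B \ C) := by
        rw [pos_iff_ne_zero]
        intro h
        rw [h, add_zero] at hadd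
        exact hClt.ne hadd
      -- one of `C` and `B \ C` has at most half the measure of `B`
      have hhalf : ∀ a b : ℝ≥0∞, a ≤ b → a + b = μ B → a ≤ μ A * 2⁻¹ ^ (n + 1) := by
        intro a b hab habB
        rw [pow_succ, ← mul_assoc]
        refine le_trans ?_ (mul_le_mul_left hBn _)
        rw [← div_eq_mul_inv, ENNReal.le_div_iff_mul_le (by simp) (by simp), mul_two, ← habB]
        gcongr
      rcases le_total (μ C) (μ (B \ C)) with h | h
      · exact ⟨C, hCB.trans hBA, hC, hC0, hhalf _ _ h hadd⟩
      · exact ⟨B \ C, Set.sdiff_subset.trans hBA, hB.diff hC, hD0,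
          hhalf _ _ h (by rw [add_comm, hadd])⟩
  have hlim : Filter.Tendsto (fun n : ℕ => μ A * 2⁻¹ ^ n) Filter.atTop (nhds 0) := by
    have := ENNReal.Tendsto.const_mul (a := μ A)
      (ENNReal.tendsto_pow_atTop_nhds_zero_of_lt_one (r := 2⁻¹) (by simp)) (Or.inr hfin)
    simpa using this
  obtain ⟨n, hn⟩ := ((tendsto_order.1 hlim).2 ε hε).exists
  obtain ⟨B, h1, h2, h3, h4⟩ := key n
  exact ⟨B, h1, h2, h3, h4.trans hn.le⟩

/-- Sierpiński's theorem: a nonatomic finite measure takes all intermediate values. -/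
lemma IsNonatomic.exists_subset_measure_eq (hμ : IsNonatomic μ) {A : Set R}
    (hA : MeasurableSet A) (hfin : μ A ≠ ∞) {c : ℝ≥0∞} (hc : c ≤ μ A) :
    ∃ B ⊆ A, MeasurableSet B ∧ μ B = c := by
  have hcfin : c ≠ ∞ := ne_top_of_le_ne_top hfin hc
  let P : Set R → Prop := fun B => B ⊆ A ∧ MeasurableSet B ∧ μ B ≤ c
  -- enlarge `B` almost as much as possible
  have step : ∀ (n : ℕ) (B : {B // P B}), ∃ B' : {B // P B}, B.1 ⊆ B'.1 ∧
      ∀ C, P C → B.1 ⊆ C → μ C ≤ μ B'.1 + 2⁻¹ ^ n := by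
    intro n B
    set S := ⨆ (C : Set R) (_ : P C ∧ B.1 ⊆ C), μ C with hS
    have hle : ∀ C, P C → B.1 ⊆ C → μ C ≤ S := fun C hC hBC =>
      le_iSup₂_of_le (f := fun (C : Set R) (_ : P C ∧ B.1 ⊆ C) => μ C) C ⟨hC, hBC⟩ le_rfl
    have hSc : S ≤ c := iSup₂_le fun C hC => hC.1.2.2
    rcases le_or_gt S (2⁻¹ ^ n) with h | h
    · exact ⟨B, subset_rfl, fun C hC hBC => (hle C hC hBC).trans (h.trans le_add_self)⟩
    · have hp : (0 : ℝ≥0∞) < 2⁻¹ ^ n := ENNReal.pow_pos (by simp) n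
      have hlt : S - 2⁻¹ ^ n < S :=
        ENNReal.sub_lt_self (ne_top_of_le_ne_top hcfin hSc) (hp.trans h).ne' hp.ne'
      rw [hS, lt_iSup_iff] at hlt
      obtain ⟨C, hC⟩ := hlt
      rw [lt_iSup_iff] at hC
      obtain ⟨hC1, hC2⟩ := hC
      refine ⟨⟨C, hC1.1⟩, hC1.2, fun D hD hBD => (hle D hD hBD).trans ?_⟩
      exact tsub_le_iff_right.1 hC2.le
  choose next hnext1 hnext2 using step
  let B : ℕ → {B // P B} := fun n => Nat.rec ⟨∅, by simp [P]⟩ (fun n B => next n B) n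
  have hBs : ∀ n, B (n + 1) = next n (B n) := fun n => rfl
  have hmono : Monotone fun n => (B n).1 := monotone_nat_of_le_succ fun n => by
    rw [hBs]; exact hnext1 n (B n)
  set D := ⋃ n, (B n).1 with hD
  have hDP : P D := ⟨Set.iUnion_subset fun n => (B n).2.1,
    MeasurableSet.iUnion fun n => (B n).2.2.1, by
      rw [hD, hmono.measure_iUnion]; exact iSup_le fun n => (B n).2.2.2⟩
  have hmax : ∀ C, P C → D ⊆ C → μ C ≤ μ D := by
    intro C hC hDC
    have h1 : ∀ n : ℕ, μ C ≤ μ D + 2⁻¹ ^ n := fun n =>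
      (hnext2 n (B n) C hC ((Set.subset_iUnion (fun n => (B n).1) n).trans hDC)).trans (by
        gcongr
        exact Set.subset_iUnion (fun n => (B n).1) (n + 1))
    have h2 : Filter.Tendsto (fun n : ℕ => μ D + 2⁻¹ ^ n) Filter.atTop (nhds (μ D)) := by
      have := (ENNReal.tendsto_pow_atTop_nhds_zero_of_lt_one (r := 2⁻¹) (by simp)).const_add (μ D)
      simpa using this
    exact ge_of_tendsto' h2 h1
  refine ⟨D, hDP.1, hDP.2.1, le_antisymm hDP.2.2 ?_⟩
  by_contra hlt
  rw [not_le] at hlt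
  have hDfin : μ D ≠ ∞ := hlt.ne_top
  have hAD : 0 < μ (A \ D) := by
    rw [measure_sdiff hDP.1 hDP.2.1.nullMeasurableSet hDfin]
    exact tsub_pos_of_lt (hlt.trans_le hc)
  obtain ⟨C, hCA, hC, hC0, hCle⟩ := hμ.exists_subset_measure_le (hA.diff hDP.2.1) hAD
    (ne_top_of_le_ne_top hfin (measure_mono Set.sdiff_subset)) (tsub_pos_of_lt hlt)
  have hun : μ (D ∪ C) = μ D + μ C :=
    measure_union (Set.disjoint_left.2 fun x hx hx' => (hCA hx').2 hx) hC
  have h3 := hmax (D ∪ C) ⟨Set.union_subset hDP.1 (hCA.trans Set.sdiff_subset), hDP.2.1.union hC, by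
    rw [hun]
    calc μ D + μ C ≤ μ D + (c - μ D) := by gcongr
      _ = c := add_tsub_cancel_of_le hlt.le⟩ Set.subset_union_left
  rw [hun] at h3
  exact h3.not_gt (ENNReal.lt_add_right hDfin hC0.ne')

/-- Binary digits: if each fibre `{V = k}`, `k < N`, has measure `m` in `E`, the fibres can be
halved. -/
lemma IsNonatomic.exists_halving (hμ : IsNonatomic μ) {E : Set R} (hE : MeasurableSet E)
    (hfin : μ E ≠ ∞) {V : R → ℕ} (hV : Measurable V) {N : ℕ} {m : ℝ}
    (hm : ∀ k < N, μ.real (E ∩ {x | V x = k}) = m) :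
    ∃ V' : R → ℕ, Measurable V' ∧ (∀ x, V' x = 2 * V x ∨ V' x = 2 * V x + 1) ∧
      ∀ k < 2 * N, μ.real (E ∩ {x | V' x = k}) = m / 2 := by
  have hms : ∀ k, MeasurableSet (E ∩ {x | V x = k}) := fun k =>
    hE.inter (hV (measurableSet_singleton k))
  have hf : ∀ k, μ (E ∩ {x | V x = k}) ≠ ∞ := fun k =>
    ne_top_of_le_ne_top hfin (measure_mono Set.inter_subset_left)
  have hex : ∀ k, ∃ B ⊆ E ∩ {x | V x = k}, MeasurableSet B ∧ μ B = μ (E ∩ {x | V x = k}) / 2 :=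
    fun k => hμ.exists_subset_measure_eq (hms k) (hf k) ENNReal.half_le_self
  choose B hB1 hB2 hB3 using hex
  classical
  have hBU : MeasurableSet (⋃ k, B k) := MeasurableSet.iUnion hB2
  have hmemB : ∀ x k, x ∈ B k → V x = k := fun x k hx => (hB1 k hx).2
  refine ⟨fun x => if x ∈ ⋃ k, B k then 2 * V x + 1 else 2 * V x,
    Measurable.ite hBU ((measurable_of_countable fun n => 2 * n + 1).comp hV)
      ((measurable_of_countable fun n => 2 * n).comp hV), fun x => ?_, fun k hk => ?_⟩
  · dsimp only
    split_ifs
    · exact Or.inr rfl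
    · exact Or.inl rfl
  · have hBr : ∀ j < N, μ.real (B j) = m / 2 := fun j hj => by
      rw [measureReal_def, hB3, ENNReal.toReal_div, ← measureReal_def, hm j hj]; simp
    rcases Nat.even_or_odd' k with ⟨j, rfl | rfl⟩
    · have hset : E ∩ {x | (if x ∈ ⋃ k, B k then 2 * V x + 1 else 2 * V x) = 2 * j}
          = (E ∩ {x | V x = j}) \ B j := by
        ext x
        simp only [Set.mem_inter_iff, Set.mem_ofPred_eq, Set.mem_sdiff]
        constructor
        · rintro ⟨hx, h⟩
          split_ifs at h with hxB
          · omega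
          · exact ⟨⟨hx, by omega⟩, fun hxj => hxB (Set.mem_iUnion.2 ⟨j, hxj⟩)⟩
        · rintro ⟨⟨hx, h⟩, hxj⟩
          refine ⟨hx, ?_⟩
          rw [if_neg]
          · omega
          · intro hxB
            obtain ⟨i, hi⟩ := Set.mem_iUnion.1 hxB
            exact hxj (by rwa [← h, hmemB x i hi])
      rw [hset, measureReal_sdiff (hB1 j) (hB2 j) (hf j), hm j (by omega), hBr j (by omega)]
      ring
    · have hset : E ∩ {x | (if x ∈ ⋃ k, B k then 2 * V x + 1 else 2 * V x) = 2 * j + 1}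
          = B j := by
        ext x
        simp only [Set.mem_inter_iff, Set.mem_ofPred_eq]
        constructor
        · rintro ⟨hx, h⟩
          split_ifs at h with hxB
          · obtain ⟨i, hi⟩ := Set.mem_iUnion.1 hxB
            have := hmemB x i hi
            rwa [show j = i by omega]
          · omega
        · intro hx
          rw [if_pos (Set.mem_iUnion.2 ⟨j, hx⟩), hmemB x j hx]
          exact ⟨(hB1 j hx).1, rfl⟩
      rw [hset, hBr j (by omega)]

/-- A nonatomic set of finite measure carries a function that is uniformly distributed on
`[0, μ E)`. -/
lemma IsNonatomic.exists_uniform (hμ : IsNonatomic μ) {E : Set R} (hE : MeasurableSet E)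
    (hfin : μ E ≠ ∞) :
    ∃ U : R → ℝ, Measurable U ∧ (∀ x, 0 ≤ U x) ∧
      (μ.restrict E).map U = volume.restrict (Set.Ico 0 (μ.real E)) := by
  let P : ℕ → (R → ℕ) → Prop := fun n V => Measurable V ∧ (∀ x, V x < 2 ^ n) ∧
    ∀ k < 2 ^ n, μ.real (E ∩ {x | V x = k}) = μ.real E / 2 ^ n
  have step : ∀ (n : ℕ) (V : {V // P n V}), ∃ V' : {V // P (n + 1) V},
      ∀ x, V'.1 x = 2 * V.1 x ∨ V'.1 x = 2 * V.1 x + 1 := by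
    intro n ⟨V, hV, hVN, hm⟩
    obtain ⟨V', h1, h2, h3⟩ := hμ.exists_halving hE hfin hV hm
    refine ⟨⟨V', h1, fun x => ?_, fun k hk => ?_⟩, h2⟩
    · have := hVN x
      rcases h2 x with h | h <;> rw [h, pow_succ] <;> omega
    · rw [h3 k (by rw [pow_succ] at hk; omega), pow_succ, div_div]
  choose next hnext using step
  let W : ∀ n, {V // P n V} := fun n => Nat.rec ⟨fun _ => 0, by simp [P]⟩ (fun n V => next n V) n
  have hWs : ∀ n x, (W (n + 1)).1 x = 2 * (W n).1 x ∨ (W (n + 1)).1 x = 2 * (W n).1 x + 1 :=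
    fun n x => hnext n (W n) x
  set a : ℕ → R → ℝ := fun n x => ((W n).1 x : ℝ) / 2 ^ n with ha
  set b : ℕ → R → ℝ := fun n x => ((W n).1 x + 1 : ℝ) / 2 ^ n with hb
  have hamono : ∀ x, Monotone fun n => a n x := fun x => monotone_nat_of_le_succ fun n => by
    simp only [ha, pow_succ]
    rw [div_le_div_iff₀ (by positivity) (by positivity)]
    have : (2 * (W n).1 x : ℝ) ≤ (W (n + 1)).1 x := by
      exact_mod_cast (show 2 * (W n).1 x ≤ (W (n + 1)).1 x by rcases hWs n x with h | h <;> omega)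
    nlinarith [show (0 : ℝ) < 2 ^ n by positivity]
  have hbanti : ∀ x, Antitone fun n => b n x := fun x => antitone_nat_of_succ_le fun n => by
    simp only [hb, pow_succ]
    rw [div_le_div_iff₀ (by positivity) (by positivity)]
    have : ((W (n + 1)).1 x : ℝ) ≤ 2 * (W n).1 x + 1 := by
      exact_mod_cast (show (W (n + 1)).1 x ≤ 2 * (W n).1 x + 1 by
        rcases hWs n x with h | h <;> omega)
    nlinarith [show (0 : ℝ) < 2 ^ n by positivity]
  have hab : ∀ n x, a n x ≤ b n x := fun n x => by
    simp only [ha, hb]; gcongr; linarith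
  have hab' : ∀ m n x, a m x ≤ b n x := fun m n x =>
    (hamono x (le_max_left m n)).trans ((hab _ x).trans (hbanti x (le_max_right m n)))
  have hbdd : ∀ x, BddAbove (Set.range fun n => a n x) := fun x =>
    ⟨b 0 x, by rintro _ ⟨m, rfl⟩; exact hab' m 0 x⟩
  set U : R → ℝ := fun x => ⨆ n, a n x with hU
  have hUm : Measurable U := Measurable.iSup fun n =>
    ((measurable_of_countable fun k : ℕ => (k : ℝ) / 2 ^ n).comp (W n).2.1)
  have haU : ∀ n x, a n x ≤ U x := fun n x => le_ciSup (hbdd x) n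
  have hUb : ∀ n x, U x ≤ b n x := fun n x => ciSup_le fun m => hab' m n x
  have hU0 : ∀ x, 0 ≤ U x := fun x => le_trans (by simp only [ha]; positivity) (haU 0 x)
  have hU1 : ∀ x, U x ≤ 1 := fun x => by
    refine ciSup_le fun n => ?_
    simp only [ha]
    rw [div_le_one (by positivity)]
    exact_mod_cast ((W n).2.2.1 x).le
  set m := μ.real E with hmdef
  have hm0 : 0 ≤ m := measureReal_nonneg
  -- the distribution of the `n`-th digit sum
  have hcount : ∀ n k : ℕ, k ≤ 2 ^ n → μ.real (E ∩ {x | (W n).1 x < k}) = k * (m / 2 ^ n) := by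
    intro n k
    induction k with
    | zero => intro _; simp
    | succ k ih =>
      intro hk
      have hset : E ∩ {x | (W n).1 x < k + 1} =
          (E ∩ {x | (W n).1 x < k}) ∪ (E ∩ {x | (W n).1 x = k}) := by
        rw [← Set.inter_union_distrib_left]
        congr 1
        ext x
        simp only [Set.mem_ofPred_eq, Set.mem_union]
        omega
      have hmk : MeasurableSet (E ∩ {x | (W n).1 x = k}) :=
        hE.inter ((W n).2.1 (measurableSet_singleton k))
      rw [hset, measureReal_union _ hmk
        (ne_top_of_le_ne_top hfin (measure_mono Set.inter_subset_left))
        (ne_top_of_le_ne_top hfin (measure_mono Set.inter_subset_left)), ih (by omega),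
        (W n).2.2.2 k (by omega)]
      · push_cast; ring
      · refine Set.disjoint_left.2 fun x hx hx' => ?_
        have h1 := hx.2
        have h2 := hx'.2
        simp only [Set.mem_ofPred_eq] at h1 h2
        omega
  have hdist : ∀ t : ℝ, 0 ≤ t → t < 1 → μ.real (E ∩ {x | U x ≤ t}) = t * m := by
    intro t ht0 ht1
    have hfl : ∀ n : ℕ, ∃ k : ℕ, k + 1 ≤ 2 ^ n ∧ (k : ℝ) ≤ t * 2 ^ n ∧ t * 2 ^ n < k + 1 := by
      intro n
      refine ⟨⌊t * 2 ^ n⌋₊, ?_, Nat.floor_le (by positivity), Nat.lt_floor_add_one _⟩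
      rw [Nat.add_one_le_iff, Nat.floor_lt (by positivity)]
      push_cast
      nlinarith [show (0 : ℝ) < 2 ^ n by positivity]
    have hfinE : ∀ s : Set R, μ (E ∩ s) ≠ ∞ := fun s =>
      ne_top_of_le_ne_top hfin (measure_mono Set.inter_subset_left)
    have hlow : ∀ n : ℕ, t * m - m * (1 / 2) ^ n ≤ μ.real (E ∩ {x | U x ≤ t}) := by
      intro n
      obtain ⟨k, hk, hk1, hk2⟩ := hfl n
      have h2 : (0 : ℝ) < 2 ^ n := by positivity
      calc t * m - m * (1 / 2) ^ n = (t * 2 ^ n - 1) * (m / 2 ^ n) := by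
            rw [one_div_pow]; field_simp
        _ ≤ k * (m / 2 ^ n) := by gcongr; linarith
        _ = μ.real (E ∩ {x | (W n).1 x < k}) := (hcount n k (by omega)).symm
        _ ≤ _ := by
            refine measureReal_mono (Set.inter_subset_inter_right _ fun x hx => ?_) (hfinE _)
            refine (hUb n x).trans ?_
            simp only [hb]
            rw [div_le_iff₀ h2]
            refine le_trans ?_ hk1
            exact_mod_cast (show (W n).1 x + 1 ≤ k from hx)
    have hup : ∀ n : ℕ, μ.real (E ∩ {x | U x ≤ t}) ≤ t * m + m * (1 / 2) ^ n := by
      intro n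
      obtain ⟨k, hk, hk1, hk2⟩ := hfl n
      have h2 : (0 : ℝ) < 2 ^ n := by positivity
      calc μ.real (E ∩ {x | U x ≤ t}) ≤ μ.real (E ∩ {x | (W n).1 x < k + 1}) := by
            refine measureReal_mono (Set.inter_subset_inter_right _ fun x hx => ?_) (hfinE _)
            have h3 := (haU n x).trans hx
            simp only [ha] at h3
            rw [div_le_iff₀ h2] at h3
            exact_mod_cast h3.trans_lt hk2
        _ = (k + 1 : ℕ) * (m / 2 ^ n) := hcount n (k + 1) hk
        _ ≤ (t * 2 ^ n + 1) * (m / 2 ^ n) := by gcongr; push_cast; linarith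
        _ = t * m + m * (1 / 2) ^ n := by rw [one_div_pow]; field_simp
    have hz : Filter.Tendsto (fun n : ℕ => m * (1 / 2 : ℝ) ^ n) Filter.atTop (nhds 0) := by
      simpa using (tendsto_pow_atTop_nhds_zero_of_lt_one (r := (1 / 2 : ℝ)) (by norm_num)
        (by norm_num)).const_mul m
    have hz1 := hz.const_add (t * m)
    have hz2 := hz.const_sub (t * m)
    rw [add_zero] at hz1
    rw [sub_zero] at hz2
    exact le_antisymm (ge_of_tendsto' hz1 hup) (le_of_tendsto' hz2 hlow)
  refine ⟨fun x => m * U x, hUm.const_mul m, fun x => mul_nonneg hm0 (hU0 x), ?_⟩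
  have : IsFiniteMeasure (μ.restrict E) := ⟨by simpa using hfin.lt_top⟩
  have hmE : μ E = ENNReal.ofReal m := (ENNReal.ofReal_toReal hfin).symm
  refine Measure.ext_of_Iic _ _ fun t => ?_
  rw [Measure.map_apply (hUm.const_mul m) measurableSet_Iic,
    Measure.restrict_apply (hUm.const_mul m measurableSet_Iic), Measure.restrict_apply
    measurableSet_Iic]
  rcases lt_or_ge t 0 with ht | ht
  · have h1 : (fun x => m * U x) ⁻¹' Set.Iic t = ∅ := by
      ext x
      have := mul_nonneg hm0 (hU0 x)
      simp only [Set.mem_preimage, Set.mem_Iic, Set.mem_empty_iff_false, iff_false, not_le]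
      linarith
    have h2 : Set.Iic t ∩ Set.Ico 0 m = ∅ := by
      ext x
      simp only [Set.mem_inter_iff, Set.mem_Iic, Set.mem_Ico, Set.mem_empty_iff_false, iff_false]
      rintro ⟨h3, h4, -⟩
      linarith
    rw [h1, h2]; simp
  rcases lt_or_ge t m with htm | htm
  · have hmpos : 0 < m := ht.trans_lt htm
    have h2 : Set.Iic t ∩ Set.Ico 0 m = Set.Icc 0 t := by
      ext x
      simp only [Set.mem_inter_iff, Set.mem_Iic, Set.mem_Ico, Set.mem_Icc]
      constructor
      · rintro ⟨h3, h4, -⟩; exact ⟨h4, h3⟩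
      · rintro ⟨h3, h4⟩; exact ⟨h4, h3, h4.trans_lt htm⟩
    have h1 : (fun x => m * U x) ⁻¹' Set.Iic t ∩ E = E ∩ {x | U x ≤ t / m} := by
      rw [Set.inter_comm]
      congr 1
      ext x
      simp only [Set.mem_preimage, Set.mem_Iic, Set.mem_ofPred_eq]
      rw [le_div_iff₀ hmpos, mul_comm]
    rw [h1, h2, Real.volume_Icc, sub_zero, ← ENNReal.ofReal_toReal (a := μ (E ∩ _))
      (ne_top_of_le_ne_top hfin (measure_mono Set.inter_subset_left)), ← measureReal_def,
      hdist _ (by positivity) ((div_lt_one hmpos).2 htm), div_mul_cancel₀ _ hmpos.ne']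
  · have h1 : (fun x => m * U x) ⁻¹' Set.Iic t ∩ E = E := by
      refine Set.inter_eq_right.2 fun x _ => ?_
      have := mul_le_mul_of_nonneg_left (hU1 x) hm0
      simp only [Set.mem_preimage, Set.mem_Iic]
      linarith
    have h2 : Set.Iic t ∩ Set.Ico 0 m = Set.Ico 0 m :=
      Set.inter_eq_right.2 fun x hx => hx.2.le.trans htm
    rw [h1, h2, Real.volume_Ico, sub_zero, hmE]

/-- A measure-preserving parametrisation of a function with finitely many levels: `σ` transports
`μ` on `{V > 0}` to Lebesgue measure on an interval, higher levels of `V` coming first. -/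
lemma IsNonatomic.exists_uniform_levels (hμ : IsNonatomic μ) {V : R → ℕ} (hV : Measurable V)
    {J : ℕ} (hJ : ∀ x, V x ≤ J) (hfin : μ {x | 0 < V x} ≠ ∞) :
    ∃ σ : R → ℝ, Measurable σ ∧ (∀ x, 0 < V x → μ {y | V x < V y} ≤ ENNReal.ofReal (σ x)) ∧
      (μ.restrict {x | 0 < V x}).map σ = volume.restrict (Set.Ico 0 (μ.real {x | 0 < V x})) := by
  have hms : ∀ T : Set ℕ, MeasurableSet {x | V x ∈ T} := fun T => hV (MeasurableSet.of_discrete)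
  have hfinv : ∀ v, μ {x | v < V x} ≠ ∞ := fun v =>
    ne_top_of_le_ne_top hfin (measure_mono fun x (hx : v < V x) => (Nat.zero_le v).trans_lt hx)
  have hfine : ∀ v, 0 < v → μ {x | V x = v} ≠ ∞ := fun v hv =>
    ne_top_of_le_ne_top hfin (measure_mono fun x (hx : V x = v) => show 0 < V x by omega)
  have hex : ∀ v, ∃ U : R → ℝ, Measurable U ∧ (∀ x, 0 ≤ U x) ∧ (0 < v →
      (μ.restrict {x | V x = v}).map U = volume.restrict (Set.Ico 0 (μ.real {x | V x = v}))) := by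
    intro v
    rcases Nat.eq_zero_or_pos v with rfl | hv
    · exact ⟨0, measurable_const, fun _ => le_rfl, fun h => absurd h (lt_irrefl _)⟩
    · obtain ⟨U, h1, h2, h3⟩ := hμ.exists_uniform (hms {v}) (hfine v hv)
      exact ⟨U, h1, h2, fun _ => h3⟩
  choose U hUm hU0 hU using hex
  set σ : R → ℝ := fun x => μ.real {y | V x < V y} + U (V x) x with hσ
  have hσm : Measurable σ := by
    have h1 : Measurable (Function.uncurry fun (v : ℕ) (x : R) => μ.real {y | v < V y} + U v x) :=
      measurable_from_prod_countable_right fun v => by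
        have h2 := (hUm v).const_add (μ.real {y | v < V y})
        exact h2
    exact h1.comp (hV.prodMk measurable_id)
  refine ⟨σ, hσm, fun x hx => ?_, ?_⟩
  · rw [← ENNReal.ofReal_toReal (hfinv (V x))]
    exact ENNReal.ofReal_le_ofReal (le_add_of_nonneg_right (hU0 _ _))
  have key : ∀ k v, J ≤ v + k → (μ.restrict {x | v < V x}).map σ =
      volume.restrict (Set.Ico 0 (μ.real {x | v < V x})) := by
    intro k
    induction k with
    | zero =>
      intro v hv
      have : {x | v < V x} = ∅ := by
        ext x
        have := hJ x
        simp only [Set.mem_ofPred_eq, Set.mem_empty_iff_false, iff_false]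
        omega
      simp [this]
    | succ k ih =>
      intro v hv
      have hset : {x | v < V x} = {x | v + 1 < V x} ∪ {x | V x = v + 1} := by
        ext x
        simp only [Set.mem_ofPred_eq, Set.mem_union]
        omega
      have hdisj : Disjoint {x | v + 1 < V x} {x | V x = v + 1} :=
        Set.disjoint_left.2 fun x (h1 : v + 1 < V x) (h2 : V x = v + 1) => by omega
      set M := μ.real {x | v + 1 < V x} with hM
      set m := μ.real {x | V x = v + 1} with hmm
      have hM0 : 0 ≤ M := measureReal_nonneg
      have hm0 : 0 ≤ m := measureReal_nonneg
      have hreal : μ.real {x | v < V x} = M + m := by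
        rw [hset, measureReal_union hdisj (hms {v + 1}) (hfinv _) (hfine _ (by omega))]
      have hshift : (volume.restrict (Set.Ico 0 m)).map (fun t => M + t) =
          volume.restrict (Set.Ico M (M + m)) := by
        have h1 := (measurePreserving_add_left (volume : Measure ℝ) M).restrict_preimage
          (s := Set.Ico M (M + m)) measurableSet_Ico
        have h2 : (fun t => M + t) ⁻¹' Set.Ico M (M + m) = Set.Ico 0 m := by
          ext t; simp
        rw [h2] at h1
        exact h1.map_eq
      have hpiece : (μ.restrict {x | V x = v + 1}).map σ = volume.restrict (Set.Ico M (M + m)) := by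
        rw [← hshift, ← hU (v + 1) (by omega), Measure.map_map (by fun_prop) (hUm _)]
        refine Measure.map_congr ?_
        filter_upwards [ae_restrict_mem (hms {v + 1})] with x hx
        have hx' : V x = v + 1 := hx
        simp only [hσ, Function.comp, hx', hM]
      rw [hreal, hset, Measure.restrict_union hdisj (hms {v + 1}), Measure.map_add _ _ hσm,
        ih (v + 1) (by omega), hpiece, ← Measure.restrict_union _ measurableSet_Ico,
        Set.Ico_union_Ico_eq_Ico hM0 (by linarith)]
      exact Set.disjoint_left.2 fun t h1 h2 => not_lt.2 h2.1 h1.2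
  exact key J 0 (by omega)

end Nonatomic

/-! ### Sharpness of Hölder's inequality for `s ≤ p` -/

section Sharp

variable {R : Type*} [MeasurableSpace R] {μ : Measure R}

lemma rearrangement_le_iSup {f : R → ℝ} {F : ℕ → R → ℝ}
    (hmono : ∀ x, Monotone fun n => ‖F n x‖ₑ)
    (hlim : ∀ x l, l < ‖f x‖ₑ → ∃ n, l < ‖F n x‖ₑ) (t : ℝ) :
    rearrangement μ f t ≤ ⨆ n, rearrangement μ (F n) t := by
  rw [rearrangement_le_iff]
  set l := ⨆ n, rearrangement μ (F n) t with hl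
  have h1 : {x | l < ‖f x‖ₑ} ⊆ ⋃ n, {x | l < ‖F n x‖ₑ} := fun x hx =>
    Set.mem_iUnion.2 (hlim x l hx)
  have h2 : Monotone fun n => {x | l < ‖F n x‖ₑ} := fun m n hmn x hx =>
    lt_of_lt_of_le hx (hmono x hmn)
  refine (measure_mono h1).trans ?_
  rw [h2.measure_iUnion]
  exact iSup_le fun n => rearrangement_le_iff.1 (le_iSup (fun n => rearrangement μ (F n) t) n)

lemma halfLineNorm_iSup_le {p : ℝ} {s : ℝ≥0∞} (hs1 : 1 ≤ s) (hs : s ≠ ∞) {u : ℕ → ℝ → ℝ≥0∞}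
    (hu : ∀ n, Measurable (u n)) (hmono : Monotone u) {K : ℝ≥0∞}
    (hK : ∀ n, halfLineNorm p s (u n) ≤ K) : halfLineNorm p s (fun t => ⨆ n, u n t) ≤ K := by
  have hs0 : 0 < s.toReal := ENNReal.toReal_pos (zero_lt_one.trans_le hs1).ne' hs
  rw [← ENNReal.rpow_le_rpow_iff hs0, halfLineNorm_rpow hs hs1]
  have h1 : ∀ t, (⨆ n, u n t) ^ s.toReal = ⨆ n, u n t ^ s.toReal := fun t =>
    (ENNReal.orderIsoRpow s.toReal hs0).map_iSup _
  simp_rw [h1, ENNReal.mul_iSup]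
  rw [lintegral_iSup (fun n => by have := hu n; fun_prop) fun m n hmn t => by
    dsimp only
    gcongr
    exact hmono hmn t]
  refine iSup_le fun n => ?_
  rw [← halfLineNorm_rpow hs hs1]
  exact ENNReal.rpow_le_rpow (hK n) hs0.le

lemma ennreal_rpow_le_rpow_of_nonpos {a b : ℝ≥0∞} {z : ℝ} (hz : z ≤ 0) (h : a ≤ b) :
    b ^ z ≤ a ^ z := by
  rw [← neg_neg z, ENNReal.rpow_neg, ENNReal.rpow_neg a, ENNReal.inv_le_inv]
  exact ENNReal.rpow_le_rpow h (by linarith)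

/-- The extremal function in Hölder's inequality for a function `c V` with finitely many levels:
for `s ≤ p` the function `φ(t) = t^{s/p-1} (c V)*(t)^{s-1}` is non-increasing, hence it is the
rearrangement of its composition with the parametrisation `σ`. -/
lemma exists_extremal (hμ : IsNonatomic μ) {p : ℝ} (hp : 1 < p) {s : ℝ≥0∞} (hs1 : 1 ≤ s)
    (hsp : s ≤ ENNReal.ofReal p) {V : R → ℕ} (hV : Measurable V) {J : ℕ} (hJ : ∀ x, V x ≤ J)
    (hfin : μ {x | 0 < V x} ≠ ∞) {c : ℝ} (hc : 0 < c) :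
    ∃ h : R → ℝ, Measurable h ∧
      lorentzNorm μ p.conjExponent s.conjExponent h ≤
        (lorentzNorm μ p s fun x => c * V x) ^ (s.toReal - 1) ∧
      (lorentzNorm μ p s fun x => c * V x) ^ s.toReal ≤ ∫⁻ x, ‖c * V x‖ₑ * ‖h x‖ₑ ∂μ := by
  have hs : s ≠ ∞ := ne_top_of_le_ne_top ENNReal.ofReal_ne_top hsp
  have hs0 : 1 ≤ s.toReal := by
    rw [← ENNReal.toReal_one]; exact ENNReal.toReal_mono hs hs1
  have hsp' : s.toReal ≤ p := ENNReal.toReal_le_of_le_ofReal (by linarith) hsp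
  have hp0 : 0 < p := by linarith
  have hexp : s.toReal / p - 1 ≤ 0 := by rw [sub_nonpos, div_le_one hp0]; exact hsp'
  obtain ⟨σ, hσm, hσV, hσ⟩ := hμ.exists_uniform_levels hV hJ hfin
  set S : Set R := {x | 0 < V x} with hS
  have hSm : MeasurableSet S := hV (MeasurableSet.of_discrete (s := {n | 0 < n}))
  set M := μ.real S with hM
  set g : R → ℝ := fun x => c * V x with hg
  set u := rearrangement μ g with hu
  have hum : Measurable u := measurable_rearrangement
  have hgJ : ∀ x, ‖g x‖ₑ ≤ ENNReal.ofReal (c * J) := fun x => by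
    rw [Real.enorm_of_nonneg (by positivity)]
    have : (V x : ℝ) ≤ J := by exact_mod_cast hJ x
    exact ENNReal.ofReal_le_ofReal (mul_le_mul_of_nonneg_left this hc.le)
  have huJ : ∀ t, u t ≤ ENNReal.ofReal (c * J) := fun t => by
    rw [hu, rearrangement_le_iff]
    refine le_trans (le_of_eq ?_) zero_le
    convert measure_empty (μ := μ)
    ext x
    simpa using hgJ x
  have huM : ∀ t, M ≤ t → u t = 0 := fun t ht => by
    refine rearrangement_eq_zero_of_measure_le ?_
    have : {x | g x ≠ 0} = S := by
      ext x
      simp [hg, hS, hc.ne', Nat.pos_iff_ne_zero]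
    rw [this, ← ENNReal.ofReal_toReal hfin]
    exact ENNReal.ofReal_le_ofReal ht
  have huV : ∀ x ∈ S, u (σ x) ≤ ‖g x‖ₑ := fun x hx => by
    rw [hu, rearrangement_le_iff]
    refine le_trans (measure_mono fun y hy => ?_) (hσV x hx)
    simp only [hg, Set.mem_ofPred_eq] at hy ⊢
    rw [Real.enorm_of_nonneg (by positivity), Real.enorm_of_nonneg (by positivity),
      ENNReal.ofReal_lt_ofReal_iff_of_nonneg (by positivity)] at hy
    exact_mod_cast lt_of_mul_lt_mul_left hy hc.le
  set φ : ℝ → ℝ≥0∞ := fun t =>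
    if t < M then ENNReal.ofReal t ^ (s.toReal / p - 1) * u t ^ (s.toReal - 1) else 0 with hφ
  have hφm : Measurable φ := Measurable.ite measurableSet_Iio (by fun_prop) measurable_const
  have hφanti : ∀ {t t' : ℝ}, t ≤ t' → φ t' ≤ φ t := by
    intro t t' htt
    simp only [hφ]
    by_cases h' : t' < M
    · rw [if_pos h', if_pos (htt.trans_lt h')]
      refine mul_le_mul' (ennreal_rpow_le_rpow_of_nonpos hexp (ENNReal.ofReal_le_ofReal htt))
        (ENNReal.rpow_le_rpow (rearrangement_antitone htt) (by linarith))
    · rw [if_neg h']; exact zero_le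
  have hφfin : ∀ t, 0 < t → φ t ≠ ∞ := by
    intro t ht
    simp only [hφ]
    split_ifs
    · refine ENNReal.mul_ne_top (ENNReal.rpow_ne_top_of_ne_zero (by simpa using ht) (by simp))
        (ENNReal.rpow_ne_top_of_nonneg (by linarith)
          (ne_top_of_le_ne_top ENNReal.ofReal_ne_top (huJ t)))
    · simp
  set h : R → ℝ := fun x => S.indicator (fun x => (φ (σ x)).toReal) x with hh
  have hhm : Measurable h := (hφm.comp hσm).ennreal_toReal.indicator hSm
  have hhle : ∀ x, ‖h x‖ₑ ≤ S.indicator (fun x => φ (σ x)) x := fun x => by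
    by_cases hx : x ∈ S
    · simp only [hh, Set.indicator_of_mem hx]
      rw [Real.enorm_of_nonneg ENNReal.toReal_nonneg]
      exact ENNReal.ofReal_toReal_le
    · simp [hh, Set.indicator_of_notMem hx]
  -- the rearrangement of `h` is at most `φ`
  have hrear : ∀ t, 0 < t → rearrangement μ h t ≤ φ t := by
    intro t ht
    rw [rearrangement_le_iff]
    calc μ {x | φ t < ‖h x‖ₑ} ≤ μ (σ ⁻¹' Set.Iio t ∩ S) := by
          refine measure_mono fun x hx => ?_
          have h1 := lt_of_lt_of_le hx (hhle x)
          by_cases hxS : x ∈ S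
          · rw [Set.indicator_of_mem hxS] at h1
            refine ⟨?_, hxS⟩
            by_contra hcon
            simp only [Set.mem_preimage, Set.mem_Iio, not_lt] at hcon
            exact absurd (hφanti hcon) (not_le.2 h1)
          · rw [Set.indicator_of_notMem hxS] at h1
            exact absurd h1 not_lt_zero
      _ = volume (Set.Iio t ∩ Set.Ico 0 M) := by
          rw [← Measure.restrict_apply (hσm measurableSet_Iio), ← Measure.map_apply hσm
            measurableSet_Iio, hσ, Measure.restrict_apply measurableSet_Iio]
      _ ≤ volume (Set.Ico 0 t) := measure_mono fun y hy => ⟨hy.2.1, hy.1⟩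
      _ = ENNReal.ofReal t := by simp
  have hIpow : lorentzNorm μ p s g ^ s.toReal = ∫⁻ t in Set.Ioi (0 : ℝ),
      ENNReal.ofReal t ^ (s.toReal / p - 1) * u t ^ s.toReal := by
    rw [lorentzNorm_eq, halfLineNorm_rpow hs hs1]
  refine ⟨h, hhm, ?_, ?_⟩
  · refine (halfLineNorm_mono hrear).trans ?_
    have hpq := Real.HolderConjugate.conjExponent hp
    have hsr := ENNReal.HolderConjugate.conjExponent hs1
    set q := p.conjExponent
    set r := s.conjExponent
    have hinv := hpq.inv_add_inv_eq_one
    by_cases hs' : s = 1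
    · have hr : r = ∞ := by
        have := hsr.inv_add_inv_eq_one
        simpa [hs'] using this
      rw [hr, halfLineNorm, if_pos rfl]
      refine iSup₂_le fun t ht => ?_
      simp only [hφ, hs', ENNReal.toReal_one, sub_self, ENNReal.rpow_zero, mul_one]
      split_ifs
      · rw [← ENNReal.rpow_add _ _ (by simpa using ht) (by simp)]
        rw [show 1 / q + (1 / p - 1) = 0 by rw [one_div, one_div]; linarith, ENNReal.rpow_zero]
      · simp
    · have hs1' : 1 < s.toReal := by
        refine lt_of_le_of_ne hs0 fun h => hs' ?_
        rw [← ENNReal.ofReal_toReal hs, ← h, ENNReal.ofReal_one]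
      have hr : r ≠ ∞ := by
        intro hr
        have := hsr.inv_add_inv_eq_one
        exact hs' (by simpa [hr] using this)
      have hC : s.toReal.HolderConjugate r.toReal := ENNReal.HolderConjugate.toReal hs1'
      have hmul : (s.toReal - 1) * r.toReal = s.toReal := by
        have := hC.mul_eq_add
        linarith
      have hexp2 : s.toReal - 1 = s.toReal * (1 / r.toReal) := by
        have := hC.symm.pos
        field_simp
        linarith
      rw [hexp2, ENNReal.rpow_mul, hIpow, halfLineNorm_of_ne_top hr]
      refine ENNReal.rpow_le_rpow (setLIntegral_mono' measurableSet_Ioi fun t ht => ?_)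
        (by have := hC.symm.pos; positivity)
      have h0 : ENNReal.ofReal t ≠ 0 := by simpa using ht
      simp only [hφ]
      split_ifs
      · rw [ENNReal.mul_rpow_of_nonneg _ _ hC.symm.nonneg, ← ENNReal.rpow_mul, ← ENNReal.rpow_mul,
          hmul, ← mul_assoc, ← ENNReal.rpow_add _ _ h0 (by simp)]
        refine le_of_eq ?_
        congr 2
        have h5 : 1 / q = 1 - 1 / p := by rw [one_div, one_div]; linarith
        rw [div_eq_mul_one_div r.toReal q, h5]
        have : (s.toReal / p - 1) * r.toReal = s.toReal / p + r.toReal / p - r.toReal := by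
          rw [← add_div, ← hC.mul_eq_add]; ring
        rw [this]
        ring
      · rw [ENNReal.zero_rpow_of_pos hC.symm.pos, mul_zero]; exact zero_le
  · have hpos : ∀ᵐ x ∂(μ.restrict S), 0 < σ x := by
      have h1 : ∀ᵐ t ∂(volume.restrict (Set.Ico 0 M)), 0 < t := by
        rw [← Measure.restrict_congr_set Ioo_ae_eq_Ico]
        exact (ae_restrict_mem measurableSet_Ioo).mono fun t ht => ht.1
      rw [← hσ] at h1
      exact ae_of_ae_map hσm.aemeasurable h1
    have hint : ∫⁻ x, ‖g x‖ₑ * ‖h x‖ₑ ∂μ = ∫⁻ x in S, ‖g x‖ₑ * ‖h x‖ₑ ∂μ := by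
      rw [← lintegral_indicator hSm]
      refine lintegral_congr fun x => ?_
      by_cases hx : x ∈ S
      · rw [Set.indicator_of_mem hx]
      · rw [Set.indicator_of_notMem hx]; simp [hh, Set.indicator_of_notMem hx]
    rw [hint, hIpow]
    calc ∫⁻ t in Set.Ioi (0 : ℝ), ENNReal.ofReal t ^ (s.toReal / p - 1) * u t ^ s.toReal
        = ∫⁻ t in Set.Ioi (0 : ℝ), (Set.Ioo 0 M).indicator (fun t => u t * φ t) t := by
          refine setLIntegral_congr_fun measurableSet_Ioi fun t ht => ?_
          rcases lt_or_ge t M with htM | htM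
          · rw [Set.indicator_of_mem (show t ∈ Set.Ioo 0 M from ⟨ht, htM⟩)]
            simp only [hφ, if_pos htM]
            rw [mul_left_comm]
            congr 1
            conv_lhs => rw [show s.toReal = 1 + (s.toReal - 1) by ring,
              ENNReal.rpow_add_of_nonneg _ _ zero_le_one (by linarith), ENNReal.rpow_one]
          · rw [Set.indicator_of_notMem (fun h => not_lt.2 htM h.2)]
            rw [huM t htM, ENNReal.zero_rpow_of_pos (by linarith), mul_zero]
      _ = ∫⁻ t in Set.Ico 0 M, u t * φ t := by
          rw [setLIntegral_indicator measurableSet_Ioo, Set.inter_eq_left.2 Set.Ioo_subset_Ioi_self,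
            Measure.restrict_congr_set Ioo_ae_eq_Ico]
      _ = ∫⁻ x in S, u (σ x) * φ (σ x) ∂μ := by
          rw [← hσ, lintegral_map (f := fun t => u t * φ t) (hum.mul hφm) hσm]
      _ ≤ ∫⁻ x in S, ‖g x‖ₑ * ‖h x‖ₑ ∂μ := by
          refine lintegral_mono_ae ?_
          filter_upwards [hpos, ae_restrict_mem hSm] with x hx hxS
          refine mul_le_mul' (huV x hxS) (le_of_eq ?_)
          simp only [hh, Set.indicator_of_mem hxS]
          rw [Real.enorm_of_nonneg ENNReal.toReal_nonneg, ENNReal.ofReal_toReal (hφfin _ hx)]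

lemma lorentzNorm_le_of_bounded {p : ℝ} (hp : 0 < p) {s : ℝ≥0∞} (hs1 : 1 ≤ s) (hs : s ≠ ∞)
    {f : R → ℝ} {C : ℝ≥0∞} (hf : ∀ x, ‖f x‖ₑ ≤ C) {M : ℝ} (hM : 0 ≤ M)
    (hfM : μ {x | f x ≠ 0} ≤ ENNReal.ofReal M) :
    lorentzNorm μ p s f ≤
      C * ENNReal.ofReal (M ^ (s.toReal / p) / (s.toReal / p)) ^ (1 / s.toReal) := by
  have hs0 : 0 < s.toReal := ENNReal.toReal_pos (zero_lt_one.trans_le hs1).ne' hs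
  have hle : ∀ t, rearrangement μ f t ≤ C := fun t => by
    rw [rearrangement_le_iff]
    refine le_trans (le_of_eq ?_) zero_le
    convert measure_empty (μ := μ)
    ext x
    simpa using hf x
  have h0 : ∀ t, M ≤ t → rearrangement μ f t = 0 := fun t ht =>
    rearrangement_eq_zero_of_measure_le (hfM.trans (ENNReal.ofReal_le_ofReal ht))
  rw [← ENNReal.rpow_le_rpow_iff hs0, lorentzNorm_eq, halfLineNorm_rpow hs hs1,
    ENNReal.mul_rpow_of_nonneg _ _ hs0.le, ← ENNReal.rpow_mul, one_div_mul_cancel hs0.ne',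
    ENNReal.rpow_one, ← lintegral_Ioo_rpow (by positivity) hM,
    ← lintegral_const_mul _ (by fun_prop)]
  calc ∫⁻ t in Set.Ioi (0 : ℝ), ENNReal.ofReal t ^ (s.toReal / p - 1) *
        rearrangement μ f t ^ s.toReal
      ≤ ∫⁻ t in Set.Ioi (0 : ℝ), (Set.Ioo 0 M).indicator
          (fun t => C ^ s.toReal * ENNReal.ofReal t ^ (s.toReal / p - 1)) t := by
        refine setLIntegral_mono' measurableSet_Ioi fun t ht => ?_
        rcases lt_or_ge t M with htM | htM
        · rw [Set.indicator_of_mem (show t ∈ Set.Ioo 0 M from ⟨ht, htM⟩), mul_comm]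
          gcongr
          exact hle t
        · rw [h0 t htM, ENNReal.zero_rpow_of_pos hs0, mul_zero]
          exact zero_le
    _ = _ := by
        rw [setLIntegral_indicator measurableSet_Ioo, Set.inter_eq_left.2 Set.Ioo_subset_Ioi_self]

lemma lorentzNorm_lt_top_of_bounded {p : ℝ} (hp : 0 < p) {s : ℝ≥0∞} (hs1 : 1 ≤ s) (hs : s ≠ ∞)
    {f : R → ℝ} {C : ℝ≥0∞} (hC : C ≠ ∞) (hf : ∀ x, ‖f x‖ₑ ≤ C) (hfin : μ {x | f x ≠ 0} ≠ ∞) :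
    lorentzNorm μ p s f < ∞ := by
  refine (lorentzNorm_le_of_bounded hp hs1 hs hf ENNReal.toReal_nonneg
    (ENNReal.ofReal_toReal hfin).ge).trans_lt ?_
  exact ENNReal.mul_lt_top hC.lt_top (ENNReal.rpow_lt_top_of_nonneg (by positivity) (by simp))

/-- Every measurable function is the increasing limit, in absolute value, of functions `2⁻ⁿ Vₙ`
with integer-valued `Vₙ` of bounded range and support of finite measure. -/
lemma exists_levels_approx [SigmaFinite μ] {g : R → ℝ} (hg : Measurable g) :
    ∃ V : ℕ → R → ℕ, (∀ n, Measurable (V n)) ∧ (∀ n, ∃ J, ∀ x, V n x ≤ J) ∧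
      (∀ n, μ {x | 0 < V n x} ≠ ∞) ∧
      (∀ n x, ‖((2 : ℝ) ^ n)⁻¹ * V n x‖ₑ ≤ ‖g x‖ₑ) ∧
      (∀ x, Monotone fun n => ‖((2 : ℝ) ^ n)⁻¹ * V n x‖ₑ) ∧
      ∀ x l, l < ‖g x‖ₑ → ∃ n, l < ‖((2 : ℝ) ^ n)⁻¹ * V n x‖ₑ := by
  classical
  set V : ℕ → R → ℕ := fun n x =>
    if x ∈ spanningSets μ n then ⌊(2 : ℝ) ^ n * min (n : ℝ) |g x|⌋₊ else 0 with hV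
  have hle : ∀ n x, ((2 : ℝ) ^ n)⁻¹ * V n x ≤ min (n : ℝ) |g x| := by
    intro n x
    have h2 : (0 : ℝ) < 2 ^ n := by positivity
    rw [inv_mul_le_iff₀ h2]
    simp only [hV]
    split_ifs
    · exact Nat.floor_le (by positivity)
    · simp only [Nat.cast_zero]; positivity
  have henorm : ∀ n x, ‖((2 : ℝ) ^ n)⁻¹ * V n x‖ₑ = ENNReal.ofReal (((2 : ℝ) ^ n)⁻¹ * V n x) :=
    fun n x => Real.enorm_of_nonneg (by positivity)
  refine ⟨V, fun n => ?_, fun n => ⟨2 ^ n * n, fun x => ?_⟩, fun n => ?_, fun n x => ?_,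
    fun x => ?_, fun x l hl => ?_⟩
  · exact Measurable.ite (measurableSet_spanningSets μ n)
      (Nat.measurable_floor.comp (by fun_prop)) measurable_const
  · have h2 : (0 : ℝ) < 2 ^ n := by positivity
    have := (hle n x).trans (min_le_left _ _)
    rw [inv_mul_le_iff₀ h2] at this
    exact_mod_cast this
  · refine ne_top_of_le_ne_top (measure_spanningSets_lt_top μ n).ne (measure_mono fun x hx => ?_)
    by_contra hcon
    simp [hV, hcon] at hx
  · rw [henorm, Real.enorm_eq_ofReal_abs]
    exact ENNReal.ofReal_le_ofReal ((hle n x).trans (min_le_right _ _))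
  · refine monotone_nat_of_le_succ fun n => ?_
    rw [henorm, henorm]
    refine ENNReal.ofReal_le_ofReal ?_
    have h2 : (0 : ℝ) < 2 ^ n := by positivity
    rw [inv_mul_le_iff₀ h2, pow_succ, mul_inv, ← mul_assoc, mul_inv_cancel_left₀ h2.ne',
      le_inv_mul_iff₀ two_pos]
    have : 2 * V n x ≤ V (n + 1) x := by
      simp only [hV]
      by_cases hx : x ∈ spanningSets μ n
      · rw [if_pos hx, if_pos (monotone_spanningSets μ n.le_succ hx)]
        refine Nat.le_floor ?_
        push_cast
        have h3 := Nat.floor_le (show 0 ≤ (2 : ℝ) ^ n * min (n : ℝ) |g x| by positivity)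
        have h4 : min (n : ℝ) |g x| ≤ min (n + 1 : ℝ) |g x| := by gcongr; linarith
        calc _ ≤ 2 * ((2 : ℝ) ^ n * min (n : ℝ) |g x|) := by gcongr
          _ ≤ 2 * ((2 : ℝ) ^ n * min (n + 1 : ℝ) |g x|) := by gcongr
          _ = _ := by ring
      · rw [if_neg hx]; omega
    exact_mod_cast this
  · have hlt : l ≠ ∞ := hl.ne_top
    have hl' : l.toReal < |g x| := by
      rw [Real.enorm_eq_ofReal_abs, ← ENNReal.ofReal_toReal hlt] at hl
      exact (ENNReal.ofReal_lt_ofReal_iff_of_nonneg ENNReal.toReal_nonneg).1 hl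
    obtain ⟨n₁, hn₁⟩ : ∃ n, x ∈ spanningSets μ n := by
      have := Set.mem_univ x
      rw [← iUnion_spanningSets μ] at this
      exact Set.mem_iUnion.1 this
    obtain ⟨n₂, hn₂⟩ := exists_nat_ge |g x|
    obtain ⟨n₃, hn₃⟩ := exists_pow_lt_of_lt_one (sub_pos.2 hl') (show (1 / 2 : ℝ) < 1 by norm_num)
    set n := max n₁ (max n₂ n₃)
    refine ⟨n, ?_⟩
    rw [henorm, ← ENNReal.ofReal_toReal hlt]
    refine (ENNReal.ofReal_lt_ofReal_iff_of_nonneg ENNReal.toReal_nonneg).2 ?_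
    have h2 : (0 : ℝ) < 2 ^ n := by positivity
    have hx : x ∈ spanningSets μ n := monotone_spanningSets μ (le_max_left _ _) hn₁
    have hn : |g x| ≤ n := hn₂.trans (by
      exact_mod_cast (le_max_left n₂ n₃).trans (le_max_right _ _))
    have h3 : (1 / 2 : ℝ) ^ n ≤ (1 / 2) ^ n₃ :=
      pow_le_pow_of_le_one (by norm_num) (by norm_num)
        ((le_max_right n₂ n₃).trans (le_max_right _ _))
    have h5 := Nat.lt_floor_add_one ((2 : ℝ) ^ n * min (n : ℝ) |g x|)
    simp only [hV, if_pos hx]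
    rw [min_eq_right hn] at h5 ⊢
    rw [lt_inv_mul_iff₀ h2]
    have h6 : (2 : ℝ) ^ n * (1 / 2) ^ n = 1 := by rw [← mul_pow]; norm_num
    have h7 : (2 : ℝ) ^ n * (1 / 2) ^ n < 2 ^ n * (|g x| - l.toReal) := by
      gcongr; exact h3.trans_lt hn₃
    rw [h6] at h7
    linarith

/-- The converse of Hölder's inequality: for `1 ≤ s ≤ p` the Lorentz functional `‖·‖_{p,s}` is
dual to `‖·‖_{p',s'}`. -/
theorem lorentzNorm_le_of_forall_lintegral_mul_le [SigmaFinite μ] (hμ : IsNonatomic μ) {p : ℝ}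
    (hp : 1 < p) {s : ℝ≥0∞} (hs1 : 1 ≤ s) (hsp : s ≤ ENNReal.ofReal p) {g : R → ℝ}
    (hg : AEMeasurable g μ) {K : ℝ≥0∞}
    (H : ∀ h : R → ℝ, MemLorentz μ p.conjExponent s.conjExponent h →
      ∫⁻ x, ‖g x‖ₑ * ‖h x‖ₑ ∂μ ≤ K * lorentzNorm μ p.conjExponent s.conjExponent h) :
    lorentzNorm μ p s g ≤ K := by
  have hs : s ≠ ∞ := ne_top_of_le_ne_top ENNReal.ofReal_ne_top hsp
  have hs0 : 1 ≤ s.toReal := by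
    rw [← ENNReal.toReal_one]; exact ENNReal.toReal_mono hs hs1
  obtain ⟨V, hV, hJ, hfin, hle, hmono, hlim⟩ := exists_levels_approx (μ := μ) hg.measurable_mk
  have hgn : ∀ n, lorentzNorm μ p s (fun x => ((2 : ℝ) ^ n)⁻¹ * V n x) ≤ K := by
    intro n
    obtain ⟨J, hJ⟩ := hJ n
    have hc : (0 : ℝ) < ((2 : ℝ) ^ n)⁻¹ := by positivity
    obtain ⟨h, hhm, hh1, hh2⟩ := exists_extremal hμ hp hs1 hsp (hV n) hJ (hfin n) hc
    set N := lorentzNorm μ p s (fun x => ((2 : ℝ) ^ n)⁻¹ * V n x) with hN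
    have hNfin : N < ∞ := by
      refine lorentzNorm_lt_top_of_bounded (by linarith) hs1 hs
        (C := ENNReal.ofReal (((2 : ℝ) ^ n)⁻¹ * J)) ENNReal.ofReal_ne_top (fun x => ?_) ?_
      · rw [Real.enorm_of_nonneg (by positivity)]
        have : (V n x : ℝ) ≤ J := by exact_mod_cast hJ x
        exact ENNReal.ofReal_le_ofReal (mul_le_mul_of_nonneg_left this hc.le)
      · convert hfin n using 3
        ext x
        simp [Nat.pos_iff_ne_zero]
    rcases eq_or_ne N 0 with h0 | h0
    · rw [h0]; exact zero_le
    have hpow : N ^ s.toReal ≤ K * N ^ (s.toReal - 1) :=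
      calc N ^ s.toReal ≤ ∫⁻ x, ‖((2 : ℝ) ^ n)⁻¹ * V n x‖ₑ * ‖h x‖ₑ ∂μ := hh2
        _ ≤ ∫⁻ x, ‖g x‖ₑ * ‖h x‖ₑ ∂μ := by
            refine lintegral_mono_ae ?_
            filter_upwards [hg.ae_eq_mk] with x hx
            rw [hx]
            gcongr
            exact hle n x
        _ ≤ K * lorentzNorm μ p.conjExponent s.conjExponent h :=
            H h ⟨hhm.aemeasurable, hh1.trans_lt
              (ENNReal.rpow_lt_top_of_nonneg (by linarith) hNfin.ne)⟩
        _ ≤ K * N ^ (s.toReal - 1) := by gcongr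
    have h1 : N ^ s.toReal = N * N ^ (s.toReal - 1) := by
      conv_lhs => rw [show s.toReal = 1 + (s.toReal - 1) by ring,
        ENNReal.rpow_add_of_nonneg _ _ zero_le_one (by linarith), ENNReal.rpow_one]
    rw [h1] at hpow
    exact (ENNReal.mul_le_mul_iff_left (by simp [h0, hNfin.ne])
      (ENNReal.rpow_ne_top_of_nonneg (by linarith) hNfin.ne)).1 hpow
  refine le_trans ?_ (halfLineNorm_iSup_le (p := p) hs1 hs
    (u := fun n => rearrangement μ (fun x => ((2 : ℝ) ^ n)⁻¹ * V n x))
    (fun n => measurable_rearrangement)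
    (fun m n hmn t => rearrangement_mono (Filter.Eventually.of_forall fun x => hmono x hmn) t) hgn)
  rw [lorentzNorm_eq, rearrangement_congr hg.ae_eq_mk]
  exact halfLineNorm_mono fun t _ => rearrangement_le_iSup hmono hlim t

end Sharp

/-! ### Order continuity and norming functionals for finite `s` -/

section Finite

variable {R : Type*} [MeasurableSpace R] {μ : Measure R}

/-- For `s ≤ p` both norms agree with the Lorentz functional itself. -/
lemma decompNorm_le_dualNorm_of_le [SigmaFinite μ] (hμ : IsNonatomic μ) {p : ℝ}
    (hp : 1 < p) {s : ℝ≥0∞} (hs1 : 1 ≤ s) (hsp : s ≤ ENNReal.ofReal p) {f : R → ℝ}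
    (hf : MemLorentz μ p s f) : decompNorm μ p s f ≤ dualNorm μ p s f :=
  (decompNorm_le_lorentzNorm hf).trans
    (lorentzNorm_le_of_forall_lintegral_mul_le hμ hp hs1 hsp hf.1 fun _ hh =>
      lintegral_mul_le_dualNorm hp hs1 hf hh)

/-- The Lorentz functional is order continuous for finite `s`. -/
lemma tendsto_lorentzNorm_zero {p : ℝ} (hp : 0 < p) {s : ℝ≥0∞} (hs1 : 1 ≤ s) (hs : s ≠ ∞)
    {f : R → ℝ} (hf : MemLorentz μ p s f) {F : ℕ → R → ℝ} (hF : ∀ n, AEMeasurable (F n) μ)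
    (hle : ∀ n x, ‖F n x‖ₑ ≤ ‖f x‖ₑ)
    (hlim : ∀ x, Filter.Tendsto (fun n => F n x) Filter.atTop (nhds 0)) :
    Filter.Tendsto (fun n => lorentzNorm μ p s (F n)) Filter.atTop (nhds 0) := by
  have hs0 : 0 < s.toReal := ENNReal.toReal_pos (zero_lt_one.trans_le hs1).ne' hs
  have hrear : ∀ t, 0 < t →
      Filter.Tendsto (fun n => rearrangement μ (F n) t) Filter.atTop (nhds 0) := by
    intro t ht
    rw [ENNReal.tendsto_nhds_zero]
    intro l hl
    set A := {x | l < ‖f x‖ₑ} with hA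
    have hAfin : μ A < ∞ := measure_lt_of_lorentzNorm_lt_top hp hs1 hf.2 hl.ne'
    have : IsFiniteMeasure (μ.restrict A) := ⟨by simpa using hAfin⟩
    have h1 := tendstoInMeasure_of_tendsto_ae (μ := μ.restrict A) (f := F) (g := fun _ => 0)
      (fun n => (hF n).restrict.aestronglyMeasurable) (Filter.Eventually.of_forall hlim) l hl
    have h2 := (ENNReal.tendsto_nhds_zero.1 h1) (ENNReal.ofReal t) (by simpa using ht)
    filter_upwards [h2] with n hn
    rw [rearrangement_le_iff]
    refine le_trans ?_ hn
    refine le_trans (measure_mono fun x hx => ?_) (Measure.le_restrict_apply _ _)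
    have hx' : l < ‖F n x‖ₑ := hx
    refine ⟨?_, hx'.trans_le (hle n x)⟩
    show l ≤ edist (F n x) 0
    rw [edist_zero_right]
    exact hx'.le
  have hfin : ∫⁻ t in Set.Ioi (0 : ℝ),
      ENNReal.ofReal t ^ (s.toReal / p - 1) * rearrangement μ f t ^ s.toReal ≠ ∞ := by
    rw [← halfLineNorm_rpow hs hs1, ← lorentzNorm_eq]
    exact ENNReal.rpow_ne_top_of_nonneg hs0.le hf.2.ne
  have hdom := tendsto_lintegral_of_dominated_convergence
    (μ := volume.restrict (Set.Ioi (0 : ℝ)))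
    (F := fun n t => ENNReal.ofReal t ^ (s.toReal / p - 1) * rearrangement μ (F n) t ^ s.toReal)
    (f := fun _ => 0)
    (fun t => ENNReal.ofReal t ^ (s.toReal / p - 1) * rearrangement μ f t ^ s.toReal)
    (fun n => by
      have := measurable_rearrangement (μ := μ) (f := F n)
      fun_prop)
    (fun n => Filter.Eventually.of_forall fun t => by
      dsimp only
      gcongr
      exact rearrangement_mono (Filter.Eventually.of_forall (hle n)) t) hfin
    ((ae_restrict_mem measurableSet_Ioi).mono fun t ht => by
      have h3 : Filter.Tendsto (fun n => rearrangement μ (F n) t ^ s.toReal) Filter.atTop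
          (nhds 0) := by
        have := ((ENNReal.continuous_rpow_const (y := s.toReal)).tendsto 0).comp (hrear t ht)
        rwa [ENNReal.zero_rpow_of_pos hs0] at this
      have h4 := ENNReal.Tendsto.const_mul (a := ENNReal.ofReal t ^ (s.toReal / p - 1)) h3
        (Or.inr (ENNReal.rpow_ne_top_of_ne_zero (by simpa using ht) (by simp)))
      rwa [mul_zero] at h4)
  rw [lintegral_zero] at hdom
  have h5 := ((ENNReal.continuous_rpow_const (y := 1 / s.toReal)).tendsto 0).comp hdom
  rw [ENNReal.zero_rpow_of_pos (by positivity)] at h5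
  refine h5.congr fun n => ?_
  rw [lorentzNorm_eq, halfLineNorm_of_ne_top hs]
  rfl

/-- Simple functions supported on sets of finite measure are dense for finite `s`. -/
lemma exists_simpleFunc_approx [SigmaFinite μ] {p : ℝ} (hp : 0 < p) {s : ℝ≥0∞} (hs1 : 1 ≤ s)
    (hs : s ≠ ∞) {f : R → ℝ} (hf : MemLorentz μ p s f) {ε : ℝ≥0∞} (hε : 0 < ε) :
    ∃ k : SimpleFunc R ℝ, μ {x | k x ≠ 0} ≠ ∞ ∧ MemLorentz μ p s (fun x => f x - k x) ∧
      lorentzNorm μ p s (fun x => f x - k x) ≤ ε := by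
  set f₀ := hf.1.mk f
  have hf₀ : Measurable f₀ := hf.1.measurable_mk
  have hf₀' : MemLorentz μ p s f₀ :=
    hf.mono hf₀.aemeasurable (hf.1.ae_eq_mk.mono fun x hx => (congrArg _ hx.symm).le)
  let k : ℕ → SimpleFunc R ℝ := fun n =>
    (SimpleFunc.approxOn f₀ hf₀ Set.univ 0 (Set.mem_univ _) n).restrict (spanningSets μ n)
  have hkapp : ∀ n x, k n x = (spanningSets μ n).indicator
      (SimpleFunc.approxOn f₀ hf₀ Set.univ 0 (Set.mem_univ _) n) x := fun n x => by
    rw [SimpleFunc.restrict_apply _ (measurableSet_spanningSets μ n)]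
  have hle : ∀ n x, ‖f₀ x - k n x‖ₑ ≤ ‖f₀ x‖ₑ := by
    intro n x
    rw [hkapp]
    by_cases hx : x ∈ spanningSets μ n
    · rw [Set.indicator_of_mem hx, ← edist_eq_enorm_sub, edist_comm]
      refine (SimpleFunc.edist_approxOn_le hf₀ (Set.mem_univ _) x n).trans ?_
      rw [edist_zero_left]
      exact le_rfl
    · rw [Set.indicator_of_notMem hx, sub_zero]
  have hlim : ∀ x, Filter.Tendsto (fun n => f₀ x - k n x) Filter.atTop (nhds 0) := by
    intro x
    have h1 := SimpleFunc.tendsto_approxOn hf₀ (Set.mem_univ (0 : ℝ)) (x := x) (by simp)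
    have h2 := h1.const_sub (f₀ x)
    rw [sub_self] at h2
    refine h2.congr' ?_
    obtain ⟨m, hm⟩ : ∃ n, x ∈ spanningSets μ n := by
      have := Set.mem_univ x
      rw [← iUnion_spanningSets μ] at this
      exact Set.mem_iUnion.1 this
    filter_upwards [Filter.eventually_ge_atTop m] with n hn
    rw [hkapp, Set.indicator_of_mem (monotone_spanningSets μ hn hm)]
  have htend := tendsto_lorentzNorm_zero hp hs1 hs hf₀' (F := fun n x => f₀ x - k n x)
    (fun n => (hf₀.sub (k n).measurable).aemeasurable) hle hlim
  obtain ⟨n, hn⟩ := ((ENNReal.tendsto_nhds_zero.1 htend) ε hε).exists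
  have hae : ∀ᵐ x ∂μ, ‖f x - k n x‖ₑ = ‖f₀ x - k n x‖ₑ :=
    hf.1.ae_eq_mk.mono fun x hx => by rw [hx]
  refine ⟨k n, ?_, ?_, ?_⟩
  · refine ne_top_of_le_ne_top (measure_spanningSets_lt_top μ n).ne (measure_mono fun x hx => ?_)
    by_contra hcon
    exact hx (by rw [hkapp, Set.indicator_of_notMem hcon])
  · refine hf.mono (hf.1.sub (k n).measurable.aemeasurable) ?_
    filter_upwards [hf.1.ae_eq_mk] with x hx
    rw [hx]
    exact hle n x
  · rwa [lorentzNorm_congr_enorm hae]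

lemma memLorentz_indicator_simpleFunc {p : ℝ} (hp : 0 < p) {s : ℝ≥0∞} (hs1 : 1 ≤ s) (hs : s ≠ ∞)
    {S : Set R} (hS : MeasurableSet S) (hSfin : μ S ≠ ∞) (k : SimpleFunc R ℝ) :
    MemLorentz μ p s (S.indicator k) := by
  obtain ⟨C, hC⟩ := k.exists_forall_norm_le
  refine ⟨(k.measurable.indicator hS).aemeasurable, ?_⟩
  refine lorentzNorm_lt_top_of_bounded hp hs1 hs (C := ENNReal.ofReal C) ENNReal.ofReal_ne_top
    (fun x => ?_) (ne_top_of_le_ne_top hSfin (measure_mono fun x hx => ?_))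
  · by_cases hx : x ∈ S
    · rw [Set.indicator_of_mem hx, ← ofReal_norm]
      exact ENNReal.ofReal_le_ofReal (hC x)
    · simp [Set.indicator_of_notMem hx]
  · by_contra hcon
    exact hx (Set.indicator_of_notMem hcon _)

/-- The decomposition norm of the restriction to `S`, as a real-valued function of a simple
function. -/
noncomputable def simpleDecompNorm (μ : Measure R) (p : ℝ) (s : ℝ≥0∞) (S : Set R)
    (k : SimpleFunc R ℝ) : ℝ :=
  (decompNorm μ p s (S.indicator k)).toReal

variable {p : ℝ} {s : ℝ≥0∞} {S : Set R}

lemma decompNorm_indicator_ne_top (hp : 0 < p) (hs1 : 1 ≤ s) (hs : s ≠ ∞)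
    (hS : MeasurableSet S) (hSfin : μ S ≠ ∞) (k : SimpleFunc R ℝ) :
    decompNorm μ p s (S.indicator k) ≠ ∞ :=
  have h := memLorentz_indicator_simpleFunc hp hs1 hs hS hSfin k
  ne_top_of_le_ne_top h.2.ne (decompNorm_le_lorentzNorm h)

lemma simpleDecompNorm_add_le (hp : 0 < p) (hs1 : 1 ≤ s) (hs : s ≠ ∞)
    (hS : MeasurableSet S) (hSfin : μ S ≠ ∞) (k l : SimpleFunc R ℝ) :
    simpleDecompNorm μ p s S (k + l) ≤ simpleDecompNorm μ p s S k + simpleDecompNorm μ p s S l := by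
  have hk := decompNorm_indicator_ne_top (μ := μ) hp hs1 hs hS hSfin k
  have hl := decompNorm_indicator_ne_top (μ := μ) hp hs1 hs hS hSfin l
  unfold simpleDecompNorm
  rw [← ENNReal.toReal_add hk hl]
  refine ENNReal.toReal_mono (ENNReal.add_ne_top.2 ⟨hk, hl⟩) ?_
  have : S.indicator (k + l : SimpleFunc R ℝ) = fun x => S.indicator k x + S.indicator l x := by
    ext x
    by_cases hx : x ∈ S <;> simp [hx]
  rw [this]
  exact decompNorm_add_le

lemma simpleDecompNorm_smul (hp : 0 < p) (hs1 : 1 ≤ s) (hs : s ≠ ∞)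
    (hS : MeasurableSet S) (hSfin : μ S ≠ ∞) {c : ℝ} (hc : 0 < c) (k : SimpleFunc R ℝ) :
    simpleDecompNorm μ p s S (c • k) = c * simpleDecompNorm μ p s S k := by
  have hle : ∀ {c : ℝ}, 0 < c → ∀ k : SimpleFunc R ℝ,
      simpleDecompNorm μ p s S (c • k) ≤ c * simpleDecompNorm μ p s S k := by
    intro c hc k
    have hk := decompNorm_indicator_ne_top (μ := μ) hp hs1 hs hS hSfin k
    unfold simpleDecompNorm
    have h1 : S.indicator (c • k : SimpleFunc R ℝ) = fun x => c * S.indicator k x := by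
      ext x
      by_cases hx : x ∈ S <;> simp [hx]
    have h2 := decompNorm_const_mul_le (μ := μ) (p := p) (f := S.indicator k) hs1 hc.ne'
    rw [h1]
    refine (ENNReal.toReal_mono (ENNReal.mul_ne_top (by simp) hk) h2).trans ?_
    rw [ENNReal.toReal_mul]
    simp [abs_of_pos hc]
  refine le_antisymm (hle hc k) ?_
  have h3 := hle (inv_pos.2 hc) (c • k)
  rw [inv_smul_smul₀ hc.ne'] at h3
  rwa [← le_inv_mul_iff₀ hc]

/-- Hahn–Banach: a norming functional for the decomposition norm. -/
lemma exists_norming_functional (hp : 0 < p) (hs1 : 1 ≤ s) (hs : s ≠ ∞)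
    (hS : MeasurableSet S) (hSfin : μ S ≠ ∞) (k : SimpleFunc R ℝ) :
    ∃ Λ : SimpleFunc R ℝ →ₗ[ℝ] ℝ, Λ k = simpleDecompNorm μ p s S k ∧
      ∀ l, Λ l ≤ simpleDecompNorm μ p s S l := by
  have hnn : ∀ l, 0 ≤ simpleDecompNorm μ p s S l := fun l => ENNReal.toReal_nonneg
  by_cases hk : k = 0
  · refine ⟨0, ?_, fun l => by simpa using hnn l⟩
    subst hk
    have h0 : S.indicator (0 : SimpleFunc R ℝ) = fun _ => (0 : ℝ) := by
      ext x; simp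
    have : decompNorm μ p s (S.indicator (0 : SimpleFunc R ℝ)) ≤ 0 := by
      rw [h0]
      refine (decompNorm_le_sum (n := 0) (F := fun _ _ => 0) (fun k => k.elim0) (by simp)).trans ?_
      simp
    rw [simpleDecompNorm, nonpos_iff_eq_zero.1 this]
    simp
  obtain ⟨Λ, h1, h2⟩ := exists_extension_of_le_sublinear
    (LinearPMap.mkSpanSingleton k (simpleDecompNorm μ p s S k) hk) (simpleDecompNorm μ p s S)
    (fun c hc l => simpleDecompNorm_smul hp hs1 hs hS hSfin hc l)
    (fun l m => simpleDecompNorm_add_le hp hs1 hs hS hSfin l m) (by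
      rintro ⟨l, hl⟩
      obtain ⟨c, rfl⟩ := Submodule.mem_span_singleton.1 hl
      rw [LinearPMap.mkSpanSingleton'_apply]
      rcases lt_or_ge 0 c with hc | hc
      · rw [simpleDecompNorm_smul hp hs1 hs hS hSfin hc, smul_eq_mul]; exact le_rfl
      · exact (mul_nonpos_of_nonpos_of_nonneg hc (hnn k)).trans (hnn _))
  refine ⟨Λ, ?_, h2⟩
  have h3 := h1 ⟨k, Submodule.mem_span_singleton_self k⟩
  rw [← LinearPMap.mkSpanSingleton_apply ℝ ℝ hk (simpleDecompNorm μ p s S k)]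
  exact h3

end Finite

/-! ### Densities of norming functionals -/

section Density

variable {R : Type*} [MeasurableSpace R] {μ : Measure R} {p : ℝ} {s : ℝ≥0∞} {S : Set R}

/-- The simple function `1_A` (zero if `A` is not measurable). -/
noncomputable def simpleInd (A : Set R) : SimpleFunc R ℝ := (SimpleFunc.const R 1).restrict A

lemma simpleInd_apply {A : Set R} (hA : MeasurableSet A) (x : R) :
    simpleInd A x = A.indicator 1 x := by
  rw [simpleInd, SimpleFunc.restrict_apply _ hA]
  by_cases hx : x ∈ A <;> simp [hx]

lemma simpleInd_union {A B : Set R} (hA : MeasurableSet A) (hB : MeasurableSet B)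
    (h : Disjoint A B) : simpleInd (A ∪ B) = simpleInd A + simpleInd B := by
  ext x
  rw [SimpleFunc.coe_add, Pi.add_apply, simpleInd_apply hA, simpleInd_apply hB,
    simpleInd_apply (hA.union hB), Set.indicator_union_of_disjoint h]

lemma abs_le_of_forall_le (hp : 0 < p) (hs1 : 1 ≤ s) (hs : s ≠ ∞)
    (hS : MeasurableSet S) (hSfin : μ S ≠ ∞) {Λ : SimpleFunc R ℝ →ₗ[ℝ] ℝ}
    (hΛ : ∀ l, Λ l ≤ simpleDecompNorm μ p s S l) (l : SimpleFunc R ℝ) :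
    |Λ l| ≤ (lorentzNorm μ p s (S.indicator l)).toReal := by
  have h1 : ∀ l : SimpleFunc R ℝ, Λ l ≤ (lorentzNorm μ p s (S.indicator l)).toReal := fun l =>
    (hΛ l).trans (ENNReal.toReal_mono (memLorentz_indicator_simpleFunc hp hs1 hs hS hSfin l).2.ne
      (decompNorm_le_lorentzNorm (memLorentz_indicator_simpleFunc hp hs1 hs hS hSfin l)))
  refine abs_le'.2 ⟨h1 l, ?_⟩
  have h2 := h1 (-l)
  rw [map_neg] at h2
  refine h2.trans (le_of_eq (congrArg _ (lorentzNorm_congr_enorm ?_)))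
  refine Filter.Eventually.of_forall fun x => ?_
  by_cases hx : x ∈ S <;> simp [hx]

/-- A functional dominated by the decomposition norm is bounded on indicators by a power of the
measure, hence countably additive. -/
lemma exists_bound_simpleInd (hp : 0 < p) (hs1 : 1 ≤ s) (hs : s ≠ ∞)
    (hS : MeasurableSet S) (hSfin : μ S ≠ ∞) {Λ : SimpleFunc R ℝ →ₗ[ℝ] ℝ}
    (hΛ : ∀ l, Λ l ≤ simpleDecompNorm μ p s S l) :
    ∃ φ : ℝ → ℝ, Filter.Tendsto φ (nhds 0) (nhds 0) ∧ φ 0 = 0 ∧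
      ∀ A, MeasurableSet A → |Λ (simpleInd A)| ≤ φ (μ.real (A ∩ S)) := by
  have hs0 : 0 < s.toReal := ENNReal.toReal_pos (zero_lt_one.trans_le hs1).ne' hs
  refine ⟨fun m => (m ^ (s.toReal / p) / (s.toReal / p)) ^ (1 / s.toReal), ?_, ?_,
    fun A hA => ?_⟩
  · have h1 : Continuous fun m : ℝ => (m ^ (s.toReal / p) / (s.toReal / p)) ^ (1 / s.toReal) :=
      ((Real.continuous_rpow_const (by positivity)).div_const _).rpow_const
        fun _ => Or.inr (by positivity)
    have h2 := h1.tendsto 0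
    rwa [Real.zero_rpow (by positivity), zero_div, Real.zero_rpow (by positivity)] at h2
  · dsimp only
    rw [Real.zero_rpow (by positivity), zero_div, Real.zero_rpow (by positivity)]
  · refine (abs_le_of_forall_le hp hs1 hs hS hSfin hΛ _).trans ?_
    have hfin : μ (A ∩ S) ≠ ∞ := ne_top_of_le_ne_top hSfin (measure_mono Set.inter_subset_right)
    have h1 := lorentzNorm_le_of_bounded (μ := μ) hp hs1 hs (f := S.indicator (simpleInd A))
      (C := 1) (fun x => ?_) (M := μ.real (A ∩ S)) measureReal_nonneg ?_
    · rw [one_mul] at h1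
      refine ENNReal.toReal_le_of_le_ofReal (Real.rpow_nonneg (by positivity) _) (h1.trans ?_)
      rw [ENNReal.ofReal_rpow_of_nonneg (by positivity) (by positivity)]
    · by_cases hx : x ∈ S
      · rw [Set.indicator_of_mem hx, simpleInd_apply hA]
        by_cases hx' : x ∈ A <;> simp [hx']
      · simp [Set.indicator_of_notMem hx]
    · rw [measureReal_def, ENNReal.ofReal_toReal hfin]
      refine measure_mono fun x hx => ?_
      by_contra hcon
      refine hx ?_
      by_cases hxS : x ∈ S
      · rw [Set.indicator_of_mem hxS, simpleInd_apply hA]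
        exact Set.indicator_of_notMem (fun h => hcon ⟨h, hxS⟩) _
      · exact Set.indicator_of_notMem hxS _

/-- Radon–Nikodym: a functional dominated by the decomposition norm is given by a density. -/
lemma exists_density (hp : 0 < p) (hs1 : 1 ≤ s) (hs : s ≠ ∞)
    (hS : MeasurableSet S) (hSfin : μ S ≠ ∞) {Λ : SimpleFunc R ℝ →ₗ[ℝ] ℝ}
    (hΛ : ∀ l, Λ l ≤ simpleDecompNorm μ p s S l) :
    ∃ g : R → ℝ, Measurable g ∧ IntegrableOn g S μ ∧
      ∀ l : SimpleFunc R ℝ, Λ l = ∫ x in S, l x * g x ∂μ := by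
  classical
  obtain ⟨φ, hφ, hφ0, hbd⟩ := exists_bound_simpleInd hp hs1 hs hS hSfin hΛ
  have hfinS : IsFiniteMeasure (μ.restrict S) := ⟨by simpa using hSfin.lt_top⟩
  have hreal : ∀ A, MeasurableSet A → μ.real (A ∩ S) = (μ.restrict S).real A := fun A hA => by
    rw [measureReal_def, measureReal_def, Measure.restrict_apply hA]
  have hfinset : ∀ (B : ℕ → Set R), (∀ i, MeasurableSet (B i)) →
      Pairwise (Function.onFun Disjoint B) → ∀ T : Finset ℕ,
      simpleInd (⋃ i ∈ T, B i) = ∑ i ∈ T, simpleInd (B i) := by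
    intro B hB hd T
    induction T using Finset.induction_on with
    | empty =>
      ext x
      simp [simpleInd_apply MeasurableSet.empty]
    | insert a T ha ih =>
      rw [Finset.sum_insert ha, ← ih, Finset.set_biUnion_insert, simpleInd_union (hB a)
        (Finset.measurableSet_biUnion _ fun i _ => hB i)]
      rw [Set.disjoint_iUnion₂_right]
      exact fun i hi => hd fun h => ha (h ▸ hi)
  let ν : SignedMeasure R :=
    { measureOf' := fun A => if MeasurableSet A then Λ (simpleInd A) else 0
      empty' := by
        have h0 : simpleInd (∅ : Set R) = 0 := by
          ext x; simp [simpleInd_apply MeasurableSet.empty]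
        simp [h0]
      not_measurable' := fun A hA => if_neg hA
      m_iUnion' := by
        intro B hB hd
        have hU : MeasurableSet (⋃ i, B i) := MeasurableSet.iUnion hB
        simp only [if_pos hU, if_pos (hB _)]
        -- the tails `⋃_{i ∉ T} B i` have measure tending to zero
        have htail : ∀ T : Finset ℕ, Λ (simpleInd (⋃ i, B i)) - ∑ i ∈ T, Λ (simpleInd (B i)) =
            Λ (simpleInd ((⋃ i, B i) \ ⋃ i ∈ T, B i)) := by
          intro T
          have hT : MeasurableSet (⋃ i ∈ T, B i) := Finset.measurableSet_biUnion _ fun i _ => hB i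
          rw [← map_sum, ← hfinset B hB hd T, sub_eq_iff_eq_add, ← map_add,
            ← simpleInd_union (hU.diff hT) hT Set.disjoint_sdiff_left, Set.sdiff_union_of_subset]
          exact Set.iUnion₂_subset fun i _ => Set.subset_iUnion B i
        have hm : Filter.Tendsto (fun T : Finset ℕ =>
            (μ.restrict S).real ((⋃ i, B i) \ ⋃ i ∈ T, B i)) Filter.atTop (nhds 0) := by
          have h1 : HasSum (fun i => (μ.restrict S).real (B i))
              ((μ.restrict S).real (⋃ i, B i)) := by
            have h2 := measure_iUnion (μ := μ.restrict S) hd hB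
            simp only [measureReal_def]
            rw [h2, ENNReal.tsum_toReal_eq fun i => measure_ne_top _ _]
            refine ENNReal.hasSum_toReal ?_
            rw [← h2]
            exact measure_ne_top _ _
          have h3 := h1.const_sub ((μ.restrict S).real (⋃ i, B i))
          rw [sub_self] at h3
          refine h3.congr fun T => ?_
          have hT : MeasurableSet (⋃ i ∈ T, B i) := Finset.measurableSet_biUnion _ fun i _ => hB i
          rw [measureReal_sdiff (Set.iUnion₂_subset fun i _ => Set.subset_iUnion B i) hT,
            measureReal_biUnion_finset (fun i _ j _ hij => hd hij) fun i _ => hB i]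
        have hz : Filter.Tendsto (fun T : Finset ℕ =>
            Λ (simpleInd (⋃ i, B i)) - ∑ i ∈ T, Λ (simpleInd (B i))) Filter.atTop (nhds 0) := by
          refine squeeze_zero_norm (fun T => ?_) (hφ.comp hm)
          have hT : MeasurableSet (⋃ i ∈ T, B i) := Finset.measurableSet_biUnion _ fun i _ => hB i
          rw [htail, Real.norm_eq_abs, Function.comp, ← hreal _ (hU.diff hT)]
          exact hbd _ (hU.diff hT)
        have h4 := hz.const_sub (Λ (simpleInd (⋃ i, B i)))
        simpa [HasSum] using h4 }
  have hνapp : ∀ A, MeasurableSet A → ν A = Λ (simpleInd A) := fun A hA => if_pos hA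
  have hac : ν ≪ᵥ (μ.restrict S).toENNRealVectorMeasure := by
    refine VectorMeasure.AbsolutelyContinuous.mk fun A hA h0 => ?_
    rw [Measure.toENNRealVectorMeasure_apply_measurable hA] at h0
    have h1 := hbd A hA
    rw [hreal A hA, measureReal_def, h0, ENNReal.toReal_zero, hφ0] at h1
    rw [hνapp A hA]
    exact abs_nonpos_iff.1 h1
  have hRN := SignedMeasure.withDensityᵥ_rnDeriv_eq ν (μ.restrict S) hac
  set g := ν.rnDeriv (μ.restrict S)
  have hgi : Integrable g (μ.restrict S) := SignedMeasure.integrable_rnDeriv _ _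
  refine ⟨g, SignedMeasure.measurable_rnDeriv _ _, hgi, fun l => ?_⟩
  have hmulint : ∀ l : SimpleFunc R ℝ, Integrable (fun x => l x * g x) (μ.restrict S) := by
    intro l
    obtain ⟨C, hC⟩ := l.exists_forall_norm_le
    exact hgi.bdd_mul l.measurable.aestronglyMeasurable (Filter.Eventually.of_forall hC)
  induction l using SimpleFunc.induction with
  | @const c A hA =>
    have h1 : SimpleFunc.piecewise A hA (SimpleFunc.const R c) (SimpleFunc.const R 0) =
        c • simpleInd A := by
      ext x
      rw [SimpleFunc.coe_smul, Pi.smul_apply, simpleInd_apply hA]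
      by_cases hx : x ∈ A <;> simp [hx]
    rw [h1, map_smul, ← hνapp A hA, ← hRN, withDensityᵥ_apply hgi hA, smul_eq_mul,
      ← integral_indicator hA, ← integral_const_mul]
    refine integral_congr_ae (Filter.Eventually.of_forall fun x => ?_)
    simp only [SimpleFunc.coe_smul, Pi.smul_apply, simpleInd_apply hA]
    by_cases hx : x ∈ A <;> simp [hx]
  | @add l m _ hl hm =>
    rw [map_add, hl, hm, ← integral_add (hmulint l) (hmulint m)]
    refine integral_congr_ae (Filter.Eventually.of_forall fun x => ?_)
    simp only [SimpleFunc.coe_add, Pi.add_apply]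
    ring

/-- The density of a functional dominated by the decomposition norm lies in the unit ball of the
dual. -/
lemma lintegral_mul_density_le (hp : 0 < p) (hs1 : 1 ≤ s) (hs : s ≠ ∞)
    (hS : MeasurableSet S) (hSfin : μ S ≠ ∞) {Λ : SimpleFunc R ℝ →ₗ[ℝ] ℝ}
    (hΛ : ∀ l, Λ l ≤ simpleDecompNorm μ p s S l) {g : R → ℝ} (hg : Measurable g)
    (hgi : IntegrableOn g S μ) (hgΛ : ∀ l : SimpleFunc R ℝ, Λ l = ∫ x in S, l x * g x ∂μ)
    {h : R → ℝ} (hh : AEMeasurable h μ) :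
    ∫⁻ x, ‖S.indicator g x‖ₑ * ‖h x‖ₑ ∂μ ≤ lorentzNorm μ p s h := by
  -- for simple functions, change signs so that the pairing becomes nonnegative
  have hsimple : ∀ k : SimpleFunc R ℝ,
      ∫⁻ x in S, ‖g x‖ₑ * ‖k x‖ₑ ∂μ ≤ lorentzNorm μ p s k := by
    intro k
    have hA : MeasurableSet {x | 0 ≤ k x * g x} :=
      measurableSet_le measurable_const (k.measurable.mul hg)
    set k' := SimpleFunc.piecewise {x | 0 ≤ k x * g x} hA k (-k) with hk'
    have hk'app : ∀ x, k' x = if 0 ≤ k x * g x then k x else -k x := by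
      intro x
      rw [hk', SimpleFunc.coe_piecewise, Set.piecewise]
      rfl
    have hprod : ∀ x, k' x * g x = |k x * g x| := by
      intro x
      rw [hk'app]
      split_ifs with h1
      · rw [abs_of_nonneg h1]
      · rw [abs_of_neg (not_le.1 h1)]; ring
    have hint : Integrable (fun x => k' x * g x) (μ.restrict S) := by
      obtain ⟨C, hC⟩ := k'.exists_forall_norm_le
      exact hgi.bdd_mul k'.measurable.aestronglyMeasurable (Filter.Eventually.of_forall hC)
    have hmem := memLorentz_indicator_simpleFunc (μ := μ) hp hs1 hs hS hSfin k'
    calc ∫⁻ x in S, ‖g x‖ₑ * ‖k x‖ₑ ∂μ = ∫⁻ x in S, ENNReal.ofReal (k' x * g x) ∂μ := by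
          refine lintegral_congr fun x => ?_
          rw [hprod, ← Real.enorm_eq_ofReal_abs, enorm_mul, mul_comm]
      _ = ENNReal.ofReal (Λ k') := by
          rw [hgΛ, ofReal_integral_eq_lintegral_ofReal hint
            (Filter.Eventually.of_forall fun x => (abs_nonneg _).trans_eq (hprod x).symm)]
      _ ≤ ENNReal.ofReal (lorentzNorm μ p s (S.indicator k')).toReal :=
          ENNReal.ofReal_le_ofReal
            ((le_abs_self _).trans (abs_le_of_forall_le hp hs1 hs hS hSfin hΛ k'))
      _ = lorentzNorm μ p s (S.indicator k') := ENNReal.ofReal_toReal hmem.2.ne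
      _ ≤ lorentzNorm μ p s k := by
          refine lorentzNorm_mono (Filter.Eventually.of_forall fun x => ?_)
          by_cases hx : x ∈ S
          · rw [Set.indicator_of_mem hx, hk'app]
            split_ifs <;> simp
          · simp [Set.indicator_of_notMem hx]
  set h₀ := hh.mk h
  have hh₀ : Measurable h₀ := hh.measurable_mk
  let k : ℕ → SimpleFunc R ℝ := fun n =>
    (SimpleFunc.eapprox (fun x => ‖h₀ x‖ₑ) n).map ENNReal.toReal
  have hk : ∀ n x, ‖k n x‖ₑ = SimpleFunc.eapprox (fun x => ‖h₀ x‖ₑ) n x := fun n x => by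
    simp only [k, SimpleFunc.map_apply]
    rw [Real.enorm_of_nonneg ENNReal.toReal_nonneg,
      ENNReal.ofReal_toReal (SimpleFunc.eapprox_lt_top _ _ _).ne]
  have hsup : ∀ x, ‖h₀ x‖ₑ = ⨆ n, ‖k n x‖ₑ := fun x => by
    simp_rw [hk]
    exact (SimpleFunc.iSup_eapprox_apply hh₀.enorm x).symm
  have hle : ∀ n x, ‖k n x‖ₑ ≤ ‖h₀ x‖ₑ := fun n x => by
    rw [hsup x]
    exact le_iSup (fun n => ‖k n x‖ₑ) n
  calc ∫⁻ x, ‖S.indicator g x‖ₑ * ‖h x‖ₑ ∂μ = ∫⁻ x in S, ‖g x‖ₑ * ‖h₀ x‖ₑ ∂μ := by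
        rw [← lintegral_indicator hS]
        refine lintegral_congr_ae ?_
        filter_upwards [hh.ae_eq_mk] with x hx
        by_cases hxS : x ∈ S
        · simp only [Set.indicator_of_mem hxS]; rw [hx]
        · simp [Set.indicator_of_notMem hxS]
    _ = ⨆ n, ∫⁻ x in S, ‖g x‖ₑ * ‖k n x‖ₑ ∂μ := by
        simp_rw [hsup, ENNReal.mul_iSup]
        refine lintegral_iSup (fun n => hg.enorm.mul (k n).measurable.enorm) fun m n hmn x => ?_
        dsimp only
        gcongr 1
        rw [hk, hk]
        exact SimpleFunc.monotone_eapprox _ hmn x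
    _ ≤ lorentzNorm μ p s h := by
        refine iSup_le fun n => (hsimple (k n)).trans (lorentzNorm_mono ?_)
        filter_upwards [hh.ae_eq_mk] with x hx
        rw [hx]
        exact hle n x

/-- For `p ≤ s < ∞` a norming functional of the decomposition norm is represented by a function in
the unit ball of `L^{p',s'}`. -/
lemma decompNorm_le_dualNorm_of_ge [SigmaFinite μ] (hμ : IsNonatomic μ)
    (hp : 1 < p) (hps : ENNReal.ofReal p ≤ s) (hs : s ≠ ∞) {f : R → ℝ}
    (hf : MemLorentz μ p s f) : decompNorm μ p s f ≤ dualNorm μ p s f := by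
  have hp0 : 0 < p := by linarith
  have hs1 : 1 ≤ s := le_trans (by simpa using hp.le) hps
  have hpq := Real.HolderConjugate.conjExponent hp
  have hsr := ENNReal.HolderConjugate.conjExponent hs1
  have hr1 : 1 ≤ s.conjExponent := hsr.symm.one_le
  have hrq : s.conjExponent ≤ ENNReal.ofReal p.conjExponent := by
    have h1 := hsr.inv_add_inv_eq_one
    have h2 : (ENNReal.ofReal p)⁻¹ + (ENNReal.ofReal p.conjExponent)⁻¹ = 1 := by
      rw [← ENNReal.ofReal_inv_of_pos hpq.pos, ← ENNReal.ofReal_inv_of_pos hpq.symm.pos,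
        ← ENNReal.ofReal_add (inv_nonneg.2 hpq.nonneg) (inv_nonneg.2 hpq.symm.nonneg),
        hpq.inv_add_inv_eq_one, ENNReal.ofReal_one]
    rw [← ENNReal.inv_le_inv]
    have h3 : s⁻¹ ≤ (ENNReal.ofReal p)⁻¹ := ENNReal.inv_le_inv.2 hps
    refine (ENNReal.add_le_add_iff_left (a := s⁻¹) ?_).1 ?_
    · exact ENNReal.inv_ne_top.2 (zero_lt_one.trans_le hs1).ne'
    · rw [h1, ← h2]
      gcongr
  refine ENNReal.le_of_forall_pos_le_add fun ε hε _ => ?_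
  have hε2 : (0 : ℝ≥0∞) < ε / 2 := by simpa using hε.ne'
  obtain ⟨k, hkfin, hfk, hfkε⟩ := exists_simpleFunc_approx hp0 hs1 hs hf hε2
  set S := {x | k x ≠ 0} with hSdef
  have hS : MeasurableSet S := k.measurableSet_fiber 0 |>.compl
  have hkS : S.indicator k = k := by
    ext x
    by_cases hx : x ∈ S
    · rw [Set.indicator_of_mem hx]
    · rw [Set.indicator_of_notMem hx]
      exact (not_not.1 hx).symm
  obtain ⟨Λ, hΛk, hΛ⟩ := exists_norming_functional hp0 hs1 hs hS hkfin k
  obtain ⟨g, hg, hgi, hgΛ⟩ := exists_density hp0 hs1 hs hS hkfin hΛ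
  have hGm : Measurable (S.indicator g) := hg.indicator hS
  have hG : lorentzNorm μ p.conjExponent s.conjExponent (S.indicator g) ≤ 1 := by
    refine lorentzNorm_le_of_forall_lintegral_mul_le hμ hpq.symm.lt hr1 hrq hGm.aemeasurable
      fun h hh => ?_
    rw [one_mul, hpq.symm.conjExponent_eq, hsr.symm.conjExponent_eq]
    exact lintegral_mul_density_le hp0 hs1 hs hS hkfin hΛ hg hgi hgΛ hh.1
  have hGmem : MemLorentz μ p.conjExponent s.conjExponent (S.indicator g) :=
    ⟨hGm.aemeasurable, hG.trans_lt ENNReal.one_lt_top⟩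
  have hkN : decompNorm μ p s k ≤ ∫⁻ x, ‖k x‖ₑ * ‖S.indicator g x‖ₑ ∂μ := by
    have h1 : decompNorm μ p s k ≠ ∞ := by
      have := decompNorm_indicator_ne_top (μ := μ) hp0 hs1 hs hS hkfin k
      rwa [hkS] at this
    rw [← ENNReal.ofReal_toReal h1]
    have h2 : (decompNorm μ p s k).toReal = Λ k := by
      rw [hΛk, simpleDecompNorm, hkS]
    rw [h2, hgΛ]
    calc ENNReal.ofReal (∫ x in S, k x * g x ∂μ) ≤ ∫⁻ x in S, ‖k x * g x‖ₑ ∂μ := by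
          refine le_trans ?_ (enorm_integral_le_lintegral_enorm _)
          rw [Real.enorm_eq_ofReal_abs]
          exact ENNReal.ofReal_le_ofReal (le_abs_self _)
      _ = ∫⁻ x, ‖k x‖ₑ * ‖S.indicator g x‖ₑ ∂μ := by
          rw [← lintegral_indicator hS]
          refine lintegral_congr fun x => ?_
          by_cases hx : x ∈ S
          · simp [Set.indicator_of_mem hx]
          · simp [Set.indicator_of_notMem hx]
  calc decompNorm μ p s f ≤ decompNorm μ p s k + decompNorm μ p s (fun x => f x - k x) := by
        refine le_trans (le_of_eq ?_) decompNorm_add_le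
        congr 1
        ext x
        ring
    _ ≤ (∫⁻ x, ‖k x‖ₑ * ‖S.indicator g x‖ₑ ∂μ) + ε / 2 :=
        add_le_add hkN ((decompNorm_le_lorentzNorm hfk).trans hfkε)
    _ ≤ (dualNorm μ p s f + ε / 2) + ε / 2 := by
        gcongr
        calc ∫⁻ x, ‖k x‖ₑ * ‖S.indicator g x‖ₑ ∂μ
            ≤ ∫⁻ x, (‖f x‖ₑ * ‖S.indicator g x‖ₑ + ‖f x - k x‖ₑ * ‖S.indicator g x‖ₑ) ∂μ := by
              refine lintegral_mono fun x => ?_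
              rw [← add_mul]
              gcongr
              have h3 := enorm_sub_le (a := f x) (b := f x - k x)
              rwa [sub_sub_cancel] at h3
          _ = (∫⁻ x, ‖f x‖ₑ * ‖S.indicator g x‖ₑ ∂μ) +
                ∫⁻ x, ‖f x - k x‖ₑ * ‖S.indicator g x‖ₑ ∂μ :=
              lintegral_add_left' (hf.1.enorm.mul hGm.aemeasurable.enorm) _
          _ ≤ dualNorm μ p s f * 1 + ε / 2 * 1 := by
              refine add_le_add ((lintegral_mul_le_dualNorm hp hs1 hf hGmem).trans ?_)
                ((lintegral_mul_le_lorentzNorm hpq hsr hfk.1 hGm.aemeasurable).trans ?_)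
              · gcongr
              · gcongr
          _ = dualNorm μ p s f + ε / 2 := by rw [mul_one, mul_one]
    _ = dualNorm μ p s f + ε := by rw [add_assoc, ENNReal.add_halves]

end Density

/-! ### Finite majorization -/

section Majorization

/-- Abel summation: against non-increasing nonnegative weights, domination of the partial sums
implies domination of the weighted sums. -/
lemma sum_mul_le_sum_mul_of_partial_sums {n : ℕ} {ζ α β : ℕ → ℝ} (hζ0 : ∀ k, 0 ≤ ζ k)
    (hζ : ∀ k, k + 1 < n → ζ (k + 1) ≤ ζ k)
    (h : ∀ k ≤ n, ∑ i ∈ Finset.range k, α i ≤ ∑ i ∈ Finset.range k, β i) :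
    ∑ i ∈ Finset.range n, ζ i * α i ≤ ∑ i ∈ Finset.range n, ζ i * β i := by
  have key : ∀ k, k + 1 ≤ n → ζ k * (∑ i ∈ Finset.range (k + 1), (β i - α i)) ≤
      ∑ i ∈ Finset.range (k + 1), ζ i * (β i - α i) := by
    intro k
    induction k with
    | zero => intro _; simp
    | succ k ih =>
      intro hk
      rw [Finset.sum_range_succ, Finset.sum_range_succ _ (k + 1), mul_add]
      refine add_le_add_left (le_trans ?_ (ih (by omega))) _
      refine mul_le_mul_of_nonneg_right (hζ k (by omega)) ?_
      rw [Finset.sum_sub_distrib, sub_nonneg]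
      exact h _ (by omega)
  rcases n with _ | n
  · simp
  rw [← sub_nonneg, ← Finset.sum_sub_distrib]
  simp_rw [← mul_sub]
  refine le_trans (mul_nonneg (hζ0 n) ?_) (key n le_rfl)
  rw [Finset.sum_sub_distrib, sub_nonneg]
  exact h _ le_rfl

variable {ι : Type*} [Fintype ι]

/-- The total mass of the cells that precede `i` in the order `τ`. -/
def massBefore (m : ι → ℝ) (τ : ι ≃ Fin (Fintype.card ι)) (i : ι) : ℝ :=
  ∑ j with τ j < τ i, m j

/-- The greedy algorithm for the polymatroid `{x : ∑_{i ∈ S} mᵢ xᵢ ≤ G (∑_{i ∈ S} mᵢ)}`: a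
nonnegative linear functional is maximised by serving the cells in the order of its densities. -/
lemma exists_greedy_order {m x : ι → ℝ} (hm : ∀ i, 0 ≤ m i)
    (hmx : ∀ i, m i = 0 → x i = 0) {G φ : ℝ → ℝ} (hφ : ∀ a, 0 ≤ a → 0 ≤ φ a) (hG0 : G 0 = 0)
    (hG : ∀ a b, 0 ≤ a → a ≤ b → G b - G a ≤ (b - a) * φ a)
    (hS : ∀ S : Finset ι, ∑ i ∈ S, m i * x i ≤ G (∑ i ∈ S, m i)) {z : ι → ℝ}
    (hz : ∀ i, 0 ≤ z i) :
    ∃ τ : ι ≃ Fin (Fintype.card ι), ∑ i, z i * x i ≤ ∑ i, z i * φ (massBefore m τ i) := by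
  classical
  set n := Fintype.card ι
  set ζ : ι → ℝ := fun i => z i / m i with hζ
  have hζ0 : ∀ i, 0 ≤ ζ i := fun i => div_nonneg (hz i) (hm i)
  set e : ι ≃ Fin n := Fintype.equivFin ι
  set σ : Equiv.Perm (Fin n) := Tuple.sort fun k => -ζ (e.symm k)
  have hσ : Monotone ((fun k => -ζ (e.symm k)) ∘ σ) := Tuple.monotone_sort _
  set τ : ι ≃ Fin n := e.trans σ.symm with hτ
  have hanti : ∀ k l : Fin n, k ≤ l → ζ (τ.symm l) ≤ ζ (τ.symm k) := fun k l hkl => by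
    have h1 := hσ hkl
    simp only [Function.comp, neg_le_neg_iff] at h1
    simpa [hτ] using h1
  refine ⟨τ, ?_⟩
  -- transport everything to sequences indexed by the position in the order
  let ext : (ι → ℝ) → ℕ → ℝ := fun v k => if h : k < n then v (τ.symm ⟨k, h⟩) else 0
  have hext : ∀ v (k : ℕ) (h : k < n), ext v k = v (τ.symm ⟨k, h⟩) := fun v k h => dif_pos h
  have hext0 : ∀ v : ι → ℝ, (∀ i, 0 ≤ v i) → ∀ k, 0 ≤ ext v k := fun v hv k => by
    simp only [ext]; split_ifs
    · exact hv _
    · exact le_rfl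
  clear_value ext
  have hsum : ∀ v : ι → ℝ, ∑ i, v i = ∑ k ∈ Finset.range n, ext v k := by
    intro v
    rw [← Equiv.sum_comp τ.symm, Finset.sum_range]
    exact Finset.sum_congr rfl fun k _ => by rw [hext v k k.2]
  have hpart : ∀ (v : ι → ℝ) (k : ℕ), k ≤ n →
      ∑ i with (τ i : ℕ) < k, v i = ∑ l ∈ Finset.range k, ext v l := by
    intro v k hk
    rw [Finset.sum_filter, hsum, ← Finset.sum_subset (Finset.range_mono hk)]
    · refine Finset.sum_congr rfl fun l hl => ?_
      have hl' := Finset.mem_range.1 hl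
      rw [hext _ l (by omega), hext _ l (by omega)]
      simp [hl']
    · intro l hl hl'
      rw [Finset.mem_range] at hl hl'
      rw [hext _ l hl]
      simp [hl']
  set M : ℕ → ℝ := fun k => ∑ l ∈ Finset.range k, ext m l with hM
  have hextm : ∀ k, 0 ≤ ext m k := hext0 m hm
  have hM0 : ∀ k, 0 ≤ M k := fun k => Finset.sum_nonneg fun l _ => hextm l
  have hMs : ∀ k, M (k + 1) = M k + ext m k := fun k => Finset.sum_range_succ _ _
  have hbefore : ∀ k (h : k < n), massBefore m τ (τ.symm ⟨k, h⟩) = M k := by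
    intro k h
    rw [massBefore, hM]
    dsimp only
    rw [← hpart m k h.le]
    refine Finset.sum_congr ?_ fun _ _ => rfl
    ext j
    simp [Fin.lt_def]
  calc ∑ i, z i * x i = ∑ k ∈ Finset.range n, ext ζ k * ext (fun i => m i * x i) k := by
        rw [hsum]
        refine Finset.sum_congr rfl fun k hk => ?_
        have hk' := Finset.mem_range.1 hk
        rw [hext _ k hk', hext _ k hk', hext _ k hk']
        simp only [hζ]
        by_cases h0 : m (τ.symm ⟨k, hk'⟩) = 0
        · rw [hmx _ h0]; simp
        · field_simp
    _ ≤ ∑ k ∈ Finset.range n, ext ζ k * (G (M (k + 1)) - G (M k)) := by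
        refine sum_mul_le_sum_mul_of_partial_sums (fun k => ?_) (fun k hk => ?_) fun k hk => ?_
        · exact hext0 ζ hζ0 k
        · rw [hext _ _ hk, hext _ k (by omega)]
          exact hanti _ _ (by simp [Fin.le_def])
        · rw [Finset.sum_range_sub (fun k => G (M k)), ← hpart _ k hk]
          have : M 0 = 0 := by simp [hM]
          rw [this, hG0, sub_zero, hM]
          dsimp only
          rw [← hpart m k hk]
          exact hS _
    _ ≤ ∑ k ∈ Finset.range n, ext (fun i => z i * φ (massBefore m τ i)) k := by
        refine Finset.sum_le_sum fun k hk => ?_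
        have hk' := Finset.mem_range.1 hk
        rw [hext _ k hk', hext _ k hk', hbefore k hk']
        have h1 := hG (M k) (M (k + 1)) (hM0 k) (by rw [hMs]; linarith [hextm k])
        rw [hMs k, add_sub_cancel_left, hext m k hk', ← hext m k hk', ← hMs] at h1
        refine (mul_le_mul_of_nonneg_left h1 (hζ0 _)).trans ?_
        rw [← mul_assoc]
        refine mul_le_mul_of_nonneg_right ?_ (hφ _ (hM0 k))
        rw [hext m k hk']
        by_cases h0 : m (τ.symm ⟨k, hk'⟩) = 0
        · rw [h0, mul_zero]; exact hz _
        · simp only [hζ]; rw [div_mul_cancel₀ _ h0]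
    _ = ∑ i, z i * φ (massBefore m τ i) := (hsum _).symm

open scoped Pointwise in
/-- A finite form of Hahn–Banach: if every nonnegative functional at `x` is at most its maximum
over the points `y j`, then `x` lies below a convex combination of these points. -/
lemma exists_le_convex_combination {κ : Type*} [Fintype κ] {x : ι → ℝ} {y : κ → ι → ℝ}
    (h : ∀ z : ι → ℝ, (∀ i, 0 ≤ z i) → ∃ j, ∑ i, z i * x i ≤ ∑ i, z i * y j i) :
    ∃ w : κ → ℝ, (∀ j, 0 ≤ w j) ∧ ∑ j, w j = 1 ∧ ∀ i, x i ≤ ∑ j, w j * y j i := by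
  classical
  set Φ : (κ → ℝ) → (ι → ℝ) := fun w i => ∑ j, w j * y j i with hΦ
  have hΦc : Continuous Φ := by fun_prop
  set A : Set (ι → ℝ) := Φ '' stdSimplex ℝ κ with hA
  have hAc : IsCompact A := (isCompact_stdSimplex ℝ κ).image hΦc
  have hAconv : Convex ℝ A := by
    rintro _ ⟨w, hw, rfl⟩ _ ⟨w', hw', rfl⟩ a b ha hb hab
    refine ⟨a • w + b • w', convex_stdSimplex ℝ κ hw hw' ha hb hab, ?_⟩
    ext i
    simp only [hΦ, Pi.add_apply, Pi.smul_apply, smul_eq_mul, Finset.mul_sum,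
      ← Finset.sum_add_distrib]
    exact Finset.sum_congr rfl fun j _ => by ring
  set D : Set (ι → ℝ) := A + Set.Iic 0 with hD
  have hDclosed : IsClosed D := isClosed_Iic.add_left_of_isCompact hAc
  have hDconv : Convex ℝ D := hAconv.add (convex_Iic 0)
  by_cases hx : x ∈ D
  · obtain ⟨_, ⟨w, hw, rfl⟩, v, hv, rfl⟩ := Set.mem_add.1 hx
    refine ⟨w, hw.1, hw.2, fun i => ?_⟩
    have := hv i
    simp only [Pi.zero_apply] at this
    simp only [Pi.add_apply, hΦ]
    linarith
  exfalso
  obtain ⟨Λ, u, hΛ1, hΛ2⟩ := geometric_hahn_banach_closed_point hDconv hDclosed hx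
  set z : ι → ℝ := fun i => Λ (Pi.single i 1) with hz
  have hΛz : ∀ v : ι → ℝ, Λ v = ∑ i, z i * v i := by
    intro v
    conv_lhs => rw [pi_eq_sum_univ' v]
    rw [map_sum]
    refine Finset.sum_congr rfl fun i _ => ?_
    rw [map_smul, smul_eq_mul, mul_comm]
  have hyA : ∀ j, y j ∈ A := fun j => by
    refine ⟨Pi.single j 1, single_mem_stdSimplex ℝ j, ?_⟩
    ext i
    simp [hΦ, Pi.single_apply]
  -- `κ` is nonempty
  obtain ⟨j₀, -⟩ := h 0 fun _ => le_rfl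
  have hz0 : ∀ i, 0 ≤ z i := by
    intro i
    by_contra hneg
    rw [not_le] at hneg
    -- moving far in the direction `-eᵢ` stays in `D` and makes `Λ` large
    set t : ℝ := max 0 ((u - Λ (y j₀)) / (-z i)) with ht
    have hmem : y j₀ + (-t) • Pi.single i (1 : ℝ) ∈ D := by
      refine Set.add_mem_add (hyA j₀) fun k => ?_
      simp only [Pi.smul_apply, smul_eq_mul, Pi.zero_apply, Pi.single_apply]
      have := le_max_left 0 ((u - Λ (y j₀)) / (-z i))
      split_ifs <;> nlinarith
    have h1 := hΛ1 _ hmem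
    rw [map_add, map_smul, smul_eq_mul] at h1
    have h2 := le_max_right 0 ((u - Λ (y j₀)) / (-z i))
    rw [← ht, div_le_iff₀ (by linarith)] at h2
    have h3 : Λ (Pi.single i 1) = z i := rfl
    rw [h3] at h1
    linarith
  obtain ⟨j, hj⟩ := h z hz0
  rw [← hΛz, ← hΛz] at hj
  have h4 := hΛ1 (y j) (by
    simpa using Set.add_mem_add (hyA j) (Set.mem_Iic.2 (le_refl (0 : ι → ℝ))))
  linarith

/-- Rounding up the weights of a convex combination to multiples of `1 / N`. -/
lemma exists_rounding {κ : Type*} [Fintype κ] [Nonempty κ] {w : κ → ℝ} (hw0 : ∀ j, 0 ≤ w j)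
    (hw1 : ∑ j, w j = 1) {N P : ℕ} (hN : 0 < N) (hP : Fintype.card κ = P) :
    ∃ ρ : Fin (N + P) → κ, ∀ y : κ → ℝ, (∀ j, 0 ≤ y j) →
      ∑ j, w j * y j ≤ (N : ℝ)⁻¹ * ∑ a, y (ρ a) := by
  classical
  subst hP
  set c : κ → ℕ := fun j => ⌈(N : ℝ) * w j⌉₊ with hc
  have hcard : Fintype.card (Σ j, Fin (c j)) ≤ Fintype.card (Fin (N + Fintype.card κ)) := by
    rw [Fintype.card_sigma, Fintype.card_fin]
    simp only [Fintype.card_fin]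
    have h1 : ((∑ j, c j : ℕ) : ℝ) ≤ (N + Fintype.card κ : ℕ) := by
      push_cast
      calc ∑ j, (c j : ℝ) ≤ ∑ j, ((N : ℝ) * w j + 1) :=
            Finset.sum_le_sum fun j _ => (Nat.ceil_lt_add_one (mul_nonneg N.cast_nonneg (hw0 j))).le
        _ = N + Fintype.card κ := by
            rw [Finset.sum_add_distrib, ← Finset.mul_sum, hw1]; simp
    exact_mod_cast h1
  obtain ⟨emb⟩ := Function.Embedding.nonempty_of_card_le hcard
  let ρ : Fin (N + Fintype.card κ) → κ :=
    Function.extend emb (fun q => q.1) fun _ => Classical.arbitrary κ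
  refine ⟨ρ, fun y hy => ?_⟩
  rw [le_inv_mul_iff₀ (by exact_mod_cast hN), Finset.mul_sum]
  calc ∑ j, (N : ℝ) * (w j * y j) ≤ ∑ j, (c j : ℝ) * y j := by
        refine Finset.sum_le_sum fun j _ => ?_
        rw [← mul_assoc]
        exact mul_le_mul_of_nonneg_right (Nat.le_ceil _) (hy j)
    _ = ∑ q : Σ j, Fin (c j), y q.1 := by
        rw [Fintype.sum_sigma]
        simp
    _ = ∑ q : Σ j, Fin (c j), y (ρ (emb q)) := by
        refine Finset.sum_congr rfl fun q _ => ?_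
        simp only [ρ, emb.injective.extend_apply]
    _ = ∑ a ∈ Finset.univ.map emb, y (ρ a) := by rw [Finset.sum_map]
    _ ≤ ∑ a, y (ρ a) :=
        Finset.sum_le_sum_of_subset_of_nonneg (Finset.subset_univ _) fun a _ _ => hy _

/-- Combination of the greedy algorithm, Hahn–Banach and rounding; the number of summands depends
only on `N` and the number of cells. -/
lemma exists_greedy_average {m x : ι → ℝ} (hm : ∀ i, 0 ≤ m i)
    (hmx : ∀ i, m i = 0 → x i = 0) {G φ : ℝ → ℝ} (hφ : ∀ a, 0 ≤ a → 0 ≤ φ a) (hG0 : G 0 = 0)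
    (hG : ∀ a b, 0 ≤ a → a ≤ b → G b - G a ≤ (b - a) * φ a)
    (hS : ∀ S : Finset ι, ∑ i ∈ S, m i * x i ≤ G (∑ i ∈ S, m i)) {N : ℕ} (hN : 0 < N) :
    ∃ ρ : Fin (N + (Fintype.card ι).factorial) → (ι ≃ Fin (Fintype.card ι)),
      ∀ i, x i ≤ (N : ℝ)⁻¹ * ∑ a, φ (massBefore m (ρ a) i) := by
  classical
  have hcard : Fintype.card (ι ≃ Fin (Fintype.card ι)) = (Fintype.card ι).factorial :=
    Fintype.card_equiv (Fintype.equivFin ι)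
  have : Nonempty (ι ≃ Fin (Fintype.card ι)) := ⟨Fintype.equivFin ι⟩
  obtain ⟨w, hw0, hw1, hw⟩ := exists_le_convex_combination
    (x := x) (y := fun (τ : ι ≃ Fin (Fintype.card ι)) i => φ (massBefore m τ i))
    fun z hz => exists_greedy_order hm hmx hφ hG0 hG hS hz
  obtain ⟨ρ, hρ⟩ := exists_rounding hw0 hw1 hN hcard
  exact ⟨ρ, fun i => (hw i).trans (hρ (fun τ => φ (massBefore m τ i)) fun τ =>
    hφ _ (Finset.sum_nonneg fun j _ => hm j))⟩

end Majorization

/-! ### The greedy profile -/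

section Profile

/-- The profile `φ(a) = (1+e) (a+1)^{-1/p}`, a bounded majorant of `a^{-1/p}` far from the
origin. -/
noncomputable def profile (p e a : ℝ) : ℝ := (1 + e) * (a + 1) ^ (-(1 / p))

/-- The primitive of `profile` that vanishes at the origin. -/
noncomputable def profilePrim (p e a : ℝ) : ℝ :=
  (1 + e) * p.conjExponent * ((a + 1) ^ (1 / p.conjExponent) - 1)

variable {p e : ℝ}

lemma one_div_conjExponent (hp : 1 < p) : 1 / p.conjExponent = 1 - 1 / p := by
  have := (Real.HolderConjugate.conjExponent hp).inv_add_inv_eq_one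
  rw [one_div, one_div]; linarith

lemma profile_nonneg (he : 0 ≤ e) {a : ℝ} (ha : 0 ≤ a) : 0 ≤ profile p e a :=
  mul_nonneg (by linarith) (Real.rpow_nonneg (by linarith) _)

lemma profilePrim_zero : profilePrim p e 0 = 0 := by simp [profilePrim]

lemma profilePrim_sub_le (hp : 1 < p) (he : 0 ≤ e) {a b : ℝ} (ha : 0 ≤ a) (hab : a ≤ b) :
    profilePrim p e b - profilePrim p e a ≤ (b - a) * profile p e a := by
  have hq := (Real.HolderConjugate.conjExponent hp).symm
  have hθ := one_div_conjExponent hp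
  set q := p.conjExponent
  set θ := 1 / q with hθdef
  have hq0 : 0 < q := hq.pos
  have hθ0 : 0 ≤ θ := by positivity
  have hθ1 : θ ≤ 1 := by rw [hθ]; have : 0 < 1 / p := by positivity
                         linarith
  have ha1 : 0 < a + 1 := by linarith
  have hfac : (b + 1) ^ θ = (a + 1) ^ θ * (1 + (b - a) / (a + 1)) ^ θ := by
    rw [← Real.mul_rpow ha1.le (by have : 0 ≤ (b - a) / (a + 1) := div_nonneg (by linarith) ha1.le
                                   linarith)]
    congr 1
    field_simp
    ring
  have hbern : (1 + (b - a) / (a + 1)) ^ θ ≤ 1 + θ * ((b - a) / (a + 1)) :=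
    rpow_one_add_le_one_add_mul_self (by
      have : 0 ≤ (b - a) / (a + 1) := div_nonneg (by linarith) ha1.le
      linarith) hθ0 hθ1
  have hpow : (a + 1) ^ (-(1 / p)) = (a + 1) ^ θ / (a + 1) := by
    rw [hθ, show -(1 / p) = (1 - 1 / p) - 1 by ring, Real.rpow_sub_one ha1.ne']
  have hpos : 0 ≤ (a + 1) ^ θ := Real.rpow_nonneg ha1.le _
  have h1 : (b + 1) ^ θ - (a + 1) ^ θ ≤ θ * ((b - a) * (a + 1) ^ (-(1 / p))) := by
    rw [hfac, hpow]
    have := mul_le_mul_of_nonneg_left hbern hpos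
    calc _ ≤ (a + 1) ^ θ * (1 + θ * ((b - a) / (a + 1))) - (a + 1) ^ θ := by linarith
      _ = _ := by ring
  have h2 : q * θ = 1 := by rw [hθdef]; field_simp
  unfold profilePrim profile
  calc (1 + e) * q * ((b + 1) ^ θ - 1) - (1 + e) * q * ((a + 1) ^ θ - 1)
      = (1 + e) * q * ((b + 1) ^ θ - (a + 1) ^ θ) := by ring
    _ ≤ (1 + e) * q * (θ * ((b - a) * (a + 1) ^ (-(1 / p)))) := by gcongr
    _ = (q * θ) * ((b - a) * ((1 + e) * (a + 1) ^ (-(1 / p)))) := by ring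
    _ = _ := by rw [h2, one_mul]

/-- The primitive lies above `u ↦ p' u^{1/p'}`, the integral of `t^{-1/p}`, except near the
origin, where the linear bound coming from an upper bound `κ` on the values takes over. -/
lemma exists_profilePrim_ge (hp : 1 < p) (he : 0 < e) : ∃ κ : ℝ, 0 < κ ∧ ∀ u, 0 ≤ u →
    ∀ y, y ≤ κ * u → y ≤ p.conjExponent * u ^ (1 / p.conjExponent) → y ≤ profilePrim p e u := by
  have hq := (Real.HolderConjugate.conjExponent hp).symm
  have hθ := one_div_conjExponent hp
  set q := p.conjExponent
  set θ := 1 / q with hθdef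
  have hq0 : 0 < q := hq.pos
  have hθ0 : 0 < θ := by positivity
  -- beyond `U` the constant of integration is negligible
  set U : ℝ := ((1 + e) / e) ^ q with hU
  have hU0 : 0 < U := by positivity
  refine ⟨(U + 1) ^ (-(1 / p)), by positivity, fun u hu y hy1 hy2 => ?_⟩
  rcases le_or_gt U u with hUu | hUu
  · refine hy2.trans ?_
    have h1 : (1 + e) / e ≤ u ^ θ := by
      have h2 := Real.rpow_le_rpow hU0.le hUu hθ0.le
      rwa [hU, ← Real.rpow_mul (by positivity), hθdef, mul_one_div, div_self hq0.ne',
        Real.rpow_one] at h2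
    rw [div_le_iff₀ he] at h1
    have h3 : u ^ θ ≤ (u + 1) ^ θ := Real.rpow_le_rpow hu (by linarith) hθ0.le
    unfold profilePrim
    have h4 : u ^ θ ≤ (1 + e) * ((u + 1) ^ θ - 1) := by nlinarith
    calc q * u ^ θ ≤ q * ((1 + e) * ((u + 1) ^ θ - 1)) := by gcongr
      _ = _ := by ring
  · refine hy1.trans ?_
    -- concavity: compare with the slope at the right end `u`
    have h1 : 0 < u + 1 := by linarith
    have hθ1 : θ ≤ 1 := by
      rw [hθ]
      have : 0 < 1 / p := by positivity
      linarith
    have hbern : (1 + -(u / (u + 1))) ^ θ ≤ 1 + θ * (-(u / (u + 1))) :=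
      rpow_one_add_le_one_add_mul_self (by
        have : u / (u + 1) ≤ 1 := by rw [div_le_one h1]; linarith
        linarith) hθ0.le hθ1
    have h2 : 1 + -(u / (u + 1)) = (u + 1)⁻¹ := by field_simp; ring
    rw [h2, Real.inv_rpow h1.le] at hbern
    have hpos : 0 < (u + 1) ^ θ := Real.rpow_pos_of_pos h1 _
    have h3 := mul_le_mul_of_nonneg_left hbern hpos.le
    rw [mul_inv_cancel₀ hpos.ne'] at h3
    have hpow : (u + 1) ^ (-(1 / p)) = (u + 1) ^ θ / (u + 1) := by
      rw [hθ, show -(1 / p) = (1 - 1 / p) - 1 by ring, Real.rpow_sub_one h1.ne']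
    have h4 : θ * (u * (u + 1) ^ (-(1 / p))) ≤ (u + 1) ^ θ - 1 := by
      rw [hpow]
      calc θ * (u * ((u + 1) ^ θ / (u + 1)))
          = (u + 1) ^ θ - (u + 1) ^ θ * (1 + θ * -(u / (u + 1))) := by ring
        _ ≤ _ := by linarith
    have h5 : (U + 1) ^ (-(1 / p)) ≤ (u + 1) ^ (-(1 / p)) :=
      Real.rpow_le_rpow_of_nonpos h1 (by linarith) (by
        have : 0 < 1 / p := by positivity
        linarith)
    have h6 : q * θ = 1 := by rw [hθdef]; field_simp
    have h7 : 0 ≤ (u + 1) ^ θ - 1 := by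
      refine le_trans ?_ h4
      positivity
    unfold profilePrim
    calc (U + 1) ^ (-(1 / p)) * u ≤ (u + 1) ^ (-(1 / p)) * u := by gcongr
      _ = q * (θ * (u * (u + 1) ^ (-(1 / p)))) := by rw [← mul_assoc, h6]; ring
      _ ≤ q * ((u + 1) ^ θ - 1) := by gcongr
      _ ≤ (1 + e) * (q * ((u + 1) ^ θ - 1)) := by
          refine le_mul_of_one_le_left (by positivity) (by linarith)
      _ = _ := by ring

/-- A greedy vertex has weak norm at most `1 + e`: the mass of its last cell above the level `l`,
which is at most `1`, is absorbed by the shift of the argument in `profile`. -/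
lemma sum_mass_profile_lt_le (hp : 1 < p) (he : 0 ≤ e) {ι : Type*} [Fintype ι] {m : ι → ℝ}
    (hm : ∀ i, 0 ≤ m i) (hm1 : ∀ i, m i ≤ 1) (τ : ι ≃ Fin (Fintype.card ι)) {l : ℝ} (hl : 0 < l) :
    ∑ i with l < profile p e (massBefore m τ i), m i ≤ ((1 + e) / l) ^ p := by
  classical
  set Y : Finset ι := {i | l < profile p e (massBefore m τ i)} with hY
  rcases Y.eq_empty_or_nonempty with h0 | h0
  · rw [h0, Finset.sum_empty]; positivity
  obtain ⟨i₀, hi₀, hmax⟩ := Y.exists_max_image τ h0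
  have hsub : Y ⊆ insert i₀ ({j | τ j < τ i₀} : Finset ι) := by
    intro j hj
    rw [Finset.mem_insert]
    rcases (hmax j hj).lt_or_eq with h | h
    · exact Or.inr (by simpa using h)
    · exact Or.inl (τ.injective h)
  have hsum : ∑ i ∈ Y, m i ≤ massBefore m τ i₀ + 1 := by
    refine (Finset.sum_le_sum_of_subset_of_nonneg hsub fun i _ _ => hm i).trans ?_
    rw [Finset.sum_insert (by simp), add_comm]
    exact add_le_add le_rfl (hm1 i₀)
  refine hsum.trans ?_
  have hM : 0 ≤ massBefore m τ i₀ := Finset.sum_nonneg fun j _ => hm j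
  have h1 : l < profile p e (massBefore m τ i₀) := by simpa [hY] using hi₀
  set M := massBefore m τ i₀
  unfold profile at h1
  have h2 : 0 < M + 1 := by linarith
  rw [Real.rpow_neg h2.le] at h1
  have h3 : (M + 1) ^ (1 / p) ≤ (1 + e) / l := by
    have h4 : 0 < (M + 1) ^ (1 / p) := Real.rpow_pos_of_pos h2 _
    rw [le_div_iff₀ hl]
    rw [← div_eq_mul_inv, lt_div_iff₀ h4] at h1
    linarith
  have h5 := Real.rpow_le_rpow (Real.rpow_nonneg h2.le _) h3 (show 0 ≤ p by linarith)
  rwa [← Real.rpow_mul h2.le, one_div_mul_cancel (by linarith), Real.rpow_one] at h5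

end Profile

/-! ### Weak Lorentz spaces: one block of levels -/

section Block

variable {R : Type*} [MeasurableSpace R] {μ : Measure R} {p e : ℝ}

/-- A set of measure at most `n c` splits into `n` pieces of measure at most `c`. -/
lemma IsNonatomic.exists_partition (hμ : IsNonatomic μ) {A : Set R} (hA : MeasurableSet A)
    (hfin : μ A ≠ ∞) {c : ℝ} (hc : 0 < c) {n : ℕ} (hn : 0 < n) (hAc : μ.real A ≤ n * c) :
    ∃ q : R → Fin n, Measurable q ∧ ∀ k, μ.real (A ∩ {x | q x = k}) ≤ c := by
  obtain ⟨U, hUm, hU0, hU⟩ := hμ.exists_uniform hA hfin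
  let cut : ℕ → Fin n := fun k => ⟨min k (n - 1), by omega⟩
  have hqm : Measurable fun x => cut ⌊U x / c⌋₊ :=
    (measurable_of_countable cut).comp (Nat.measurable_floor.comp (hUm.div_const c))
  refine ⟨fun x => cut ⌊U x / c⌋₊, hqm, fun k => ?_⟩
  have hlt : ∀ᵐ x ∂(μ.restrict A), U x < μ.real A := by
    have h1 : ∀ᵐ t ∂(volume.restrict (Set.Ico 0 (μ.real A))), t < μ.real A :=
      (ae_restrict_mem measurableSet_Ico).mono fun t ht => ht.2
    rw [← hU] at h1
    exact ae_of_ae_map hUm.aemeasurable h1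
  have hms : MeasurableSet {x | cut ⌊U x / c⌋₊ = k} := hqm (measurableSet_singleton k)
  have hle : μ (A ∩ {x | cut ⌊U x / c⌋₊ = k}) ≤ ENNReal.ofReal c := by
    rw [Set.inter_comm, ← Measure.restrict_apply hms]
    calc (μ.restrict A) {x | cut ⌊U x / c⌋₊ = k}
        ≤ (μ.restrict A) (U ⁻¹' Set.Ico (k * c) (k * c + c)) := by
          refine measure_mono_ae ?_
          filter_upwards [hlt] with x hx hxk
          have hlt' : ⌊U x / c⌋₊ < n := by
            rw [Nat.floor_lt (div_nonneg (hU0 x) hc.le), div_lt_iff₀ hc]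
            exact hx.trans_le hAc
          have hk : ⌊U x / c⌋₊ = k := by
            have h2 : (cut ⌊U x / c⌋₊ : ℕ) = k := congrArg Fin.val hxk
            simp only [cut] at h2
            omega
          rw [Nat.floor_eq_iff (div_nonneg (hU0 x) hc.le), le_div_iff₀ hc, div_lt_iff₀ hc] at hk
          exact ⟨hk.1, by linarith [hk.2]⟩
      _ = volume (Set.Ico ((k : ℕ) * c) (k * c + c) ∩ Set.Ico 0 (μ.real A)) := by
          rw [← Measure.map_apply hUm measurableSet_Ico, hU, Measure.restrict_apply
            measurableSet_Ico]
      _ ≤ volume (Set.Ico ((k : ℕ) * c) (k * c + c)) := measure_mono Set.inter_subset_left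
      _ = ENNReal.ofReal c := by rw [Real.volume_Ico, add_sub_cancel_left]
  exact ENNReal.toReal_le_of_le_ofReal hc.le hle

/-- Geometric levels: a measurable index `n` with `bⁿ < f / L ≤ bⁿ⁺¹`. -/
lemma exists_level_index {b : ℝ} (hb : 1 < b) {n : ℕ} (hn : 0 < n) {E L : ℝ} (hEb : E ≤ b ^ n)
    (hL : 0 < L) {f : R → ℝ} (hf : Measurable f) :
    ∃ lev : R → Fin n, Measurable lev ∧ ∀ x, L < f x → f x ≤ E * L →
      L * b ^ (lev x : ℕ) < f x ∧ f x ≤ L * b ^ ((lev x : ℕ) + 1) := by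
  have hlb : 0 < Real.log b := Real.log_pos hb
  have hb0 : 0 < b := by linarith
  let cut : ℕ → Fin n := fun k => ⟨min (k - 1) (n - 1), by omega⟩
  refine ⟨fun x => cut ⌈Real.log (f x / L) / Real.log b⌉₊,
    (measurable_of_countable cut).comp (Nat.measurable_ceil.comp
      ((Real.measurable_log.comp (hf.div_const L)).div_const _)), fun x hx1 hx2 => ?_⟩
  set r := Real.log (f x / L) / Real.log b with hr
  have hfL : 1 < f x / L := by rwa [one_lt_div hL]
  have hr0 : 0 < r := div_pos (Real.log_pos hfL) hlb
  have hceil : 1 ≤ ⌈r⌉₊ := Nat.one_le_iff_ne_zero.2 (Nat.ceil_pos.2 hr0).ne'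
  have hrn : r ≤ n := by
    rw [hr, div_le_iff₀ hlb, ← Real.log_pow]
    refine Real.log_le_log (by positivity) (le_trans ?_ hEb)
    rwa [div_le_iff₀ hL]
  have hcn : ⌈r⌉₊ ≤ n := Nat.ceil_le.2 hrn
  have hval : (cut ⌈r⌉₊ : ℕ) = ⌈r⌉₊ - 1 := by simp only [cut]; omega
  dsimp only
  rw [hval, Nat.sub_add_cancel hceil]
  constructor
  · have h1 : ((⌈r⌉₊ - 1 : ℕ) : ℝ) < r := Nat.lt_ceil.1 (by omega)
    rw [hr, lt_div_iff₀ hlb, ← Real.log_pow, Real.log_lt_log_iff (by positivity) (by positivity),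
      lt_div_iff₀ hL] at h1
    rwa [mul_comm]
  · have h1 : r ≤ (⌈r⌉₊ : ℝ) := Nat.le_ceil r
    rw [hr, div_le_iff₀ hlb, ← Real.log_pow, Real.log_le_log_iff (by positivity) (by positivity),
      div_le_iff₀ hL] at h1
    rwa [mul_comm]

/-- A function with values in `(L, E L]` that is majorized by `t ↦ t^{-1/p}`, in the sense that its
integral over a set of measure `a` is at most `∫₀^a t^{-1/p} dt = p' a^{1/p'}`, lies, up to a factor
`1 + e`, below an average of functions of weak norm at most `1 + e`. The numbers `N` and `P` do not
depend on `L`, and the summands are at most a fixed multiple of `L`: this allows blocks at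
different levels to be combined. -/
lemma exists_block_majorants (hμ : IsNonatomic μ) (hp : 1 < p) (he : 0 < e) {C E κ : ℝ}
    (hE : 1 ≤ E) (hκ0 : 0 < κ)
    (hκ : ∀ u, 0 ≤ u → ∀ y, y ≤ κ * u → y ≤ p.conjExponent * u ^ (1 / p.conjExponent) →
      y ≤ profilePrim p e u) :
    ∃ N P : ℕ, 0 < N ∧ (P : ℝ) ≤ (1 + e) * N ∧ ∀ L : ℝ, 0 < L → ∀ f : R → ℝ, Measurable f →
      ∀ X : Set R, MeasurableSet X → (∀ x ∈ X, L < f x ∧ f x ≤ E * L) →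
      μ X ≤ ENNReal.ofReal (C * L ^ (-p)) →
      (∀ A ⊆ X, MeasurableSet A → ∫⁻ x in A, ENNReal.ofReal (f x) ∂μ ≤
        ENNReal.ofReal (p.conjExponent * μ.real A ^ (1 / p.conjExponent))) →
      ∃ h : Fin P → R → ℝ, (∀ a, Measurable (h a)) ∧
        (∀ a x, 0 ≤ h a x ∧ h a x ≤ (1 + e) * (E * L / κ)) ∧
        (∀ a l, 0 < l → μ (X ∩ {x | l < h a x}) ≤ ENNReal.ofReal (((1 + e) / l) ^ p)) ∧
        ∀ᵐ x ∂μ, x ∈ X → f x ≤ (1 + e) * ((N : ℝ)⁻¹ * ∑ a, h a x) := by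
  classical
  have hq := (Real.HolderConjugate.conjExponent hp).symm
  have hθ := one_div_conjExponent hp
  set q' := p.conjExponent
  have hq0 : 0 < q' := hq.pos
  have hb : 1 < 1 + e := by linarith
  obtain ⟨n₁, hn₁⟩ := pow_unbounded_of_one_lt E hb
  have hn₁0 : 0 < n₁ := Nat.pos_of_ne_zero fun h => by
    rw [h, pow_zero] at hn₁; linarith
  -- `n₁` geometric levels with ratio `1 + e`, each cut into `n₂` cells
  obtain ⟨n₂, hn₂⟩ := exists_nat_gt (max 0 (C * (E / κ) ^ p))
  have hn₂0 : 0 < n₂ := by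
    have := (le_max_left 0 (C * (E / κ) ^ p)).trans_lt hn₂
    exact_mod_cast this
  set F := (Fintype.card (Fin n₁ × Fin n₂)).factorial with hF
  obtain ⟨N, hN⟩ := exists_nat_gt ((F : ℝ) / e)
  have hN0 : 0 < N := by
    have : (0 : ℝ) < N := lt_of_le_of_lt (by positivity) hN
    exact_mod_cast this
  refine ⟨N, N + F, hN0, ?_, ?_⟩
  · rw [div_lt_iff₀ he] at hN
    push_cast
    linarith
  intro L hL f hf X hX hfX hμX hD
  -- cells of measure `c = T ^ (-p)` and values measured in units of `T` turn the hypothesis on the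
  -- integrals into constraints on masses at most `1`; values at most `E L = κ T` become at most `κ`
  set T := E * L / κ with hT
  have hT0 : 0 < T := by positivity
  set c := T ^ (-p) with hc
  have hc0 : 0 < c := Real.rpow_pos_of_pos hT0 _
  have hcT : c ^ (1 / q') = c * T := by
    rw [hc, ← Real.rpow_mul hT0.le, hθ, ← Real.rpow_add_one hT0.ne']
    congr 1
    field_simp
    ring
  have hcTp : c * T ^ p = 1 := by
    rw [hc, ← Real.rpow_add hT0, neg_add_cancel, Real.rpow_zero]
  have hXfin : μ X ≠ ∞ := ne_top_of_le_ne_top ENNReal.ofReal_ne_top hμX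
  have hXc : μ.real X ≤ n₂ * c := by
    have h1 : C * L ^ (-p) = C * (E / κ) ^ p * c := by
      have h2 : T = (E / κ) * L := by rw [hT]; ring
      rw [hc, h2, Real.mul_rpow (by positivity) hL.le, Real.rpow_neg (show 0 ≤ E / κ by positivity)]
      have : (E / κ) ^ p ≠ 0 := (Real.rpow_pos_of_pos (by positivity) _).ne'
      field_simp
    refine ENNReal.toReal_le_of_le_ofReal (by positivity) (hμX.trans ?_)
    refine ENNReal.ofReal_le_ofReal ?_
    rw [h1]
    gcongr
    exact (le_max_right _ _).trans hn₂.le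
  obtain ⟨lev, hlevm, hlev⟩ := exists_level_index hb hn₁0 hn₁.le hL hf
  have hlevel : ∀ n : Fin n₁, MeasurableSet (X ∩ {x | lev x = n}) := fun n =>
    hX.inter (hlevm (measurableSet_singleton n))
  have hpart : ∀ n : Fin n₁, ∃ q : R → Fin n₂, Measurable q ∧
      ∀ k, μ.real ((X ∩ {x | lev x = n}) ∩ {x | q x = k}) ≤ c := fun n =>
    hμ.exists_partition (hlevel n) (ne_top_of_le_ne_top hXfin (measure_mono Set.inter_subset_left))
      hc0 hn₂0 ((measureReal_mono Set.inter_subset_left hXfin).trans hXc)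
  choose q hqm hqc using hpart
  set Q : R → Fin n₁ × Fin n₂ := fun x => (lev x, q (lev x) x) with hQ
  have hQm : Measurable Q := by
    refine hlevm.prodMk ?_
    have h1 : Measurable (Function.uncurry fun (n : Fin n₁) (x : R) => q n x) :=
      measurable_from_prod_countable_right fun n => hqm n
    exact h1.comp (hlevm.prodMk measurable_id)
  set Z : Fin n₁ × Fin n₂ → Set R := fun i => X ∩ {x | Q x = i} with hZ
  have hZm : ∀ i, MeasurableSet (Z i) := fun i => hX.inter (hQm (measurableSet_singleton i))
  have hZX : ∀ i, Z i ⊆ X := fun i => Set.inter_subset_left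
  have hZfin : ∀ i, μ (Z i) ≠ ∞ := fun i => ne_top_of_le_ne_top hXfin (measure_mono (hZX i))
  have hZc : ∀ i, μ.real (Z i) ≤ c := fun i => by
    refine le_trans (measureReal_mono (fun x hx => ?_) ?_) (hqc i.1 i.2)
    · have h1 : Q x = i := hx.2
      have h2 : lev x = i.1 := congrArg Prod.fst h1
      have h3 : q (lev x) x = i.2 := congrArg Prod.snd h1
      exact ⟨⟨hx.1, h2⟩, by rw [h2] at h3; exact h3⟩
    · exact ne_top_of_le_ne_top hXfin
        (measure_mono (Set.inter_subset_left.trans Set.inter_subset_left))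
  have hZdisj : ∀ i j, i ≠ j → Disjoint (Z i) (Z j) := fun i j hij =>
    Set.disjoint_left.2 fun x hx hx' => hij (hx.2.symm.trans hx'.2)
  set m : Fin n₁ × Fin n₂ → ℝ := fun i => μ.real (Z i) / c with hm
  have hm0 : ∀ i, 0 ≤ m i := fun i => by positivity
  have hm1 : ∀ i, m i ≤ 1 := fun i => (div_le_one hc0).2 (hZc i)
  have hmc : ∀ i, μ.real (Z i) = c * m i := fun i => by simp only [hm]; field_simp
  -- the lower bound for `f / T` on the cell `i`
  set v : Fin n₁ × Fin n₂ → ℝ := fun i => if m i = 0 then 0 else L * (1 + e) ^ (i.1 : ℕ) / T with hv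
  have hlow : ∀ i, ∀ x ∈ Z i, T * v i ≤ f x := by
    intro i x hx
    have h1 := (hlev x (hfX x hx.1).1 (hfX x hx.1).2).1
    have h2 : lev x = i.1 := congrArg Prod.fst hx.2
    rw [h2] at h1
    simp only [hv]
    split_ifs
    · rw [mul_zero]; exact hL.le.trans (hfX x hx.1).1.le
    · rw [mul_div_cancel₀ _ hT0.ne']; exact h1.le
  have hv0 : ∀ i, 0 ≤ v i := fun i => by
    simp only [hv]; split_ifs
    · exact le_rfl
    · positivity
  -- the polymatroid constraints express the majorization hypothesis on unions of cells
  have hS : ∀ S : Finset (Fin n₁ × Fin n₂),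
      ∑ i ∈ S, m i * v i ≤ profilePrim p e (∑ i ∈ S, m i) := by
    intro S
    set A := ⋃ i ∈ S, Z i with hA
    have hAm : MeasurableSet A := Finset.measurableSet_biUnion _ fun i _ => hZm i
    have hAX : A ⊆ X := Set.iUnion₂_subset fun i _ => hZX i
    have hAfin : μ A ≠ ∞ := ne_top_of_le_ne_top hXfin (measure_mono hAX)
    have hAreal : μ.real A = c * ∑ i ∈ S, m i := by
      rw [hA, measureReal_biUnion_finset (fun i _ j _ hij => hZdisj i j hij) (fun i _ => hZm i)
        (fun i _ => hZfin i), Finset.mul_sum]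
      exact Finset.sum_congr rfl fun i _ => hmc i
    have hsum : ENNReal.ofReal (c * T * ∑ i ∈ S, m i * v i) ≤
        ∫⁻ x in A, ENNReal.ofReal (f x) ∂μ := by
      rw [hA, lintegral_biUnion_finset (fun i _ j _ hij => hZdisj i j hij) (fun i _ => hZm i),
        Finset.mul_sum, ENNReal.ofReal_sum_of_nonneg
        (fun i _ => by have := hm0 i; have := hv0 i; positivity)]
      refine Finset.sum_le_sum fun i _ => ?_
      have h1 : c * T * (m i * v i) = μ.real (Z i) * (T * v i) := by rw [hmc]; ring
      rw [h1, ENNReal.ofReal_mul measureReal_nonneg, measureReal_def,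
        ENNReal.ofReal_toReal (hZfin i), mul_comm, ← setLIntegral_const]
      exact setLIntegral_mono' (hZm i) fun x hx => ENNReal.ofReal_le_ofReal (hlow i x hx)
    set u := ∑ i ∈ S, m i
    have hu : 0 ≤ u := Finset.sum_nonneg fun i _ => hm0 i
    have hcT0 : 0 < c * T := by positivity
    refine hκ u hu _ ?_ ?_
    · have h1 : ∫⁻ x in A, ENNReal.ofReal (f x) ∂μ ≤ ENNReal.ofReal (E * L * (c * u)) := by
        rw [← hAreal, ENNReal.ofReal_mul (by positivity), measureReal_def,
          ENNReal.ofReal_toReal hAfin, ← setLIntegral_const]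
        exact setLIntegral_mono' hAm fun x hx => ENNReal.ofReal_le_ofReal (hfX x (hAX hx)).2
      have h2 := (ENNReal.ofReal_le_ofReal_iff (by positivity)).1 (hsum.trans h1)
      have h3 : E * L * (c * u) = c * T * (κ * u) := by rw [hT]; field_simp
      rw [h3] at h2
      exact le_of_mul_le_mul_left h2 hcT0
    · have h1 := hsum.trans (hD A hAX hAm)
      rw [hAreal, Real.mul_rpow hc0.le hu, hcT] at h1
      have h2 := (ENNReal.ofReal_le_ofReal_iff (by positivity)).1 h1
      refine le_of_mul_le_mul_left (h2.trans (le_of_eq ?_)) hcT0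
      ring
  obtain ⟨ρ, hρ⟩ := exists_greedy_average hm0 (fun i hi => by simp only [hv]; rw [if_pos hi])
    (fun a ha => profile_nonneg (p := p) he.le ha) profilePrim_zero
    (fun a b ha hab => profilePrim_sub_le hp he.le ha hab) hS hN0
  have hM0 : ∀ τ i, 0 ≤ massBefore m τ i := fun τ i => Finset.sum_nonneg fun j _ => hm0 j
  refine ⟨fun a x => T * profile p e (massBefore m (ρ a) (Q x)), fun a => ?_, fun a x => ⟨?_, ?_⟩,
    fun a l hl => ?_, ?_⟩
  · exact (measurable_of_countable fun i => T * profile p e (massBefore m (ρ a) i)).comp hQm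
  · exact mul_nonneg hT0.le (profile_nonneg he.le (hM0 _ _))
  · rw [mul_comm (1 + e)]
    refine mul_le_mul_of_nonneg_left ?_ hT0.le
    unfold profile
    refine mul_le_of_le_one_right (by linarith) ?_
    refine Real.rpow_le_one_of_one_le_of_nonpos (by linarith [hM0 (ρ a) (Q x)]) ?_
    have : 0 < 1 / p := by positivity
    linarith
  · have hset : X ∩ {x | l < T * profile p e (massBefore m (ρ a) (Q x))} ⊆
        ⋃ i ∈ ({i | l / T < profile p e (massBefore m (ρ a) i)} : Finset (Fin n₁ × Fin n₂)),
          Z i := by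
      intro x hx
      rw [Set.mem_iUnion₂]
      refine ⟨Q x, ?_, hx.1, rfl⟩
      rw [Finset.mem_filter]
      refine ⟨Finset.mem_univ _, ?_⟩
      rw [div_lt_iff₀ hT0, mul_comm]
      exact hx.2
    refine (measure_mono hset).trans ((measure_biUnion_finset_le _ _).trans ?_)
    have h1 := sum_mass_profile_lt_le hp he.le hm0 hm1 (ρ a) (div_pos hl hT0)
    calc ∑ i with l / T < profile p e (massBefore m (ρ a) i), μ (Z i)
        = ENNReal.ofReal (∑ i with l / T < profile p e (massBefore m (ρ a) i), c * m i) := by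
          rw [ENNReal.ofReal_sum_of_nonneg fun i _ => mul_nonneg hc0.le (hm0 i)]
          refine Finset.sum_congr rfl fun i _ => ?_
          rw [← hmc, measureReal_def, ENNReal.ofReal_toReal (hZfin i)]
      _ ≤ ENNReal.ofReal (c * ((1 + e) / (l / T)) ^ p) := by
          rw [← Finset.mul_sum]
          gcongr
      _ = ENNReal.ofReal (((1 + e) / l) ^ p) := by
          have h2 : (1 + e) / (l / T) = T * ((1 + e) / l) := by field_simp
          rw [h2, Real.mul_rpow hT0.le (by positivity), ← mul_assoc, hcTp, one_mul]
  · -- cells of measure zero are negligible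
    have hnull : ∀ᵐ x ∂μ, ∀ i, m i = 0 → x ∉ Z i := by
      rw [ae_all_iff]
      intro i
      by_cases hi : m i = 0
      · have h1 : μ (Z i) = 0 := by
          have h2 : μ.real (Z i) = 0 := by rw [hmc, hi, mul_zero]
          exact (measureReal_eq_zero_iff (hZfin i)).1 h2
        filter_upwards [measure_eq_zero_iff_ae_notMem.1 h1] with x hx _
        exact hx
      · exact Filter.Eventually.of_forall fun x h => absurd h hi
    filter_upwards [hnull] with x hx hxX
    have hmQ : m (Q x) ≠ 0 := fun h => hx (Q x) h ⟨hxX, rfl⟩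
    have h1 := (hlev x (hfX x hxX).1 (hfX x hxX).2).2
    have h2 : v (Q x) = L * (1 + e) ^ (lev x : ℕ) / T := by simp only [hv]; rw [if_neg hmQ]
    calc f x ≤ L * (1 + e) ^ ((lev x : ℕ) + 1) := h1
      _ = (1 + e) * (T * v (Q x)) := by rw [h2, pow_succ]; field_simp
      _ ≤ (1 + e) * (T * ((N : ℝ)⁻¹ * ∑ a, profile p e (massBefore m (ρ a) (Q x)))) := by
          gcongr
          exact hρ (Q x)
      _ = _ := by rw [← Finset.mul_sum]; ring

end Block

/-! ### Weak Lorentz spaces: combining the blocks -/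

section WeakNorm

variable {R : Type*} [MeasurableSpace R] {μ : Measure R} {p : ℝ} {f : R → ℝ}

lemma ofReal_lt_enorm_iff {l y : ℝ} (hl : 0 ≤ l) (hy : 0 ≤ y) :
    ENNReal.ofReal l < ‖y‖ₑ ↔ l < y := by
  rw [Real.enorm_of_nonneg hy, ENNReal.ofReal_lt_ofReal_iff_of_nonneg hl]

lemma lorentzNorm_top_le (hp : 0 < p) (hf : ∀ x, 0 ≤ f x) {K : ℝ} (hK : 0 < K)
    (h : ∀ l, 0 < l → μ {x | l < f x} ≤ ENNReal.ofReal ((K / l) ^ p)) :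
    lorentzNorm μ p ∞ f ≤ ENNReal.ofReal K := by
  rw [lorentzNorm, if_pos rfl]
  refine iSup₂_le fun t ht => ?_
  have ht0 : 0 < t := ht
  have htp : 0 < t ^ (1 / p) := Real.rpow_pos_of_pos ht0 _
  have hl : 0 < K / t ^ (1 / p) := by positivity
  have h1 : rearrangement μ f t ≤ ENNReal.ofReal (K / t ^ (1 / p)) := by
    rw [rearrangement_le_iff]
    have h2 : K / (K / t ^ (1 / p)) = t ^ (1 / p) := by field_simp
    have h3 := h _ hl
    rw [h2, ← Real.rpow_mul ht0.le, one_div_mul_cancel hp.ne', Real.rpow_one] at h3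
    simpa only [ofReal_lt_enorm_iff hl.le (hf _)] using h3
  calc ENNReal.ofReal t ^ (1 / p) * rearrangement μ f t
      ≤ ENNReal.ofReal (t ^ (1 / p)) * ENNReal.ofReal (K / t ^ (1 / p)) := by
        rw [ENNReal.ofReal_rpow_of_pos ht0]
        gcongr
    _ = ENNReal.ofReal K := by
        rw [← ENNReal.ofReal_mul htp.le, mul_div_cancel₀ _ htp.ne']

lemma measure_lt_le_of_lorentzNorm_top_le (hp : 0 < p) (hf : ∀ x, 0 ≤ f x) {K : ℝ} (hK : 0 < K)
    (h : lorentzNorm μ p ∞ f ≤ ENNReal.ofReal K) {l : ℝ} (hl : 0 < l) :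
    μ {x | l < f x} ≤ ENNReal.ofReal ((K / l) ^ p) := by
  rw [lorentzNorm, if_pos rfl] at h
  have ht : 0 < (K / l) ^ p := Real.rpow_pos_of_pos (by positivity) _
  have h1 := (le_iSup₂ (f := fun (t : ℝ) (_ : t ∈ Set.Ioi (0 : ℝ)) =>
    ENNReal.ofReal t ^ (1 / p) * rearrangement μ f t) _ ht).trans h
  have hKl : ((K / l) ^ p) ^ (1 / p) = K / l := by
    rw [← Real.rpow_mul (by positivity), mul_one_div_cancel hp.ne', Real.rpow_one]
  have h0 : ENNReal.ofReal (K / l) ≠ 0 := (ENNReal.ofReal_pos.2 (by positivity)).ne'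
  have hKm : ENNReal.ofReal K = ENNReal.ofReal (K / l) * ENNReal.ofReal l := by
    rw [← ENNReal.ofReal_mul (by positivity), div_mul_cancel₀ _ hl.ne']
  rw [ENNReal.ofReal_rpow_of_pos ht, hKl, hKm,
    ENNReal.mul_le_mul_iff_right h0 ENNReal.ofReal_ne_top, rearrangement_le_iff] at h1
  simpa only [ofReal_lt_enorm_iff hl.le (hf _)] using h1

lemma decompNorm_sum_le {ι : Type*} {s : ℝ≥0∞} (S : Finset ι) (g : ι → R → ℝ) :
    decompNorm μ p s (fun x => ∑ i ∈ S, g i x) ≤ ∑ i ∈ S, decompNorm μ p s (g i) := by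
  classical
  induction S using Finset.induction_on with
  | empty =>
    simpa using decompNorm_le_sum (μ := μ) (p := p) (s := s) (f := fun _ => 0) (n := 0)
      (F := fun _ _ => 0) (fun k => k.elim0) (by simp)
  | insert a S ha ih =>
    simp only [Finset.sum_insert ha]
    exact decompNorm_add_le.trans (by gcongr)

end WeakNorm

section Assembly

variable {R : Type*} [MeasurableSpace R] {μ : Measure R} {p e : ℝ} {f : R → ℝ}

/-- A nonnegative function that is majorized by `t ↦ t^{-1/p}` and whose values avoid the gaps
`(A₀ E Dʲ, A₀ Dʲ⁺¹]`, with `D = E B`, has decomposition norm close to `1` if `B` is large: the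
majorants of the different blocks hardly interact. -/
lemma decompNorm_le_of_gaps (hμ : IsNonatomic μ) (hp : 1 < p) (he : 0 < e)
    (hf : Measurable f) (hf0 : ∀ x, 0 ≤ f x) {C : ℝ}
    (hW : ∀ l, 0 < l → μ {x | l < f x} ≤ ENNReal.ofReal (C * l ^ (-p)))
    (hD : ∀ A, MeasurableSet A → μ A ≠ ∞ → ∫⁻ x in A, ENNReal.ofReal (f x) ∂μ ≤
      ENNReal.ofReal (p.conjExponent * μ.real A ^ (1 / p.conjExponent)))
    {E κ B A₀ : ℝ} (hE : 1 ≤ E) (hκ0 : 0 < κ)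
    (hκ : ∀ u, 0 ≤ u → ∀ y, y ≤ κ * u → y ≤ p.conjExponent * u ^ (1 / p.conjExponent) →
      y ≤ profilePrim p e u)
    (hB : 1 < B) (hCB : C * (κ * B) ^ (-p) ≤ e) (hA : 0 < A₀) {j : R → ℤ} (hj : Measurable j)
    (hjf : ∀ x, 0 < f x → A₀ * (E * B) ^ j x < f x ∧ f x ≤ A₀ * E * (E * B) ^ j x) :
    decompNorm μ p ∞ f ≤ ENNReal.ofReal ((1 + e) ^ 4) := by
  classical
  have hp0 : 0 < p := by linarith
  obtain ⟨N, P, hN, hPN, hblock⟩ := exists_block_majorants (C := C) hμ hp he hE hκ0 hκ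
  have hE0 : 0 < E := by linarith
  have hD1 : 1 < E * B := by nlinarith
  have hD0 : 0 < E * B := by linarith
  set lo : ℤ → ℝ := fun i => A₀ * (E * B) ^ i with hlo
  have hlo0 : ∀ i, 0 < lo i := fun i => by positivity
  have hsucc : ∀ i, lo (i + 1) = E * B * lo i := fun i => by
    simp only [hlo]; rw [zpow_add_one₀ hD0.ne']; ring
  have hmono : Monotone lo := fun i k hik =>
    mul_le_mul_of_nonneg_left (zpow_le_zpow_right₀ hD1.le hik) hA.le
  have hXm : ∀ i : ℤ, MeasurableSet ({x | 0 < f x} ∩ {x | j x = i}) := fun i =>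
    (measurableSet_lt measurable_const hf).inter (hj (measurableSet_singleton i))
  have hXW : ∀ i : ℤ, μ ({x | 0 < f x} ∩ {x | j x = i}) ≤ ENNReal.ofReal (C * lo i ^ (-p)) := by
    refine fun i => le_trans (measure_mono fun x hx => ?_) (hW _ (hlo0 i))
    have h1 := (hjf x hx.1).1
    rw [show j x = i from hx.2] at h1
    exact h1
  have hmaj := fun i : ℤ => hblock (lo i) (hlo0 i) f hf ({x | 0 < f x} ∩ {x | j x = i}) (hXm i)
    (fun x hx => by
      have h1 := hjf x hx.1
      rw [show j x = i from hx.2] at h1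
      exact ⟨h1.1, h1.2.trans (le_of_eq (by simp only [hlo]; ring))⟩) (hXW i)
    (fun A hAX hAm => hD A hAm (ne_top_of_le_ne_top ENNReal.ofReal_ne_top
      ((measure_mono hAX).trans (hXW i))))
  choose h hhm hhb hhd hhf using hmaj
  set H : Fin P → R → ℝ := fun a x => if 0 < f x then h (j x) a x else 0 with hH
  have hHm : ∀ a, Measurable (H a) := fun a => by
    refine Measurable.ite (measurableSet_lt measurable_const hf) ?_ measurable_const
    have h1 : Measurable (Function.uncurry fun (n : ℤ) (x : R) => h n a x) :=
      measurable_from_prod_countable_right fun n => hhm n a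
    exact h1.comp (hj.prodMk measurable_id)
  have hH0 : ∀ a x, 0 ≤ H a x := fun a x => by
    simp only [hH]; split_ifs
    · exact (hhb _ a x).1
    · exact le_rfl
  have hHd : ∀ a l, 0 < l → μ {x | l < H a x} ≤ ENNReal.ofReal (((1 + e) ^ 2 / l) ^ p) := by
    intro a l hl
    -- the block whose majorants have maximal value next above `l`
    obtain ⟨i, hi1, hi2⟩ := exists_mem_Ico_zpow (x := l / ((1 + e) * (E * A₀ / κ))) (by positivity)
      hD1
    rw [le_div_iff₀ (by positivity)] at hi1
    rw [div_lt_iff₀ (by positivity)] at hi2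
    have hT1 : (1 + e) * (E * lo i / κ) ≤ l := le_trans (le_of_eq (by simp only [hlo]; ring)) hi1
    have hT2 : l < (1 + e) * (E * lo (i + 1) / κ) :=
      hi2.trans_le (le_of_eq (by simp only [hlo]; ring))
    have hT0 : 0 < E * lo (i + 1) / κ := by have := hlo0 (i + 1); positivity
    have hsub : {x | l < H a x} ⊆
        (({x | 0 < f x} ∩ {x | j x = i + 1}) ∩ {x | l < h (i + 1) a x}) ∪
          {x | E * B * lo (i + 1) < f x} := by
      intro x hx
      have hx' : l < H a x := hx
      simp only [hH] at hx'
      split_ifs at hx' with hfx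
      · have h1 := hx'.trans_le (hhb (j x) a x).2
        have h2 : lo i < lo (j x) := by
          have h3 := hT1.trans_lt h1
          have h4 := lt_of_mul_lt_mul_left h3 (by positivity)
          rw [div_lt_div_iff_of_pos_right hκ0] at h4
          exact lt_of_mul_lt_mul_left h4 hE0.le
        have h3 : i < j x := hmono.reflect_lt h2
        rcases (show i + 1 ≤ j x from h3).eq_or_lt with h4 | h4
        · left
          refine ⟨⟨hfx, h4.symm⟩, ?_⟩
          rw [← h4] at hx'
          exact hx'
        · right
          have h5 : lo (i + 1 + 1) ≤ lo (j x) := hmono h4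
          rw [hsucc (i + 1)] at h5
          exact h5.trans_lt (hjf x hfx).1
      · exact absurd hx' (not_lt.2 hl.le)
    refine (measure_mono hsub).trans ((measure_union_le _ _).trans ?_)
    have hlp : 0 < ((1 + e) / l) ^ p := Real.rpow_pos_of_pos (by positivity) _
    have h2 : μ {x | E * B * lo (i + 1) < f x} ≤ ENNReal.ofReal (e * ((1 + e) / l) ^ p) := by
      refine (hW _ (by have := hlo0 (i + 1); positivity)).trans (ENNReal.ofReal_le_ofReal ?_)
      have h3 : E * B * lo (i + 1) = κ * B * (E * lo (i + 1) / κ) := by field_simp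
      rw [h3, Real.mul_rpow (by positivity) hT0.le, ← mul_assoc]
      refine mul_le_mul hCB ?_ (Real.rpow_pos_of_pos hT0 _).le he.le
      rw [Real.rpow_neg hT0.le, ← Real.inv_rpow hT0.le]
      refine Real.rpow_le_rpow (by positivity) ?_ hp0.le
      rw [inv_eq_one_div, div_le_div_iff₀ hT0 hl]
      linarith
    calc _ ≤ ENNReal.ofReal (((1 + e) / l) ^ p) + ENNReal.ofReal (e * ((1 + e) / l) ^ p) :=
          add_le_add (hhd _ a l hl) h2
      _ = ENNReal.ofReal ((1 + e) * ((1 + e) / l) ^ p) := by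
          rw [← ENNReal.ofReal_add hlp.le (by positivity)]
          congr 1; ring
      _ ≤ _ := by
          refine ENNReal.ofReal_le_ofReal ?_
          rw [pow_two, mul_div_assoc, Real.mul_rpow (by linarith) (by positivity)]
          gcongr
          nth_rewrite 1 [← Real.rpow_one (1 + e)]
          exact Real.rpow_le_rpow_of_exponent_le (by linarith) hp.le
  have hHn : ∀ a, lorentzNorm μ p ∞ (H a) ≤ ENNReal.ofReal ((1 + e) ^ 2) := fun a =>
    lorentzNorm_top_le hp0 (hH0 a) (by positivity) (hHd a)
  have hHmem : ∀ a, MemLorentz μ p ∞ (H a) := fun a =>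
    ⟨(hHm a).aemeasurable, (hHn a).trans_lt ENNReal.ofReal_lt_top⟩
  have hN0 : (0 : ℝ) < N := by exact_mod_cast hN
  set c : ℝ := (1 + e) * (N : ℝ)⁻¹ with hc
  have hc0 : 0 < c := by positivity
  have hle : ∀ᵐ x ∂μ, ‖f x‖ₑ ≤ ‖∑ a, c * H a x‖ₑ := by
    have hall : ∀ᵐ x ∂μ, ∀ i, x ∈ {x | 0 < f x} ∩ {x | j x = i} →
        f x ≤ (1 + e) * ((N : ℝ)⁻¹ * ∑ a, h i a x) := ae_all_iff.2 hhf
    filter_upwards [hall] with x hx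
    have h0 : 0 ≤ ∑ a, c * H a x := Finset.sum_nonneg fun a _ => mul_nonneg hc0.le (hH0 a x)
    rw [Real.enorm_of_nonneg (hf0 x), Real.enorm_of_nonneg h0]
    refine ENNReal.ofReal_le_ofReal ?_
    rcases (hf0 x).eq_or_lt with h1 | h1
    · rwa [← h1]
    · refine (hx (j x) ⟨h1, rfl⟩).trans (le_of_eq ?_)
      rw [← Finset.mul_sum, ← mul_assoc, ← hc]
      simp only [hH, if_pos h1]
  calc decompNorm μ p ∞ f ≤ decompNorm μ p ∞ (fun x => ∑ a, c * H a x) :=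
        decompNorm_mono hf.aemeasurable
          (Finset.measurable_sum _ fun a _ => (hHm a).const_mul c).aemeasurable hle
    _ ≤ ∑ a, lorentzNorm μ p ∞ (fun x => c * H a x) :=
        decompNorm_le_sum (fun a => (hHmem a).const_mul le_top hc0.ne')
          (Filter.EventuallyEq.refl _ _)
    _ ≤ ∑ _a : Fin P, ENNReal.ofReal (c * (1 + e) ^ 2) := by
        refine Finset.sum_le_sum fun a _ => ?_
        rw [lorentzNorm_const_mul le_top hc0.ne', Real.enorm_of_nonneg hc0.le,
          ENNReal.ofReal_mul hc0.le]
        gcongr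
        exact hHn a
    _ = ENNReal.ofReal (P * (c * (1 + e) ^ 2)) := by
        rw [Finset.sum_const, Finset.card_univ, Fintype.card_fin, nsmul_eq_mul,
          ENNReal.ofReal_mul P.cast_nonneg, ENNReal.ofReal_natCast]
    _ ≤ _ := by
        refine ENNReal.ofReal_le_ofReal ?_
        have h1 : (P : ℝ) * (N : ℝ)⁻¹ ≤ 1 + e := by
          rwa [← div_eq_mul_inv, div_le_iff₀ hN0]
        calc (P : ℝ) * (c * (1 + e) ^ 2) = (P * (N : ℝ)⁻¹) * (1 + e) ^ 3 := by rw [hc]; ring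
          _ ≤ (1 + e) * (1 + e) ^ 3 := by gcongr
          _ = _ := by ring

end Assembly

/-! ### Weak Lorentz spaces: general functions -/

section Top

variable {R : Type*} [MeasurableSpace R] {μ : Measure R} {p e : ℝ} {f : R → ℝ}

/-- Deleting one residue class of levels modulo `M` from `f` leaves a function whose values avoid
long gaps; averaging over the residue classes recovers `f` up to the factor `M / (M - 1)`. -/
lemma decompNorm_top_le_pow (hμ : IsNonatomic μ) (hp : 1 < p) (he : 0 < e)
    (hf : Measurable f) (hf0 : ∀ x, 0 ≤ f x) {C : ℝ} (hC : 0 ≤ C)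
    (hW : ∀ l, 0 < l → μ {x | l < f x} ≤ ENNReal.ofReal (C * l ^ (-p)))
    (hD : ∀ A, MeasurableSet A → μ A ≠ ∞ → ∫⁻ x in A, ENNReal.ofReal (f x) ∂μ ≤
      ENNReal.ofReal (p.conjExponent * μ.real A ^ (1 / p.conjExponent))) :
    decompNorm μ p ∞ f ≤ ENNReal.ofReal ((1 + e) ^ 5) := by
  classical
  have hp0 : 0 < p := by linarith
  obtain ⟨κ, hκ0, hκ⟩ := exists_profilePrim_ge hp he
  obtain ⟨M, hM⟩ := exists_nat_gt (1 / e)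
  have hM0 : (0 : ℝ) < M := lt_trans (by positivity) hM
  have hM0' : 0 < M := by exact_mod_cast hM0
  have hMe : (M : ℝ)⁻¹ * (M + 1) ≤ 1 + e := by
    rw [div_lt_iff₀ he] at hM
    rw [inv_mul_le_iff₀ hM0]
    linarith
  -- a ratio `B` so large that the part of `f` above the gap contributes at most `e`
  set B : ℝ := 2 + (C / e) ^ (1 / p) / κ with hB
  have hBpos : 0 ≤ (C / e) ^ (1 / p) / κ := by positivity
  have hB1 : 1 < B := by linarith
  have hB0 : 0 < B := by linarith
  have hCB : C * (κ * B) ^ (-p) ≤ e := by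
    have h1 : (C / e) ^ (1 / p) ≤ κ * B := by
      rw [hB, mul_add, mul_div_cancel₀ _ hκ0.ne']
      linarith
    have h2 : C / e ≤ (κ * B) ^ p := by
      have := Real.rpow_le_rpow (by positivity) h1 hp0.le
      rwa [← Real.rpow_mul (by positivity), one_div_mul_cancel hp0.ne', Real.rpow_one] at this
    rw [Real.rpow_neg (by positivity), ← div_eq_mul_inv, div_le_iff₀ (by positivity)]
    rwa [div_le_iff₀ he, mul_comm] at h2
  have hlB : 0 < Real.log B := Real.log_pos hB1
  -- the level of `f x > 0`, defined by `B ^ q x < f x ≤ B ^ (q x + 1)`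
  set q : R → ℤ := fun x => ⌈Real.log (f x) / Real.log B⌉ - 1 with hq
  have hqm : Measurable q :=
    (Int.measurable_ceil.comp ((Real.measurable_log.comp hf).div_const _)).sub_const 1
  have hqf : ∀ x, 0 < f x → B ^ q x < f x ∧ f x ≤ B ^ (q x + 1) := by
    intro x hx
    constructor
    · have h1 : (q x : ℝ) < Real.log (f x) / Real.log B := by
        simp only [hq]
        push_cast
        linarith [Int.ceil_lt_add_one (Real.log (f x) / Real.log B)]
      rw [lt_div_iff₀ hlB, ← Real.log_zpow] at h1
      exact (Real.log_lt_log_iff (by positivity) hx).1 h1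
    · have h1 : Real.log (f x) / Real.log B ≤ ((q x + 1 : ℤ) : ℝ) := by
        simp only [hq, sub_add_cancel]
        exact Int.le_ceil _
      rw [div_le_iff₀ hlB, ← Real.log_zpow] at h1
      exact (Real.log_le_log_iff hx (by positivity)).1 h1
  set good : Fin (M + 1) → Set R := fun i => {x | (q x - (i : ℕ)) % ((M : ℤ) + 1) ≠ 0} with hgood
  have hgm : ∀ i, MeasurableSet (good i) := fun i =>
    hqm (MeasurableSet.of_discrete (s := {n : ℤ | (n - (i : ℕ)) % ((M : ℤ) + 1) ≠ 0}))
  have hpart : ∀ i, decompNorm μ p ∞ ((good i).indicator f) ≤ ENNReal.ofReal ((1 + e) ^ 4) := by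
    intro i
    have hle : ∀ x, (good i).indicator f x ≤ f x := fun x =>
      Set.indicator_le_self' (fun y _ => hf0 y) x
    refine decompNorm_le_of_gaps hμ hp he (hf.indicator (hgm i))
      (fun x => Set.indicator_nonneg (fun y _ => hf0 y) x)
      (fun l hl => (measure_mono fun x hx => lt_of_lt_of_le hx (hle x)).trans (hW l hl))
      (fun A hA hAf => (lintegral_mono fun x => ENNReal.ofReal_le_ofReal (hle x)).trans
        (hD A hA hAf))
      (E := B ^ M) (A₀ := B ^ ((i : ℕ) + 1)) (j := fun x => (q x - (i : ℕ)) / ((M : ℤ) + 1))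
      (one_le_pow₀ hB1.le) hκ0 hκ hB1 hCB (by positivity)
      ((measurable_of_countable fun n : ℤ => (n - (i : ℕ)) / ((M : ℤ) + 1)).comp hqm)
      fun x hx => ?_
    have hxg : x ∈ good i := Set.mem_of_indicator_ne_zero hx.ne'
    rw [Set.indicator_of_mem hxg] at hx ⊢
    obtain ⟨h1, h2⟩ := hqf x hx
    have hpos : (0 : ℤ) < (M : ℤ) + 1 := by positivity
    have hdm := Int.mul_ediv_add_emod (q x - (i : ℕ)) ((M : ℤ) + 1)
    have hr0 := Int.emod_nonneg (q x - (i : ℕ)) hpos.ne'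
    have hrM := Int.emod_lt_of_pos (q x - (i : ℕ)) hpos
    have hr1 : (q x - (i : ℕ)) % ((M : ℤ) + 1) ≠ 0 := hxg
    set k := (q x - (i : ℕ)) / ((M : ℤ) + 1)
    set r := (q x - (i : ℕ)) % ((M : ℤ) + 1)
    have hBk : (B ^ M * B) ^ k = B ^ (((M : ℤ) + 1) * k) := by
      rw [← pow_succ, zpow_mul]; norm_cast
    rw [hBk, ← zpow_natCast B ((i : ℕ) + 1), ← zpow_natCast B M, ← zpow_add₀ hB0.ne',
      ← zpow_add₀ hB0.ne', ← zpow_add₀ hB0.ne']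
    constructor
    · refine lt_of_le_of_lt (zpow_le_zpow_right₀ hB1.le ?_) h1
      push_cast
      omega
    · refine h2.trans (zpow_le_zpow_right₀ hB1.le ?_)
      push_cast
      omega
  -- each point is lost in at most one residue class
  have hsum : ∀ x, f x ≤ ∑ i, (M : ℝ)⁻¹ * (good i).indicator f x := by
    intro x
    rw [← Finset.mul_sum, le_inv_mul_iff₀ hM0]
    have h1 : ∑ i, (good i).indicator f x =
        ∑ _i : Fin (M + 1), f x - ∑ i with x ∉ good i, f x := by
      rw [Finset.sum_filter, ← Finset.sum_sub_distrib]
      refine Finset.sum_congr rfl fun i _ => ?_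
      by_cases h : x ∈ good i <;> simp [h]
    have h2 : (Finset.card {i : Fin (M + 1) | x ∉ good i} : ℝ) ≤ 1 := by
      norm_cast
      rw [Finset.card_le_one]
      intro a ha b hb
      simp only [hgood, Finset.mem_filter, Finset.mem_univ, true_and, Set.mem_ofPred_eq,
        not_not] at ha hb
      have ha' := Int.dvd_of_emod_eq_zero ha
      have hb' := Int.dvd_of_emod_eq_zero hb
      have hab : ((M : ℤ) + 1) ∣ (a : ℕ) - (b : ℕ) := by
        have := dvd_sub hb' ha'
        rwa [sub_sub_sub_cancel_left] at this
      have h3 : ((a : ℕ) - (b : ℕ) : ℤ) = 0 :=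
        Int.eq_zero_of_abs_lt_dvd hab (by rw [abs_lt]; omega)
      exact Fin.ext (by omega)
    rw [h1, Finset.sum_const, Finset.sum_const, Finset.card_univ, Fintype.card_fin, nsmul_eq_mul,
      nsmul_eq_mul]
    push_cast
    nlinarith [mul_le_mul_of_nonneg_right h2 (hf0 x)]
  have hMi : (M : ℝ)⁻¹ ≠ 0 := (inv_pos.2 hM0).ne'
  calc decompNorm μ p ∞ f
      ≤ decompNorm μ p ∞ (fun x => ∑ i, (M : ℝ)⁻¹ * (good i).indicator f x) := by
        refine decompNorm_mono hf.aemeasurable (Finset.measurable_sum _ fun i _ =>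
          (hf.indicator (hgm i)).const_mul _).aemeasurable (Filter.Eventually.of_forall fun x => ?_)
        rw [Real.enorm_of_nonneg (hf0 x), Real.enorm_of_nonneg ((hf0 x).trans (hsum x))]
        exact ENNReal.ofReal_le_ofReal (hsum x)
    _ ≤ ∑ i, decompNorm μ p ∞ (fun x => (M : ℝ)⁻¹ * (good i).indicator f x) :=
        decompNorm_sum_le _ _
    _ ≤ ∑ _i : Fin (M + 1), ENNReal.ofReal ((M : ℝ)⁻¹ * (1 + e) ^ 4) := by
        refine Finset.sum_le_sum fun i _ => (decompNorm_const_mul_le le_top hMi).trans ?_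
        rw [Real.enorm_of_nonneg (by positivity), ENNReal.ofReal_mul (by positivity)]
        gcongr
        exact hpart i
    _ = ENNReal.ofReal ((M : ℝ)⁻¹ * (M + 1) * (1 + e) ^ 4) := by
        rw [Finset.sum_const, Finset.card_univ, Fintype.card_fin, nsmul_eq_mul,
          ← ENNReal.ofReal_natCast, ← ENNReal.ofReal_mul (Nat.cast_nonneg _)]
        congr 1
        push_cast
        ring
    _ ≤ _ := by
        refine ENNReal.ofReal_le_ofReal ?_
        calc (M : ℝ)⁻¹ * (M + 1) * (1 + e) ^ 4 ≤ (1 + e) * (1 + e) ^ 4 := by gcongr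
          _ = _ := by ring

/-- A function in weak `L^p` whose averages are dominated by those of `t ↦ t^{-1/p}` has
decomposition norm at most `1`. -/
lemma decompNorm_top_le_one (hμ : IsNonatomic μ) (hp : 1 < p)
    (hf : Measurable f) (hf0 : ∀ x, 0 ≤ f x) {C : ℝ} (hC : 0 ≤ C)
    (hW : ∀ l, 0 < l → μ {x | l < f x} ≤ ENNReal.ofReal (C * l ^ (-p)))
    (hD : ∀ A, MeasurableSet A → μ A ≠ ∞ → ∫⁻ x in A, ENNReal.ofReal (f x) ∂μ ≤
      ENNReal.ofReal (p.conjExponent * μ.real A ^ (1 / p.conjExponent))) :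
    decompNorm μ p ∞ f ≤ 1 := by
  have hlim : Filter.Tendsto (fun e : ℝ => ENNReal.ofReal ((1 + e) ^ 5)) (nhdsWithin 0 (Set.Ioi 0))
      (nhds 1) := by
    have h1 : Continuous fun e : ℝ => ENNReal.ofReal ((1 + e) ^ 5) :=
      ENNReal.continuous_ofReal.comp (by fun_prop)
    have h2 := (h1.tendsto 0).mono_left (nhdsWithin_le_nhds (s := Set.Ioi 0))
    simpa using h2
  refine ge_of_tendsto hlim ?_
  filter_upwards [self_mem_nhdsWithin] with e he
  exact decompNorm_top_le_pow hμ hp he hf hf0 hC hW hD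

/-- For `s = ∞` the pairing with indicators, whose norm in `L^{p',1}` is `p' μ(A)^{1/p'}`, shows
that `f` divided by its dual norm is majorized by `t ↦ t^{-1/p}`. -/
lemma decompNorm_top_le_dualNorm [SigmaFinite μ] (hμ : IsNonatomic μ) (hp : 1 < p)
    (hf : MemLorentz μ p ∞ f) : decompNorm μ p ∞ f ≤ dualNorm μ p ∞ f := by
  have hp0 : 0 < p := by linarith
  have hq := (Real.HolderConjugate.conjExponent hp).symm
  have hfin : dualNorm μ p ∞ f < ∞ := (dualNorm_le_decompNorm hp le_top).trans_lt
    ((decompNorm_le_lorentzNorm hf).trans_lt hf.2)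
  -- it suffices to bound by real numbers `K` above the dual norm; these are positive
  refine le_of_forall_gt_imp_ge_of_dense fun a ha => ?_
  rcases eq_or_ne a ∞ with rfl | hat
  · exact le_top
  obtain ⟨K, hK0, rfl⟩ : ∃ K : ℝ, 0 ≤ K ∧ a = ENNReal.ofReal K :=
    ⟨a.toReal, ENNReal.toReal_nonneg, (ENNReal.ofReal_toReal hat).symm⟩
  have hK : 0 < K := ENNReal.ofReal_pos.1 (zero_le.trans_lt ha)
  set g : R → ℝ := fun x => K⁻¹ * |hf.1.mk f x| with hg
  have hgm : Measurable g := (hf.1.measurable_mk.norm).const_mul _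
  have hg0 : ∀ x, 0 ≤ g x := fun x => by positivity
  have hge : ∀ᵐ x ∂μ, ‖f x‖ₑ = ‖K * g x‖ₑ := by
    filter_upwards [hf.1.ae_eq_mk] with x hx
    simp only [hg]
    rw [mul_inv_cancel_left₀ hK.ne', hx, Real.enorm_abs]
  have hgn : ∀ᵐ x ∂μ, ‖f x‖ₑ = ENNReal.ofReal K * ENNReal.ofReal (g x) := by
    filter_upwards [hge] with x hx
    rw [hx, enorm_mul, Real.enorm_of_nonneg hK.le, Real.enorm_of_nonneg (hg0 x)]
  have hg1 : decompNorm μ p ∞ g ≤ 1 := by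
    obtain ⟨W, hW0, hW⟩ : ∃ W : ℝ, 0 < W ∧ lorentzNorm μ p ∞ g ≤ ENNReal.ofReal W := by
      have h1 : lorentzNorm μ p ∞ g < ∞ := by
        have h2 : lorentzNorm μ p ∞ f = ‖K‖ₑ * lorentzNorm μ p ∞ g := by
          rw [← lorentzNorm_const_mul le_top hK.ne']
          exact lorentzNorm_congr_enorm hge
        have h3 := hf.2
        rw [h2] at h3
        exact ENNReal.lt_top_of_mul_ne_top_right h3.ne (by simpa using hK.ne')
      refine ⟨(lorentzNorm μ p ∞ g).toReal + 1, by positivity, ?_⟩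
      refine (ENNReal.ofReal_toReal h1.ne).ge.trans (ENNReal.ofReal_le_ofReal (by linarith))
    refine decompNorm_top_le_one hμ hp hgm hg0 (C := W ^ p) (by positivity) (fun l hl => ?_)
      fun A hA hAf => ?_
    · refine (measure_lt_le_of_lorentzNorm_top_le hp0 hg0 hW0 hW hl).trans (le_of_eq ?_)
      rw [Real.div_rpow hW0.le hl.le, Real.rpow_neg hl.le, div_eq_mul_inv]
    · have hc1 : (∞ : ℝ≥0∞).conjExponent = 1 := by simp [ENNReal.conjExponent]
      -- the indicator of `A` has norm at most `p' μ(A)^{1/p'}` in `L^{p',1}`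
      have hind : lorentzNorm μ p.conjExponent 1 (A.indicator fun _ => (1 : ℝ)) ≤
          ENNReal.ofReal (p.conjExponent * μ.real A ^ (1 / p.conjExponent)) := by
        refine (lorentzNorm_le_of_bounded hq.pos le_rfl ENNReal.one_ne_top (C := 1) (fun x => ?_)
          (M := μ.real A) measureReal_nonneg ?_).trans (le_of_eq ?_)
        · by_cases hx : x ∈ A <;> simp [hx]
        · rw [measureReal_def, ENNReal.ofReal_toReal hAf]
          exact measure_mono fun x hx => Set.mem_of_indicator_ne_zero hx
        · rw [ENNReal.toReal_one, one_mul, one_div_one, ENNReal.rpow_one]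
          congr 1
          rw [div_eq_mul_inv, one_div, inv_inv, mul_comm]
      have hmem : MemLorentz μ p.conjExponent (∞ : ℝ≥0∞).conjExponent
          (A.indicator fun _ => (1 : ℝ)) := by
        rw [hc1]
        exact ⟨(measurable_const.indicator hA).aemeasurable,
          hind.trans_lt ENNReal.ofReal_lt_top⟩
      have h1 := lintegral_mul_le_dualNorm hp le_top hf hmem
      rw [hc1] at h1
      have h2 : ∫⁻ x, ‖f x‖ₑ * ‖A.indicator (fun _ => (1 : ℝ)) x‖ₑ ∂μ =
          ENNReal.ofReal K * ∫⁻ x in A, ENNReal.ofReal (g x) ∂μ := by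
        rw [← lintegral_const_mul _ hgm.ennreal_ofReal, ← lintegral_indicator hA]
        refine lintegral_congr_ae ?_
        filter_upwards [hgn] with x hx
        by_cases hxA : x ∈ A <;> simp [hxA, hx]
      rw [h2] at h1
      have h3 := h1.trans (mul_le_mul' ha.le hind)
      rwa [ENNReal.mul_le_mul_iff_right (ENNReal.ofReal_pos.2 hK).ne' ENNReal.ofReal_ne_top] at h3
  calc decompNorm μ p ∞ f ≤ decompNorm μ p ∞ (fun x => K * g x) :=
        decompNorm_mono hf.1 (hgm.const_mul K).aemeasurable (hge.mono fun x hx => hx.le)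
    _ ≤ ‖K‖ₑ * decompNorm μ p ∞ g := decompNorm_const_mul_le le_top hK.ne'
    _ ≤ ‖K‖ₑ * 1 := by gcongr
    _ = ENNReal.ofReal K := by rw [mul_one, Real.enorm_of_nonneg hK.le]

end Top

end Lorentz

theorem mainTheorem1 {R : Type*} [MeasurableSpace R] (μ : Measure R) [SigmaFinite μ]
    (hμ : Lorentz.IsNonatomic μ) (p : ℝ) (hp : 1 < p) (s : ℝ≥0∞) (hs : 1 ≤ s)
    (f : R → ℝ) (hf : Lorentz.MemLorentz μ p s f) :
    (∀ g : R → ℝ, Lorentz.MemLorentz μ p.conjExponent s.conjExponent g →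
      Integrable (fun x => f x * g x) μ) ∧
    Lorentz.dualNorm μ p s f = Lorentz.decompNorm μ p s f := by
  refine ⟨fun g hg => Lorentz.MemLorentz.integrable_mul (Real.HolderConjugate.conjExponent hp)
    (ENNReal.HolderConjugate.conjExponent hs) hf hg,
    le_antisymm (Lorentz.dualNorm_le_decompNorm hp hs) ?_⟩
  rcases eq_or_ne s ∞ with rfl | hst
  · exact Lorentz.decompNorm_top_le_dualNorm hμ hp hf
  rcases le_total s (ENNReal.ofReal p) with hsp | hps
  · exact Lorentz.decompNorm_le_dualNorm_of_le hμ hp hs hsp hf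
  · exact Lorentz.decompNorm_le_dualNorm_of_ge hμ hp hps hst hf
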